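/- Notation. $\mathbb{D}^\infty$ denotes the open unit ball of the Banach space $\ell_\infty$ of bounded complex sequences, $\mathbb{N}_0^{(\mathbb{N})}$ and $\mathbb{Z}^{(\mathbb{N})}$ the finitely supported sequences of non-negative integers and of integers, and $z^\alpha=\prod_n z_n^{\alpha_n}$. $H_\infty(\mathbb{D}^\infty)$ is the space of bounded Fréchet complex-differentiable functions $f:\mathbb{D}^\infty\to\mathbb{C}$. For such $f$ and $\alpha\in\mathbb{N}_0^k\subseteq\mathbb{N}_0^{(\mathbb{N})}$ the monomial coefficient is $$c_\alpha(f)=\frac{1}{(2\pi i)^k}\int_{|z_1|=r}\cdots\int_{|z_k|=r}\frac{f(z_1,\dots,z_k,0,0,\dots)}{z_1^{\alpha_1+1}\cdots z_k^{\alpha_k+1}}\,dz_1\cdots dz_k ,$$ which does not depend on $0<r<1$ or on $k$. Let $$\operatorname{mon}H_\infty(\mathbb{D}^\infty)=\Big\{z\in\mathbb{D}^\infty : \forall f\in H_\infty(\mathbb{D}^\infty),\ f(z)=\sum_{\alpha\in\mathbb{N}_0^{(\mathbb{N})}}c_\alpha(f)z^\alpha\ \text{with absolute convergence}\Big\}.$$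 Let $m$ be the countable product on $\mathbb{T}^\infty$ of the normalized Lebesgue measure on the unit circle $\mathbb{T}$, and $\hat f(\alpha)=\int_{\mathbb{T}^\infty}f(w)w^{-\alpha}\,dm(w)$ for $f\in L_p(\mathbb{T}^\infty)$ and $\alpha\in\mathbb{Z}^{(\mathbb{N})}$. For $1\le p\le\infty$ let $H_p(\mathbb{T}^\infty)$ be the space of all $f\in L_p(\mathbb{T}^\infty)$ with $\hat f(\alpha)=0$ for all $\alpha\in\mathbb{Z}^{(\mathbb{N})}\setminus\mathbb{N}_0^{(\mathbb{N})}$, and $$\operatorname{mon}H_p(\mathbb{T}^\infty)=\Big\{z\in\mathbb{D}^\infty : \sum_{\alpha\in\mathbb{N}_0^{(\mathbb{N})}}|\hat f(\alpha)z^\alpha|<\infty\ \text{ for all } f\in H_p(\mathbb{T}^\infty)\Big\}.$$ For $z\in\ell_\infty$ and $n\ge1$ let $z_n^*=\inf\{\sup_{j\in\mathbb{N}\setminus J}|z_j| : J\subseteq\mathbb{N},\ \operatorname{card}J<n\}$, and put $$\mathbf{B}=\Big\{z\in\mathbb{D}^\infty:\limsup_{n\to\infty}\frac{1}{\log n}\sum_{j=1}^n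 z_j^{*2}<1\Big\},\qquad \overline{\mathbf{B}}=\Big\{z\in\mathbb{D}^\infty:\limsup_{n\to\infty}\frac{1}{\log n}\sum_{j=1}^n z_j^{*2}\le1\Big\}$$ (the limsup is taken in $[0,\infty]$). Theorem. (i) $\operatorname{mon}H_\infty(\mathbb{T}^\infty)=\operatorname{mon}H_\infty(\mathbb{D}^\infty)$, and $\frac{1}{\sqrt2}\mathbf{B}\subseteq\operatorname{mon}H_\infty(\mathbb{T}^\infty)\subseteq\overline{\mathbf{B}}$. (ii) For every $1\le p<\infty$, $\operatorname{mon}H_p(\mathbb{T}^\infty)=\ell_2\cap\mathbb{D}^\infty$. -/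

import Mathlib

open MeasureTheory Filter Topology
open scoped ENNReal Pointwise

noncomputable section

/-- The Banach space `ℓ_∞` of bounded complex sequences (indexed from `0`) with the sup norm. -/
abbrev EllInfty : Type := lp (fun _ : ℕ => ℂ) ∞

/-- The infinite dimensional polydisc `𝔻^∞`: the open unit ball of `ℓ_∞`. -/
def polydisc : Set EllInfty := Metric.ball 0 1

/-- The monomial `z^α` for a finitely supported multi-index `α` of non-negative integers. -/
def seqMonomial (z : EllInfty) (α : ℕ →₀ ℕ) : ℂ := α.prod fun i n => z i ^ n

/-! ### Bounded holomorphic functions on the polydisc -/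

/-- `H_∞(𝔻^∞)`: bounded, Fréchet complex-differentiable functions on the open unit ball of `ℓ_∞`.
Functions are total on `ℓ_∞`; their values off the ball play no role. -/
def HInftyPolydisc : Set (EllInfty → ℂ) :=
  {f | DifferentiableOn ℂ f polydisc ∧ ∃ C : ℝ, ∀ z ∈ polydisc, ‖f z‖ ≤ C}

/-- The embedding `ℂ^k → ℓ_∞`, `(z_0, …, z_{k-1}) ↦ (z_0, …, z_{k-1}, 0, 0, …)`. -/
def embedFin (k : ℕ) (z : Fin k → ℂ) : EllInfty :=
  ∑ i : Fin k, lp.single ∞ (i : ℕ) (z i)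

/-- The least `k` such that `α` vanishes at all indices `≥ k`, that is, `α ∈ ℕ₀^k`. -/
def multiIndexLength (α : ℕ →₀ ℕ) : ℕ := α.support.sup Nat.succ

/-- The monomial coefficient `c_α(f)`, by the Cauchy integral formula on the torus of radius `1/2`
in `ℂ^k`, where `k = multiIndexLength α`:
`c_α(f) = (2πi)^{-k} ∫_{|z_0| = 1/2} ⋯ ∫_{|z_{k-1}| = 1/2} f(z) / z^{α+1} dz`. -/
def monomialCoeff (f : EllInfty → ℂ) (α : ℕ →₀ ℕ) : ℂ :=
  ((2 * (Real.pi : ℂ) * Complex.I) ^ multiIndexLength α)⁻¹ *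
    torusIntegral
      (fun z : Fin (multiIndexLength α) → ℂ =>
        f (embedFin (multiIndexLength α) z) / ∏ i, z i ^ (α (i : ℕ) + 1))
      0 (fun _ => 1 / 2)

/-- `mon H_∞(𝔻^∞)`: the points `z` of the polydisc such that, for every bounded holomorphic `f`,
the monomial series of `f` at `z` converges absolutely, and its sum is `f z`. -/
def monHInftyPolydisc : Set EllInfty :=
  {z | z ∈ polydisc ∧ ∀ f ∈ HInftyPolydisc,
    (Summable fun α : ℕ →₀ ℕ => ‖monomialCoeff f α * seqMonomial z α‖) ∧
      HasSum (fun α : ℕ →₀ ℕ => monomialCoeff f α * seqMonomial z α) (f z)}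

/-! ### Hardy spaces on the infinite dimensional polytorus -/

instance instMeasurableSpaceCircle : MeasurableSpace Circle := borel Circle

instance instBorelSpaceCircle : BorelSpace Circle := ⟨rfl⟩

/-- The normalized Lebesgue measure on the unit circle `𝕋`: the image of the normalized Haar
measure on `ℝ/ℤ` (that is, Lebesgue measure) under `t ↦ e^{2πit}`. -/
def circleMeasure : Measure Circle :=
  (AddCircle.haarAddCircle (T := 1)).map AddCircle.toCircle

instance instIsProbabilityMeasureCircleMeasure : IsProbabilityMeasure circleMeasure :=
  Measure.isProbabilityMeasure_map AddCircle.continuous_toCircle.measurable.aemeasurable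

/-- The measure `m` on `𝕋^∞ = ∏_{n ∈ ℕ} 𝕋`: the product of the normalized Lebesgue measures. -/
def polytorusMeasure : Measure (ℕ → Circle) := Measure.infinitePi fun _ => circleMeasure

/-- The Fourier coefficient `f̂(α) = ∫ f(w) w^{-α} dm(w)`, for `α ∈ ℤ^(ℕ)`. -/
def polytorusFourierCoeff (f : (ℕ → Circle) → ℂ) (α : ℕ →₀ ℤ) : ℂ :=
  ∫ w, f w * α.prod (fun i n => (w i : ℂ) ^ (-n)) ∂polytorusMeasure

/-- The Hardy space `H_p(𝕋^∞)`: those `f ∈ L_p(𝕋^∞)` with `f̂(α) = 0` for every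
`α ∈ ℤ^(ℕ)` that has a negative entry. -/
def hardySpace (p : ℝ≥0∞) : Set (Lp ℂ p polytorusMeasure) :=
  {f | ∀ α : ℕ →₀ ℤ, (∃ i, α i < 0) → polytorusFourierCoeff f α = 0}

/-- `mon H_p(𝕋^∞)`: the points `z` of the polydisc such that `∑_α |f̂(α) z^α| < ∞`, the sum being
over all `α ∈ ℕ₀^(ℕ)`, for every `f ∈ H_p(𝕋^∞)`. -/
def monHardy (p : ℝ≥0∞) : Set EllInfty :=
  {z | z ∈ polydisc ∧ ∀ f ∈ hardySpace p,
    Summable fun α : ℕ →₀ ℕ =>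
      ‖polytorusFourierCoeff f (α.mapRange (fun n : ℕ => (n : ℤ)) Nat.cast_zero) *
        seqMonomial z α‖}

/-! ### The sets defined through the decreasing rearrangement -/

/-- The decreasing rearrangement `z*_n = inf {sup_{j ∉ J} |z_j| : J ⊆ ℕ, card J < n}`, `n ≥ 1`. -/
def decreasingRearrangement (z : EllInfty) (n : ℕ) : ℝ :=
  ⨅ J : {J : Finset ℕ // J.card < n}, ⨆ j : {j : ℕ // j ∉ J.1}, ‖z j‖

/-- `limsup_n (1 / log n) ∑_{j=1}^n (z*_j)²`, as an extended real number. -/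
def logLimsup (z : EllInfty) : EReal :=
  limsup (fun n : ℕ =>
    ((1 / Real.log n * ∑ j ∈ Finset.Icc 1 n, decreasingRearrangement z j ^ 2 : ℝ) : EReal)) atTop

/-- The set `B`. -/
def setB : Set EllInfty := {z | z ∈ polydisc ∧ logLimsup z < 1}

/-- The set `B̄`, defined by the weak inequality (it is not a norm closure). -/
def setBbar : Set EllInfty := {z | z ∈ polydisc ∧ logLimsup z ≤ 1}

end

noncomputable section

/-! ### Characters of the polytorus -/

/-! The engine is Carleman's inequality in `sum_fourierCoeff_sq_div_divisorWeight_le`: for f in H_1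
the sum of |f̂(α)|²/∏(α_i+1) is at most ‖f‖_1². On the circle one factors f = gh with |g|² = |h|² =
|f| and applies Cauchy–Schwarz to the Cauchy product. The constant is 1, so the inequality passes to
several variables by Minkowski, and Fejér means carry it from polynomials to H_1.

Finite p. If z ∈ ℓ_2, Cauchy–Schwarz against Carleman's weights leaves ∑ ∏(α_i+1)|z^α|² ≤
∏(1-|z_i|²)^{-2} < ∞. Conversely, Banach–Steinhaus bounds ∑|c_α(Q) z^α| by C‖Q‖_p for all
polynomials Q (`exists_bound_of_mem_monHardy`). For linear Q with coefficients conj z_i,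
Khinchine–Steinhaus compares ‖Q‖_p with the ℓ_2 norm of the coefficients, which bounds ∑|z_i|².

Upper inclusion in H_∞. The same uniform bound is tested on random polynomials with |c_α| = |z^α|,
|α| = m, in n variables. A moment estimate and a Nikolskii inequality bound their sup norms, giving
(∑|z_i|²)^m ≤ m!·n·poly(m) once n ≤ e^m. As m! is about (m/e)^m, taking m = ⌈log n⌉ gives ∑|z_i|² ≤
(1+o(1)) log n.

Lower inclusion. Let z = y/√2 with y ∈ B. Nonzero α are grouped by the coordinate j of their support
at which |y_j| is smallest, and α = β + e_j. Carleman's inequality for the dilated derivative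
∂_jQ(r·), with ∏(β_i+1) ≤ 2^{|β|}, bounds the weighted ℓ_2 norm of a block of coefficients by
‖∂_jQ(r·)‖_1; the 2^{|β|} is what 1/√2 pays for. These norms sum to at most C/(1-r) over j, because
∑_j|∂_jQ| is a directional derivative in ℓ_∞. The remaining factor |y_j|²∏(1-|y_i|²/r²)^{-1} is
bounded by `exists_product_bound`, the only place where the strict inequality defining B enters.

Equality of the two H_∞ sets. Both spaces have the same coefficient families. The Fejér means of the
monomial series of a bounded holomorphic f are bounded on the polytorus, so they converge in L_2 to
a function in H_∞(𝕋^∞). In the other direction, Fejér means of F are bounded on the polydisc by the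
maximum principle, and an ultralimit of them is holomorphic with the right coefficients. The sum of
the series is f(z) because points of mon H_∞ are null sequences, by the upper inclusion, so
truncations of z converge to z in norm. -/

lemma continuous_circle_coe : Continuous fun w : Circle => (w : ℂ) := continuous_subtype_val

lemma integral_circle_zpow (n : ℤ) :
    ∫ w : Circle, (w : ℂ) ^ n ∂circleMeasure = if n = 0 then 1 else 0 := by
  have : Fact ((0 : ℝ) < 1) := ⟨one_pos⟩
  rw [circleMeasure, integral_map AddCircle.continuous_toCircle.measurable.aemeasurable]
  · have h1 : ∀ t : AddCircle (1 : ℝ), ((AddCircle.toCircle t : Circle) : ℂ) ^ n = fourier n t := by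
      intro t
      rw [fourier_apply, AddCircle.toCircle_zsmul, Circle.coe_zpow]
    simp_rw [h1]
    split_ifs with h
    · subst h; simp
    -- For n ≠ 0, translation by half a period of the character changes its sign, while Haar measure
    -- is invariant.
    · exact integral_eq_zero_of_add_right_eq_neg (μ := AddCircle.haarAddCircle)
        (fun x => fourier_add_half_inv_index h one_pos x)
  · refine Continuous.aestronglyMeasurable ?_
    exact continuous_iff_continuousAt.2 fun x =>
      (continuous_circle_coe.continuousAt).zpow₀ n (Or.inl (Circle.coe_ne_zero x))

/-- The character `w ↦ w^n` of the polytorus. -/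
def torusChar (n : ℕ →₀ ℤ) (w : ℕ → Circle) : ℂ := n.prod fun i k => (w i : ℂ) ^ k

/-- The point of `ℂ^ℕ` with the given unimodular coordinates. -/
def torusPoint (w : ℕ → Circle) : ℕ → ℂ := fun i => (w i : ℂ)

/-- The inclusion `ℕ₀^(ℕ) ⊆ ℤ^(ℕ)`. -/
def natExp (α : ℕ →₀ ℕ) : ℕ →₀ ℤ := α.mapRange (fun n : ℕ => (n : ℤ)) Nat.cast_zero

lemma natExp_apply (α : ℕ →₀ ℕ) (i : ℕ) : natExp α i = α i := by simp [natExp]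

lemma natExp_injective : Function.Injective natExp :=
  Finsupp.mapRange_injective _ Nat.cast_zero Nat.cast_injective

lemma natExp_add (α β : ℕ →₀ ℕ) : natExp (α + β) = natExp α + natExp β := by
  ext i; simp [natExp_apply]

lemma torusChar_eq_prod (n : ℕ →₀ ℤ) (w : ℕ → Circle) {s : Finset ℕ} (h : n.support ⊆ s) :
    torusChar n w = ∏ i ∈ s, (w i : ℂ) ^ n i :=
  Finsupp.prod_of_support_subset _ h _ fun _ _ => zpow_zero _

lemma torusChar_zero (w : ℕ → Circle) : torusChar 0 w = 1 := by simp [torusChar]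

lemma torusChar_add (m n : ℕ →₀ ℤ) (w : ℕ → Circle) :
    torusChar (m + n) w = torusChar m w * torusChar n w := by
  classical
  exact Finsupp.prod_add_index' (fun _ => zpow_zero _) fun i a b => zpow_add₀ (Circle.coe_ne_zero _) a b

lemma norm_torusChar (n : ℕ →₀ ℤ) (w : ℕ → Circle) : ‖torusChar n w‖ = 1 := by
  rw [torusChar, Finsupp.prod, norm_prod]
  exact Finset.prod_eq_one fun i _ => by rw [norm_zpow, Circle.norm_coe, one_zpow]

lemma torusChar_neg (n : ℕ →₀ ℤ) (w : ℕ → Circle) :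
    torusChar (-n) w = (starRingEnd ℂ) (torusChar n w) := by
  have h : torusChar n w * torusChar (-n) w = 1 := by
    rw [← torusChar_add, add_neg_cancel, torusChar_zero]
  have h2 : torusChar n w * (starRingEnd ℂ) (torusChar n w) = 1 := by
    rw [Complex.mul_conj, Complex.normSq_eq_norm_sq, norm_torusChar]; simp
  have h3 : torusChar n w ≠ 0 := left_ne_zero_of_mul_eq_one h
  exact mul_left_cancel₀ h3 (h.trans h2.symm)

lemma torusChar_mul (n : ℕ →₀ ℤ) (v w : ℕ → Circle) :
    torusChar n (v * w) = torusChar n v * torusChar n w := by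
  simp [torusChar, Finsupp.prod, mul_zpow, Finset.prod_mul_distrib]

lemma torusChar_inv (n : ℕ →₀ ℤ) (w : ℕ → Circle) : torusChar n w⁻¹ = torusChar (-n) w := by
  rw [torusChar_eq_prod n _ subset_rfl, torusChar_eq_prod (-n) w (by simp : _ ⊆ n.support)]
  simp

lemma continuous_torusChar (n : ℕ →₀ ℤ) : Continuous (torusChar n) := by
  refine continuous_finsetProd _ fun i _ => ?_
  exact continuous_iff_continuousAt.2 fun x =>
    ((continuous_circle_coe.comp (continuous_apply i)).continuousAt).zpow₀ _
      (Or.inl (Circle.coe_ne_zero _))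

lemma integral_torusChar (n : ℕ →₀ ℤ) :
    ∫ w, torusChar n w ∂polytorusMeasure = if n = 0 then 1 else 0 := by
  have hc : Continuous fun y : n.support → Circle => ∏ i, (y i : ℂ) ^ n i :=
    continuous_finsetProd _ fun i _ => continuous_iff_continuousAt.2 fun x =>
      ((continuous_circle_coe.comp (continuous_apply i)).continuousAt).zpow₀ _
        (Or.inl (Circle.coe_ne_zero _))
  have h1 := integral_restrict_infinitePi (μ := fun _ : ℕ => circleMeasure) (s := n.support)
    (f := fun y : n.support → Circle => ∏ i, (y i : ℂ) ^ n i) hc.aestronglyMeasurable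
  have h2 : ∀ w : ℕ → Circle, torusChar n w =
      (fun y : n.support → Circle => ∏ i, (y i : ℂ) ^ n i) (n.support.restrict w) := by
    intro w
    rw [torusChar_eq_prod n w subset_rfl, ← Finset.prod_coe_sort]
    rfl
  refine (integral_congr_ae (ae_of_all _ h2)).trans (h1.trans ?_)
  rw [integral_fintype_prod_eq_prod (μ := fun _ : n.support => circleMeasure)
    (f := fun (i : n.support) (x : Circle) => (x : ℂ) ^ n i)]
  simp_rw [integral_circle_zpow]
  split_ifs with h
  · subst h; simp
  · obtain ⟨i, hi⟩ := Finsupp.support_nonempty_iff.2 h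
    exact Finset.prod_eq_zero (Finset.mem_univ ⟨i, hi⟩) (if_neg (Finsupp.mem_support_iff.1 hi))

instance instIsProbabilityMeasurePolytorus : IsProbabilityMeasure polytorusMeasure := by
  unfold polytorusMeasure; infer_instance

lemma integrable_of_continuous_polytorus {E : Type*} [NormedAddCommGroup E]
    [SecondCountableTopologyEither (ℕ → Circle) E] {f : (ℕ → Circle) → E} (hf : Continuous f) :
    Integrable f polytorusMeasure := by
  obtain ⟨C, hC⟩ := (isCompact_range hf).isBounded.exists_norm_le
  exact Integrable.of_bound hf.aestronglyMeasurable C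
    (ae_of_all _ fun w => hC _ (Set.mem_range_self w))

lemma integral_torusChar_mul_conj (m n : ℕ →₀ ℤ) :
    ∫ w, torusChar m w * (starRingEnd ℂ) (torusChar n w) ∂polytorusMeasure =
      if m = n then 1 else 0 := by
  simp_rw [← torusChar_neg, ← torusChar_add, integral_torusChar, ← sub_eq_add_neg, sub_eq_zero]

/-- Parseval's identity for trigonometric polynomials. -/
lemma integral_norm_sq_sum_torusChar {ι : Type*} (A : Finset ι) (c : ι → ℂ) (e : ι → ℕ →₀ ℤ)
    (he : Set.InjOn e A) :
    ∫ w, ‖∑ a ∈ A, c a * torusChar (e a) w‖ ^ 2 ∂polytorusMeasure = ∑ a ∈ A, ‖c a‖ ^ 2 := by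
  classical
  have h1 : ∀ w, ((‖∑ a ∈ A, c a * torusChar (e a) w‖ ^ 2 : ℝ) : ℂ) =
      ∑ a ∈ A, ∑ b ∈ A, c a * (starRingEnd ℂ) (c b) *
        (torusChar (e a) w * (starRingEnd ℂ) (torusChar (e b) w)) := by
    intro w
    rw [← Complex.normSq_eq_norm_sq, ← Complex.mul_conj, map_sum, Finset.sum_mul_sum]
    refine Finset.sum_congr rfl fun a _ => Finset.sum_congr rfl fun b _ => ?_
    rw [map_mul]; ring
  have h2 : ∀ a b, Integrable (fun w => c a * (starRingEnd ℂ) (c b) *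
        (torusChar (e a) w * (starRingEnd ℂ) (torusChar (e b) w))) polytorusMeasure := fun a b =>
    integrable_of_continuous_polytorus (continuous_const.mul ((continuous_torusChar _).mul
      (Complex.continuous_conj.comp (continuous_torusChar _))))
  have h3 : ((∫ w, ‖∑ a ∈ A, c a * torusChar (e a) w‖ ^ 2 ∂polytorusMeasure : ℝ) : ℂ) =
      ((∑ a ∈ A, ‖c a‖ ^ 2 : ℝ) : ℂ) := by
    rw [← integral_complex_ofReal]
    simp_rw [h1]
    rw [integral_finsetSum _ fun a _ => integrable_finsetSum _ fun b _ => h2 a b]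
    push_cast
    refine Finset.sum_congr rfl fun a ha => ?_
    rw [integral_finsetSum _ fun b _ => h2 a b]
    simp_rw [integral_const_mul, integral_torusChar_mul_conj]
    rw [Finset.sum_eq_single a]
    · simp [Complex.mul_conj, Complex.normSq_eq_norm_sq]
    · intro b hb hba
      rw [if_neg (fun h => hba (he hb ha h.symm)), mul_zero]
    · exact fun h => absurd ha h
  exact_mod_cast h3

/-! ### Polynomials on the polytorus -/

lemma prod_torusPoint (α : ℕ →₀ ℕ) (w : ℕ → Circle) :
    (α.prod fun i n => torusPoint w i ^ n) = torusChar (natExp α) w := by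
  rw [torusChar_eq_prod (natExp α) w (s := α.support) (by intro i; simp [natExp_apply])]
  simp [Finsupp.prod, natExp_apply, torusPoint]

lemma eval_torusPoint (Q : MvPolynomial ℕ ℂ) (w : ℕ → Circle) :
    MvPolynomial.eval (torusPoint w) Q =
      ∑ α ∈ Q.support, Q.coeff α * torusChar (natExp α) w := by
  rw [MvPolynomial.eval_eq]
  refine Finset.sum_congr rfl fun α _ => ?_
  rw [← prod_torusPoint, Finsupp.prod]

lemma continuous_torusPoint : Continuous torusPoint :=
  continuous_pi fun i => continuous_circle_coe.comp (continuous_apply i)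

lemma continuous_eval_torusPoint (Q : MvPolynomial ℕ ℂ) :
    Continuous fun w => MvPolynomial.eval (torusPoint w) Q :=
  (MvPolynomial.continuous_eval Q).comp continuous_torusPoint

lemma integral_norm_sq_eval (Q : MvPolynomial ℕ ℂ) :
    ∫ w, ‖MvPolynomial.eval (torusPoint w) Q‖ ^ 2 ∂polytorusMeasure =
      ∑ α ∈ Q.support, ‖Q.coeff α‖ ^ 2 := by
  simp_rw [eval_torusPoint]
  exact integral_norm_sq_sum_torusChar _ _ _ natExp_injective.injOn

lemma polytorusFourierCoeff_eq (f : (ℕ → Circle) → ℂ) (n : ℕ →₀ ℤ) :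
    polytorusFourierCoeff f n = ∫ w, f w * torusChar (-n) w ∂polytorusMeasure := by
  refine integral_congr_ae (ae_of_all _ fun w => ?_)
  show _ * _ = _ * _
  rw [torusChar_eq_prod (-n) w (by simp : _ ⊆ n.support)]
  simp [Finsupp.prod]

lemma polytorusFourierCoeff_sum_torusChar {ι : Type*} (A : Finset ι) (c : ι → ℂ)
    (e : ι → ℕ →₀ ℤ) (n : ℕ →₀ ℤ) :
    polytorusFourierCoeff (fun w => ∑ a ∈ A, c a * torusChar (e a) w) n =
      ∑ a ∈ A, if e a = n then c a else 0 := by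
  rw [polytorusFourierCoeff_eq]
  simp_rw [Finset.sum_mul, mul_assoc, torusChar_neg]
  have hi : ∀ a ∈ A, Integrable (fun w => c a *
      (torusChar (e a) w * (starRingEnd ℂ) (torusChar n w))) polytorusMeasure := fun a _ =>
    integrable_of_continuous_polytorus (continuous_const.mul ((continuous_torusChar _).mul
      (Complex.continuous_conj.comp (continuous_torusChar _))))
  rw [integral_finsetSum _ hi]
  refine Finset.sum_congr rfl fun a _ => ?_
  rw [integral_const_mul, integral_torusChar_mul_conj]
  simp

lemma polytorusFourierCoeff_eval (Q : MvPolynomial ℕ ℂ) (α : ℕ →₀ ℕ) :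
    polytorusFourierCoeff (fun w => MvPolynomial.eval (torusPoint w) Q) (natExp α) =
      Q.coeff α := by
  classical
  simp_rw [eval_torusPoint, polytorusFourierCoeff_sum_torusChar, natExp_injective.eq_iff]
  simp [Finset.sum_ite_eq']
  exact fun h => h.symm

lemma polytorusFourierCoeff_eval_of_neg (Q : MvPolynomial ℕ ℂ) {n : ℕ →₀ ℤ} (hn : ∃ i, n i < 0) :
    polytorusFourierCoeff (fun w => MvPolynomial.eval (torusPoint w) Q) n = 0 := by
  classical
  obtain ⟨i, hi⟩ := hn
  simp_rw [eval_torusPoint, polytorusFourierCoeff_sum_torusChar]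
  refine Finset.sum_eq_zero fun α _ => if_neg fun h => ?_
  rw [← h, natExp_apply] at hi
  exact absurd hi (by simp)

lemma polytorusFourierCoeff_congr_ae {f g : (ℕ → Circle) → ℂ} (h : f =ᵐ[polytorusMeasure] g)
    (n : ℕ →₀ ℤ) : polytorusFourierCoeff f n = polytorusFourierCoeff g n :=
  integral_congr_ae (h.mono fun w hw => by simp only [hw])

lemma norm_polytorusFourierCoeff_le (f : (ℕ → Circle) → ℂ) (n : ℕ →₀ ℤ) :
    ‖polytorusFourierCoeff f n‖ ≤ ∫ w, ‖f w‖ ∂polytorusMeasure := by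
  rw [polytorusFourierCoeff_eq]
  refine (norm_integral_le_integral_norm _).trans_eq ?_
  simp [norm_torusChar]

/-! ### Absolutely convergent power series on the circle -/

lemma integral_eval_polytorus {E : Type*} [NormedAddCommGroup E] [NormedSpace ℝ E]
    {f : Circle → E} (hf : AEStronglyMeasurable f circleMeasure) (i : ℕ) :
    ∫ w, f (w i) ∂polytorusMeasure = ∫ t, f t ∂circleMeasure := by
  have h := measurePreserving_eval_infinitePi (μ := fun _ : ℕ => circleMeasure) i
  have h2 := integral_map h.measurable.aemeasurable (by rwa [h.map_eq] : AEStronglyMeasurable f _)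
  rw [h.map_eq] at h2
  exact h2.symm

lemma continuous_circle_sum (b : ℕ → ℂ) (N : ℕ) :
    Continuous fun w : Circle => ∑ n ∈ Finset.range N, b n * (w : ℂ) ^ n :=
  continuous_finsetSum _ fun n _ => continuous_const.mul (continuous_circle_coe.pow n)

lemma integral_norm_sq_circle_sum (b : ℕ → ℂ) (N : ℕ) :
    ∫ w : Circle, ‖∑ n ∈ Finset.range N, b n * (w : ℂ) ^ n‖ ^ 2 ∂circleMeasure =
      ∑ n ∈ Finset.range N, ‖b n‖ ^ 2 := by
  refine (integral_eval_polytorus (f := fun t : Circle =>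
    ‖∑ n ∈ Finset.range N, b n * (t : ℂ) ^ n‖ ^ 2)
    ((continuous_circle_sum b N).norm.pow 2).aestronglyMeasurable 0).symm.trans ?_
  rw [← integral_norm_sq_sum_torusChar (Finset.range N) b (fun n => Finsupp.single 0 (n : ℤ))]
  · simp [torusChar]
  · intro a _ b _ h
    simpa using (Finsupp.single_injective 0) h

lemma hasSum_norm_sq_of_hasSum {b : ℕ → ℂ} {g : Circle → ℂ} (hb : Summable fun n => ‖b n‖)
    (hg : ∀ w : Circle, HasSum (fun n => b n * (w : ℂ) ^ n) (g w)) :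
    HasSum (fun n => ‖b n‖ ^ 2) (∫ w, ‖g w‖ ^ 2 ∂circleMeasure) := by
  rw [hasSum_iff_tendsto_nat_of_nonneg (fun n => by positivity)]
  simp_rw [← integral_norm_sq_circle_sum]
  refine tendsto_integral_of_dominated_convergence (fun _ => (∑' n, ‖b n‖) ^ 2) ?_ ?_ ?_ ?_
  · exact fun N => ((continuous_circle_sum b N).norm.pow 2).aestronglyMeasurable
  · exact integrable_const _
  · refine fun N => ae_of_all _ fun w => ?_
    rw [norm_pow, norm_norm]
    refine pow_le_pow_left₀ (norm_nonneg _) ?_ 2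
    refine (norm_sum_le _ _).trans ?_
    simp only [norm_mul, norm_pow, Circle.norm_coe, one_pow, mul_one]
    exact hb.sum_le_tsum _ fun _ _ => norm_nonneg _
  · exact ae_of_all _ fun w => ((hg w).tendsto_sum_nat.norm).pow 2

/-- Holomorphy slightly beyond the unit disc gives a radius of convergence above 1, hence absolute
convergence on the circle itself. -/
lemma exists_summable_coeff_of_differentiableOn {g : ℂ → ℂ} {R : ℝ} (hR : 1 < R)
    (hg : DifferentiableOn ℂ g (Metric.ball 0 R)) :
    ∃ b : ℕ → ℂ, (Summable fun n => ‖b n‖) ∧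
      ∀ w : Circle, HasSum (fun n => b n * (w : ℂ) ^ n) (g w) := by
  obtain ⟨r, hr1, hrR⟩ := exists_between hR
  lift r to NNReal using by linarith
  have hr1' : (1 : NNReal) < r := by exact_mod_cast hr1
  have h := (hg.mono (Metric.closedBall_subset_ball hrR)).hasFPowerSeriesOnBall
    (zero_lt_one.trans hr1')
  set p := cauchyPowerSeries g 0 r
  refine ⟨p.coeff, ?_, fun w => ?_⟩
  · have := p.summable_norm_mul_pow (r := 1) (lt_of_lt_of_le (by exact_mod_cast hr1') h.r_le)
    simpa [FormalMultilinearSeries.norm_apply_eq_norm_coef] using this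
  · have := h.hasSum (y := (w : ℂ)) (by
      simp only [Metric.mem_eball, edist_zero_right]
      rw [← ofReal_norm, Circle.norm_coe]
      simpa using hr1')
    simpa [FormalMultilinearSeries.apply_eq_pow_smul_coeff, mul_comm] using this

/-! ### Balanced factorization and Carleman's inequality on the circle. -/

/-- A function on the circle that is the product of two functions, holomorphic near the closed
disc, both of modulus `√|f|` on the circle. -/
def HasBalancedFactorization (f : ℂ → ℂ) : Prop :=
  ∃ R : ℝ, 1 < R ∧ ∃ g h : ℂ → ℂ, DifferentiableOn ℂ g (Metric.ball 0 R) ∧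
    DifferentiableOn ℂ h (Metric.ball 0 R) ∧ ∀ w : Circle, f w = g w * h w ∧
      ‖g w‖ ^ 2 = ‖f w‖ ∧ ‖h w‖ ^ 2 = ‖f w‖

lemma HasBalancedFactorization.mul {f₁ f₂ : ℂ → ℂ} (h₁ : HasBalancedFactorization f₁)
    (h₂ : HasBalancedFactorization f₂) : HasBalancedFactorization fun z => f₁ z * f₂ z := by
  obtain ⟨R₁, hR₁, g₁, k₁, hg₁, hk₁, H₁⟩ := h₁
  obtain ⟨R₂, hR₂, g₂, k₂, hg₂, hk₂, H₂⟩ := h₂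
  have s₁ : Metric.ball (0 : ℂ) (min R₁ R₂) ⊆ Metric.ball 0 R₁ :=
    Metric.ball_subset_ball (min_le_left _ _)
  have s₂ : Metric.ball (0 : ℂ) (min R₁ R₂) ⊆ Metric.ball 0 R₂ :=
    Metric.ball_subset_ball (min_le_right _ _)
  refine ⟨min R₁ R₂, lt_min hR₁ hR₂, fun z => g₁ z * g₂ z, fun z => k₁ z * k₂ z,
    (hg₁.mono s₁).mul (hg₂.mono s₂), (hk₁.mono s₁).mul (hk₂.mono s₂), fun w => ⟨?_, ?_, ?_⟩⟩
  · simp only [(H₁ w).1, (H₂ w).1]; ring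
  · simp only [norm_mul, mul_pow, (H₁ w).2.1, (H₂ w).2.1]
  · simp only [norm_mul, mul_pow, (H₁ w).2.2, (H₂ w).2.2]

lemma hasBalancedFactorization_const (c : ℂ) : HasBalancedFactorization fun _ => c := by
  refine ⟨2, one_lt_two, fun _ => c ^ ((2 : ℕ)⁻¹ : ℂ), fun _ => c ^ ((2 : ℕ)⁻¹ : ℂ),
    differentiableOn_const _, differentiableOn_const _, fun w => ?_⟩
  have h := Complex.cpow_nat_inv_pow c two_ne_zero
  refine ⟨by rw [← sq, h], ?_, ?_⟩ <;> rw [← norm_pow, h]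

/-- Holomorphic square roots of `1 - a z` near the closed disc, for `|a| < 1`. -/
lemma exists_sqrt_one_sub_mul {a : ℂ} (ha : ‖a‖ < 1) :
    ∃ R : ℝ, 1 < R ∧ (∀ z ∈ Metric.ball (0 : ℂ) R, 1 - a * z ≠ 0) ∧
      ∃ s : ℂ → ℂ, DifferentiableOn ℂ s (Metric.ball 0 R) ∧ ∀ z, s z ^ 2 = 1 - a * z := by
  obtain ⟨R, hR1, hRa⟩ : ∃ R : ℝ, 1 < R ∧ ‖a‖ * R < 1 := by
    rcases eq_or_ne a 0 with rfl | h
    · exact ⟨2, one_lt_two, by simp⟩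
    · have hp := norm_pos_iff.2 h
      obtain ⟨R, h1, h2⟩ := exists_between ((one_lt_inv₀ hp).2 ha)
      exact ⟨R, h1, by rwa [mul_comm, ← lt_div_iff₀ hp, one_div]⟩
  -- Positive real part keeps 1 - az off the branch cut, so the principal square root is holomorphic
  -- on the ball.
  have hre : ∀ z ∈ Metric.ball (0 : ℂ) R, 0 < (1 - a * z).re := by
    intro z hz
    have hz' : ‖z‖ < R := by simpa using hz
    have : (a * z).re < 1 := by
      refine (Complex.re_le_norm _).trans_lt ?_
      rw [norm_mul]
      exact (mul_le_mul_of_nonneg_left hz'.le (norm_nonneg _)).trans_lt hRa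
    simpa using this
  refine ⟨R, hR1, fun z hz h0 => ?_, fun z => (1 - a * z) ^ ((2 : ℕ)⁻¹ : ℂ), ?_,
    fun z => Complex.cpow_nat_inv_pow _ two_ne_zero⟩
  · have := hre z hz
    rw [h0] at this
    simp at this
  · intro z hz
    refine DifferentiableWithinAt.cpow_const ?_ (Or.inl (hre z hz))
    exact ((differentiable_const _).sub ((differentiable_const _).mul differentiable_id)
      ).differentiableAt.differentiableWithinAt

lemma hasBalancedFactorization_one_sub_mul {a : ℂ} (ha : ‖a‖ < 1) :
    HasBalancedFactorization fun z => 1 - a * z := by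
  obtain ⟨R, hR, -, s, hs, h⟩ := exists_sqrt_one_sub_mul ha
  refine ⟨R, hR, s, s, hs, hs, fun w => ?_⟩
  have e := h (w : ℂ)
  exact ⟨by rw [← sq, e], by rw [← norm_pow, e], by rw [← norm_pow, e]⟩

lemma norm_circle_sub_eq (a : ℂ) (w : Circle) :
    ‖(w : ℂ) - a‖ = ‖1 - (starRingEnd ℂ) a * w‖ := by
  have h1 : 1 - (starRingEnd ℂ) a * w = (starRingEnd ℂ) ((w : ℂ) - a) * w := by
    have : (starRingEnd ℂ) (w : ℂ) * w = 1 := by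
      rw [mul_comm, Complex.mul_conj, Circle.normSq_coe]; simp
    rw [map_sub, sub_mul, this]
  rw [h1, norm_mul, Circle.norm_coe, mul_one, RCLike.norm_conj]

/-- If |a| < 1, then z - a is 1 - āz times a Blaschke factor of modulus 1 on the circle; the square
root of the zero-free part is shared and the Blaschke factor is given to one side. If |a| > 1, then
z - a = -a(1 - z/a) has no zero in the closed disc. For |a| = 1 the square root would branch on the
circle, whence the hypothesis. -/
lemma hasBalancedFactorization_sub {a : ℂ} (ha : ‖a‖ ≠ 1) :
    HasBalancedFactorization fun z => z - a := by
  rcases lt_or_gt_of_ne ha with h | h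
  · have h' : ‖(starRingEnd ℂ) a‖ < 1 := by rwa [RCLike.norm_conj]
    obtain ⟨R, hR, hne, s, hs, hsq⟩ := exists_sqrt_one_sub_mul h'
    have hd : DifferentiableOn ℂ (fun z : ℂ => (z - a) / (1 - (starRingEnd ℂ) a * z))
        (Metric.ball 0 R) :=
      ((differentiable_id.sub (differentiable_const _)).differentiableOn).fun_div
        (((differentiable_const _).sub ((differentiable_const _).mul
          differentiable_id)).differentiableOn) hne
    refine ⟨R, hR, s, fun z => s z * ((z - a) / (1 - (starRingEnd ℂ) a * z)), hs, hs.mul hd,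
      fun w => ?_⟩
    have hw : (1 - (starRingEnd ℂ) a * (w : ℂ)) ≠ 0 := hne _ (by simpa [Circle.norm_coe] using hR)
    refine ⟨?_, ?_, ?_⟩
    · rw [← mul_assoc, ← sq, hsq, mul_div_cancel₀ _ hw]
    · rw [← norm_pow, hsq, norm_circle_sub_eq]
    · rw [norm_mul, norm_div, norm_circle_sub_eq, div_self (norm_ne_zero_iff.2 hw), mul_one,
        ← norm_pow, hsq]
  · have h0 : a ≠ 0 := by rintro rfl; simp at h; linarith
    have h' : ‖a⁻¹‖ < 1 := by rw [norm_inv]; exact inv_lt_one_of_one_lt₀ h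
    have := (hasBalancedFactorization_const (-a)).mul (hasBalancedFactorization_one_sub_mul h')
    convert this using 2 with z
    field_simp
    ring

lemma hasBalancedFactorization_polynomial (f : Polynomial ℂ)
    (hf : ∀ a ∈ f.roots, ‖a‖ ≠ 1) : HasBalancedFactorization fun z => f.eval z := by
  have key : ∀ s : Multiset ℂ, (∀ a ∈ s, ‖a‖ ≠ 1) →
      HasBalancedFactorization fun z => (s.map fun a => z - a).prod := by
    intro s
    induction s using Multiset.induction with
    | empty => intro _; simpa using hasBalancedFactorization_const 1
    | cons a s ih =>
      intro h
      simp only [Multiset.map_cons, Multiset.prod_cons]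
      exact (hasBalancedFactorization_sub (h a (Multiset.mem_cons_self a s))).mul
        (ih fun b hb => h b (Multiset.mem_cons_of_mem hb))
  have h1 := (hasBalancedFactorization_const f.leadingCoeff).mul (key f.roots hf)
  convert h1 using 2 with z
  conv_lhs => rw [(IsAlgClosed.splits f).eq_prod_roots]
  simp [Polynomial.eval_multiset_prod]

/-- Parseval applied to the difference of the two series, which sums to zero. -/
lemma coeff_eq_of_hasSum_circle {c d : ℕ → ℂ} (hc : Summable fun n => ‖c n‖)
    (hd : Summable fun n => ‖d n‖) {f : Circle → ℂ}
    (hcf : ∀ w : Circle, HasSum (fun n => c n * (w : ℂ) ^ n) (f w))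
    (hdf : ∀ w : Circle, HasSum (fun n => d n * (w : ℂ) ^ n) (f w)) : c = d := by
  have h1 : Summable fun n => ‖c n - d n‖ :=
    (hc.add hd).of_nonneg_of_le (fun _ => norm_nonneg _) fun n => norm_sub_le _ _
  have h2 : ∀ w : Circle, HasSum (fun n => (c n - d n) * (w : ℂ) ^ n) 0 := by
    intro w
    simpa [sub_mul] using (hcf w).sub (hdf w)
  have h3 := hasSum_norm_sq_of_hasSum h1 h2
  funext n
  have h4 : ‖c n - d n‖ ^ 2 = 0 := by
    have h5 : HasSum (fun n => ‖c n - d n‖ ^ 2) 0 := by simpa using h3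
    exact congrFun ((hasSum_zero_iff_of_nonneg (fun n => by positivity)).1 h5) n
  exact sub_eq_zero.1 (norm_eq_zero.1 (pow_eq_zero_iff two_ne_zero |>.1 h4))

lemma hasSum_circle_polynomial (f : Polynomial ℂ) (w : Circle) :
    HasSum (fun n => f.coeff n * (w : ℂ) ^ n) (f.eval (w : ℂ)) := by
  rw [Polynomial.eval_eq_sum_range]
  refine hasSum_sum_of_ne_finset_zero fun n hn => ?_
  rw [Polynomial.coeff_eq_zero_of_natDegree_lt (by simpa using hn), zero_mul]

lemma summable_norm_polynomial_coeff (f : Polynomial ℂ) : Summable fun n => ‖f.coeff n‖ :=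
  summable_of_ne_finset_zero (s := Finset.range (f.natDegree + 1)) fun n hn => by
    rw [Polynomial.coeff_eq_zero_of_natDegree_lt (by simpa using hn), norm_zero]

/-- With f = gh balanced, ‖g‖_2² = ‖h‖_2² = ‖f‖_1. The n-th coefficient of f is a Cauchy product of
n+1 terms, so Cauchy–Schwarz gives |c_n|² ≤ (n+1)∑|b_k|²|d_{n-k}|². Summing over n produces
‖g‖_2²‖h‖_2² = ‖f‖_1². -/
lemma sum_coeff_sq_div_le_of_roots (f : Polynomial ℂ) (hf : ∀ a ∈ f.roots, ‖a‖ ≠ 1) (N : ℕ) :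
    ∑ n ∈ Finset.range N, ‖f.coeff n‖ ^ 2 / (n + 1) ≤
      (∫ w : Circle, ‖f.eval (w : ℂ)‖ ∂circleMeasure) ^ 2 := by
  obtain ⟨R, hR, g, h, hg, hh, H⟩ := hasBalancedFactorization_polynomial f hf
  obtain ⟨b, hb, hbg⟩ := exists_summable_coeff_of_differentiableOn hR hg
  obtain ⟨d, hd, hdh⟩ := exists_summable_coeff_of_differentiableOn hR hh
  have hb2 := hasSum_norm_sq_of_hasSum hb hbg
  have hd2 := hasSum_norm_sq_of_hasSum hd hdh
  simp_rw [fun w => (H w).2.1] at hb2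
  simp_rw [fun w => (H w).2.2] at hd2
  set I := ∫ w : Circle, ‖f.eval (w : ℂ)‖ ∂circleMeasure
  have hcoeff : f.coeff = fun n => ∑ p ∈ Finset.HasAntidiagonal.antidiagonal n, b p.1 * d p.2 := by
    refine coeff_eq_of_hasSum_circle (f := fun w => f.eval (w : ℂ))
      (summable_norm_polynomial_coeff f)
      (summable_norm_sum_mul_antidiagonal_of_summable_norm hb hd)
      (hasSum_circle_polynomial f) fun w => ?_
    have nb : Summable fun n => ‖b n * (w : ℂ) ^ n‖ := by
      simpa only [norm_mul, norm_pow, Circle.norm_coe, one_pow, mul_one] using hb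
    have nd : Summable fun n => ‖d n * (w : ℂ) ^ n‖ := by
      simpa only [norm_mul, norm_pow, Circle.norm_coe, one_pow, mul_one] using hd
    have e1 := tsum_mul_tsum_eq_tsum_sum_antidiagonal_of_summable_norm nb nd
    have e2 := (summable_norm_sum_mul_antidiagonal_of_summable_norm nb nd).of_norm.hasSum
    rw [← e1, (hbg w).tsum_eq, (hdh w).tsum_eq, ← (H w).1] at e2
    have e3 : ∀ n, (∑ p ∈ Finset.HasAntidiagonal.antidiagonal n, b p.1 * d p.2) * (w : ℂ) ^ n =
        ∑ p ∈ Finset.HasAntidiagonal.antidiagonal n,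
          b p.1 * (w : ℂ) ^ p.1 * (d p.2 * (w : ℂ) ^ p.2) := ?_
    · simp only [e3]
      exact e2
    intro n
    rw [Finset.sum_mul]
    refine Finset.sum_congr rfl fun p hp => ?_
    rw [← Finset.HasAntidiagonal.mem_antidiagonal.1 hp, pow_add]; ring
  have hsum : HasSum (fun n => ∑ p ∈ Finset.HasAntidiagonal.antidiagonal n, ‖b p.1‖ ^ 2 * ‖d p.2‖ ^ 2)
      (I ^ 2) := by
    have nb : Summable fun n => ‖(‖b n‖ ^ 2)‖ := by simpa using hb2.summable
    have nd : Summable fun n => ‖(‖d n‖ ^ 2)‖ := by simpa using hd2.summable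
    have e1 := tsum_mul_tsum_eq_tsum_sum_antidiagonal_of_summable_norm nb nd
    have e2 := (summable_norm_sum_mul_antidiagonal_of_summable_norm nb nd).of_norm.hasSum
    rwa [← e1, hb2.tsum_eq, hd2.tsum_eq, ← sq] at e2
  refine le_trans (Finset.sum_le_sum fun n _ => ?_)
    (sum_le_hasSum (Finset.range N) (fun n _ => Finset.sum_nonneg fun _ _ => by positivity) hsum)
  rw [div_le_iff₀ (by positivity), hcoeff]
  have h1 : ‖∑ p ∈ Finset.HasAntidiagonal.antidiagonal n, b p.1 * d p.2‖ ≤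
      ∑ p ∈ Finset.HasAntidiagonal.antidiagonal n, ‖b p.1‖ * ‖d p.2‖ :=
    (norm_sum_le _ _).trans_eq (by simp)
  refine (pow_le_pow_left₀ (norm_nonneg _) h1 2).trans (sq_sum_le_card_mul_sum_sq.trans_eq ?_)
  rw [Finset.Nat.card_antidiagonal, mul_comm]
  push_cast
  congr 1
  exact Finset.sum_congr rfl fun _ _ => by ring

/-- Carleman's inequality `∑ |c_n|² / (n + 1) ≤ ‖f‖₁²` for polynomials on the circle. -/
lemma sum_coeff_sq_div_le (f : Polynomial ℂ) (N : ℕ) :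
    ∑ n ∈ Finset.range N, ‖f.coeff n‖ ^ 2 / (n + 1) ≤
      (∫ w : Circle, ‖f.eval (w : ℂ)‖ ∂circleMeasure) ^ 2 := by
  -- Dilation removes roots on the circle; both sides are continuous in ρ, so ρ → 1 recovers f.
  set fr : ℝ → Polynomial ℂ := fun ρ => f.comp (Polynomial.C (ρ : ℂ) * Polynomial.X)
  have hev : ∀ ρ z, (fr ρ).eval z = f.eval (ρ * z) := fun ρ z => by simp [fr]
  have h1 : ∀ᶠ ρ : ℝ in 𝓝[<] 1, ∑ n ∈ Finset.range N, ‖(fr ρ).coeff n‖ ^ 2 / (n + 1) ≤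
      (∫ w : Circle, ‖(fr ρ).eval (w : ℂ)‖ ∂circleMeasure) ^ 2 := by
    rcases eq_or_ne f 0 with rfl | hf0
    · exact Eventually.of_forall fun ρ => by simp [fr]
    -- A root of f(ρ·) on the circle makes ρ the modulus of a root of f, so only finitely many ρ are
    -- bad. The value 1 is taken out of the bad set so that its complement is a neighbourhood of 1;
    -- ρ < 1 rules that value out anyway.
    have hfin : (((fun a : ℂ => ‖a‖) '' {a | a ∈ f.roots}) \ {1}).Finite :=
      ((Multiset.finite_toSet f.roots).image _).sdiff
    have h2 : ∀ᶠ ρ : ℝ in 𝓝[<] 1, ρ ∉ ((fun a : ℂ => ‖a‖) '' {a | a ∈ f.roots}) \ {1} :=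
      mem_nhdsWithin_of_mem_nhds (hfin.isClosed.isOpen_compl.mem_nhds (by simp))
    filter_upwards [h2, self_mem_nhdsWithin,
      mem_nhdsWithin_of_mem_nhds (lt_mem_nhds (zero_lt_one (α := ℝ)))] with ρ hρ hρ1 hρ0
    refine sum_coeff_sq_div_le_of_roots _ (fun a ha ha1 => hρ ⟨⟨ρ * a, ?_, ?_⟩, ?_⟩) N
    · have := Polynomial.isRoot_of_mem_roots ha
      rw [Polynomial.IsRoot, hev] at this
      exact (Polynomial.mem_roots hf0).2 this
    · simp [ha1, abs_of_pos hρ0]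
    · exact (ne_of_lt hρ1)
  have hc1 : Tendsto (fun ρ : ℝ => ∑ n ∈ Finset.range N, ‖(fr ρ).coeff n‖ ^ 2 / (n + 1))
      (𝓝[<] 1) (𝓝 (∑ n ∈ Finset.range N, ‖f.coeff n‖ ^ 2 / (n + 1))) := by
    have : Continuous fun ρ : ℝ => ∑ n ∈ Finset.range N, ‖(fr ρ).coeff n‖ ^ 2 / (n + 1 : ℝ) := by
      simp only [fr, Polynomial.comp_C_mul_X_coeff]
      fun_prop
    have h := (this.tendsto 1).mono_left (nhdsWithin_le_nhds (s := Set.Iio 1))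
    simpa [fr] using h
  have hc2 : Tendsto (fun ρ : ℝ => (∫ w : Circle, ‖(fr ρ).eval (w : ℂ)‖ ∂circleMeasure) ^ 2)
      (𝓝[<] 1) (𝓝 ((∫ w : Circle, ‖f.eval (w : ℂ)‖ ∂circleMeasure) ^ 2)) := by
    refine Tendsto.pow ?_ 2
    simp_rw [hev]
    have hcont : Continuous fun p : ℝ × Circle => ‖f.eval ((p.1 : ℂ) * (p.2 : ℂ))‖ :=
      (f.continuous.comp ((Complex.continuous_ofReal.comp continuous_fst).mul
        (continuous_circle_coe.comp continuous_snd))).norm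
    have h := continuous_parametric_integral_of_continuous (μ := circleMeasure)
      (f := fun (ρ : ℝ) (w : Circle) => ‖f.eval ((ρ : ℂ) * (w : ℂ))‖) hcont
      (isCompact_univ (X := Circle))
    have h := (h.tendsto 1).mono_left (nhdsWithin_le_nhds (s := Set.Iio 1))
    simpa using h
  exact le_of_tendsto_of_tendsto hc1 hc2 h1

/-- Minkowski's inequality for square sums of integrals. -/
lemma sum_sq_integral_le {ι X : Type*} [MeasurableSpace X] {μ : Measure X} (s : Finset ι)
    {f : ι → X → ℝ} {G : X → ℝ} (hf : ∀ i ∈ s, Integrable (f i) μ) (hG : Integrable G μ)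
    (hG0 : ∀ x, 0 ≤ G x) (h : ∀ x, ∑ i ∈ s, f i x ^ 2 ≤ G x ^ 2) :
    ∑ i ∈ s, (∫ x, f i x ∂μ) ^ 2 ≤ (∫ x, G x ∂μ) ^ 2 := by
  set I : ι → ℝ := fun i => ∫ x, f i x ∂μ
  set S := ∑ i ∈ s, I i ^ 2
  have hS0 : 0 ≤ S := Finset.sum_nonneg fun _ _ => sq_nonneg _
  have hGi : 0 ≤ ∫ x, G x ∂μ := integral_nonneg hG0
  -- Duality: the vector of integrals is paired with itself and Cauchy–Schwarz is applied pointwise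
  -- under the integral. Dividing by √S finishes.
  have h1 : S ≤ √S * ∫ x, G x ∂μ := by
    have e : S = ∫ x, ∑ i ∈ s, I i * f i x ∂μ := by
      rw [integral_finsetSum _ fun i hi => (hf i hi).const_mul _]
      exact Finset.sum_congr rfl fun i _ => by rw [integral_const_mul, sq]
    rw [← integral_const_mul]
    refine e.trans_le (integral_mono (integrable_finsetSum _ fun i hi => (hf i hi).const_mul _)
      (hG.const_mul _) fun x => ?_)
    refine (Real.sum_mul_le_sqrt_mul_sqrt s _ _).trans ?_
    refine mul_le_mul_of_nonneg_left ?_ (Real.sqrt_nonneg _)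
    exact Real.sqrt_le_iff.2 ⟨hG0 x, h x⟩
  rcases hS0.eq_or_lt with h0 | hpos
  · exact h0.symm.le.trans (sq_nonneg _)
  · have h2 : √S ≤ ∫ x, G x ∂μ := by
      have hs := Real.sqrt_pos.2 hpos
      refine le_of_mul_le_mul_left ?_ hs
      rwa [Real.mul_self_sqrt hS0]
    calc S = √S ^ 2 := (Real.sq_sqrt hS0).symm
      _ ≤ _ := pow_le_pow_left₀ (Real.sqrt_nonneg _) h2 2

/-! ### Carleman's inequality in several variables -/

/-- The weight `∏ (α_i + 1)` of a multi-index. -/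
def divisorWeight {σ : Type*} (α : σ →₀ ℕ) : ℝ := α.prod fun _ k => (k + 1 : ℝ)

lemma divisorWeight_pos {σ : Type*} (α : σ →₀ ℕ) : 0 < divisorWeight α :=
  Finset.prod_pos fun _ _ => by positivity

lemma divisorWeight_cons {n : ℕ} (k : ℕ) (β : Fin n →₀ ℕ) :
    divisorWeight (Finsupp.cons k β) = (k + 1) * divisorWeight β := by
  rw [divisorWeight, divisorWeight, Finsupp.prod_fintype _ _ (by simp),
    Finsupp.prod_fintype _ _ (by simp), Fin.prod_univ_succ]
  simp

lemma integrable_of_continuous_pi_circle {n : ℕ} {f : (Fin n → Circle) → ℝ} (hf : Continuous f) :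
    Integrable f (Measure.pi fun _ => circleMeasure) := by
  obtain ⟨C, hC⟩ := (isCompact_range hf).isBounded.exists_norm_le
  exact Integrable.of_bound hf.aestronglyMeasurable C
    (ae_of_all _ fun w => hC _ (Set.mem_range_self w))

lemma continuous_pi_circle_coe {σ : Type*} :
    Continuous fun (w : σ → Circle) (i : σ) => (w i : ℂ) :=
  continuous_pi fun i => continuous_circle_coe.comp (continuous_apply i)

lemma integral_pi_circle_succ {n : ℕ} {f : (Fin (n + 1) → Circle) → ℝ} (hf : Continuous f) :
    ∫ w, f w ∂(Measure.pi fun _ => circleMeasure) =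
      ∫ v : Fin n → Circle, ∫ t, f (Fin.cons t v) ∂circleMeasure
        ∂(Measure.pi fun _ => circleMeasure) := by
  have h := (measurePreserving_piFinSuccAbove (fun _ : Fin (n + 1) => circleMeasure) 0).symm
  rw [← h.integral_comp', integral_prod_symm]
  · simp [MeasurableEquiv.piFinSuccAbove_symm_apply, Fin.insertNthEquiv]
  · exact h.integrable_comp_of_integrable (integrable_of_continuous_pi_circle hf)

/-- Induction on the number of variables. Q is viewed as a polynomial in its first variable with
coefficients in the others: the induction hypothesis handles each coefficient `P.coeff k`,
Minkowski's inequality moves the sum over k inside the integral, and the one-variable inequality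
applies for frozen remaining variables. No constant accumulates. -/
lemma sum_coeff_sq_div_divisorWeight_le_fin {n : ℕ} (Q : MvPolynomial (Fin n) ℂ)
    (A : Finset (Fin n →₀ ℕ)) :
    ∑ α ∈ A, ‖Q.coeff α‖ ^ 2 / divisorWeight α ≤
      (∫ w : Fin n → Circle, ‖MvPolynomial.eval (fun i => (w i : ℂ)) Q‖
        ∂(Measure.pi fun _ => circleMeasure)) ^ 2 := by
  classical
  induction n with
  | zero =>
    have h1 : ∀ w : Fin 0 → Circle, MvPolynomial.eval (fun i => (w i : ℂ)) Q = Q.coeff 0 := by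
      intro w
      conv_lhs => rw [MvPolynomial.eq_C_of_isEmpty Q]
      simp
    simp_rw [h1]
    refine (Finset.sum_le_sum_of_subset_of_nonneg (Finset.subset_univ A)
      fun _ _ _ => by have := divisorWeight_pos ‹Fin 0 →₀ ℕ›; positivity).trans ?_
    rw [Fintype.sum_subsingleton _ 0]
    simp [divisorWeight]
  | succ n ih =>
    set P := MvPolynomial.finSuccEquiv ℂ n Q
    set B := A.image Finsupp.tail
    set N := A.sup (fun α => α 0) + 1
    have hsub : A ⊆ (Finset.range N ×ˢ B).image fun p => Finsupp.cons p.1 p.2 := by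
      intro α hα
      refine Finset.mem_image.2 ⟨(α 0, α.tail), Finset.mem_product.2 ⟨?_, ?_⟩,
        Finsupp.cons_tail α⟩
      · exact Finset.mem_range.2 (Nat.lt_succ_of_le (Finset.le_sup (f := fun α => α 0) hα))
      · exact Finset.mem_image_of_mem _ hα
    have hinj : Set.InjOn (fun p : ℕ × (Fin n →₀ ℕ) => Finsupp.cons p.1 p.2)
        (Finset.range N ×ˢ B : Finset (ℕ × (Fin n →₀ ℕ))) := by
      rintro ⟨a, b⟩ _ ⟨c, d⟩ _ h
      have h0 := DFunLike.congr_fun h 0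
      have ht := congrArg Finsupp.tail h
      simp only [Finsupp.cons_zero, Finsupp.tail_cons] at h0 ht
      rw [h0, ht]
    refine (Finset.sum_le_sum_of_subset_of_nonneg hsub fun α _ _ => by
      have := divisorWeight_pos α; positivity).trans ?_
    rw [Finset.sum_image hinj, Finset.sum_product]
    have hP : ∀ k, Continuous fun v : Fin n → Circle =>
        MvPolynomial.eval (fun i => (v i : ℂ)) (P.coeff k) := fun k =>
      (MvPolynomial.continuous_eval _).comp continuous_pi_circle_coe
    have hQ : Continuous fun w : Fin (n + 1) → Circle =>
        ‖MvPolynomial.eval (fun i => (w i : ℂ)) Q‖ :=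
      ((MvPolynomial.continuous_eval _).comp continuous_pi_circle_coe).norm
    have hG : Continuous fun v : Fin n → Circle => ∫ t : Circle,
        ‖MvPolynomial.eval (fun i => ((Fin.cons t v : Fin (n + 1) → Circle) i : ℂ)) Q‖
          ∂circleMeasure := by
      have h := continuous_parametric_integral_of_continuous (μ := circleMeasure)
        (f := fun (v : Fin n → Circle) (t : Circle) => ‖MvPolynomial.eval
          (fun i => ((Fin.cons t v : Fin (n + 1) → Circle) i : ℂ)) Q‖)
        (hQ.comp (Continuous.finCons continuous_snd continuous_fst))
        (isCompact_univ (X := Circle))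
      simpa only [Measure.restrict_univ] using h
    rw [integral_pi_circle_succ hQ]
    refine le_trans (Finset.sum_le_sum fun k _ => ?_) (sum_sq_integral_le
      (μ := Measure.pi fun _ : Fin n => circleMeasure) (Finset.range N)
      (f := fun k v => ‖MvPolynomial.eval (fun i => (v i : ℂ)) (P.coeff k)‖ / √(k + 1))
      (fun k _ => integrable_of_continuous_pi_circle ((hP k).norm.div_const _))
      (integrable_of_continuous_pi_circle hG) (fun v => integral_nonneg fun t => norm_nonneg _) ?_)
    · have h1 : ∀ β, ‖MvPolynomial.coeff (Finsupp.cons k β) Q‖ ^ 2 /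
          divisorWeight (Finsupp.cons k β) =
          (‖(P.coeff k).coeff β‖ ^ 2 / divisorWeight β) / (k + 1) := by
        intro β
        rw [divisorWeight_cons, MvPolynomial.finSuccEquiv_coeff_coeff, div_div, mul_comm]
      simp_rw [h1]
      rw [← Finset.sum_div, integral_div, div_pow, Real.sq_sqrt (by positivity)]
      exact div_le_div_of_nonneg_right (ih (P.coeff k) B) (by positivity)
    · intro v
      have h2 := sum_coeff_sq_div_le (P.map (MvPolynomial.eval fun i => (v i : ℂ))) N
      have h3 : ∀ t : Circle, MvPolynomial.eval
          (fun i => ((Fin.cons t v : Fin (n + 1) → Circle) i : ℂ)) Q =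
          (P.map (MvPolynomial.eval fun i => (v i : ℂ))).eval (t : ℂ) := by
        intro t
        rw [← MvPolynomial.eval_eq_eval_mv_eval']
        congr 2
        funext i
        refine Fin.cases ?_ (fun j => ?_) i <;> simp
      simp_rw [h3]
      refine le_trans (Finset.sum_le_sum fun k _ => ?_) h2
      rw [div_pow, Real.sq_sqrt (by positivity), Polynomial.coeff_map]

lemma measurePreserving_polytorus_comp {n : ℕ} {f : Fin n → ℕ} (hf : Function.Injective f) :
    MeasurePreserving (fun w : ℕ → Circle => w ∘ f) polytorusMeasure
      (Measure.pi fun _ => circleMeasure) := by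
  have hm : Measurable fun w : ℕ → Circle => w ∘ f :=
    measurable_pi_lambda _ fun i => measurable_pi_apply (f i)
  refine ⟨hm, (Measure.pi_eq fun s hs => ?_).symm⟩
  rw [Measure.map_apply hm (MeasurableSet.univ_pi hs)]
  have h1 : (fun w : ℕ → Circle => w ∘ f) ⁻¹' Set.univ.pi s =
      ((Finset.univ.map ⟨f, hf⟩ : Finset ℕ) : Set ℕ).pi
        (Function.extend f s fun _ => Set.univ) := by
    ext w
    simp [Set.mem_pi, hf.extend_apply]
  rw [h1, polytorusMeasure, Measure.infinitePi_pi]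
  · simp [hf.extend_apply]
  · intro i hi
    obtain ⟨j, -, rfl⟩ := Finset.mem_map.1 hi
    simpa [hf.extend_apply] using hs j

/-- Carleman's inequality `∑ |c_α|² / ∏ (α_i + 1) ≤ ‖Q‖₁²` for polynomials on the polytorus. -/
theorem sum_coeff_sq_div_divisorWeight_le (Q : MvPolynomial ℕ ℂ) (A : Finset (ℕ →₀ ℕ)) :
    ∑ α ∈ A, ‖Q.coeff α‖ ^ 2 / divisorWeight α ≤
      (∫ w, ‖MvPolynomial.eval (torusPoint w) Q‖ ∂polytorusMeasure) ^ 2 := by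
  classical
  obtain ⟨n, f, hf, q, rfl⟩ := MvPolynomial.exists_fin_rename Q
  have h := measurePreserving_polytorus_comp hf
  have h1 : ∫ w, ‖MvPolynomial.eval (torusPoint w) (MvPolynomial.rename f q)‖ ∂polytorusMeasure =
      ∫ w : Fin n → Circle, ‖MvPolynomial.eval (fun i => (w i : ℂ)) q‖
        ∂(Measure.pi fun _ => circleMeasure) := by
    have hc : Continuous fun w : Fin n → Circle =>
        ‖MvPolynomial.eval (fun i => (w i : ℂ)) q‖ :=
      ((MvPolynomial.continuous_eval _).comp continuous_pi_circle_coe).norm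
    rw [← h.map_eq, integral_map h.measurable.aemeasurable hc.aestronglyMeasurable]
    refine integral_congr_ae (ae_of_all _ fun w => ?_)
    simp only [MvPolynomial.eval_rename]
    rfl
  rw [h1]
  refine le_trans ?_ (sum_coeff_sq_div_divisorWeight_le_fin q q.support)
  have h2 : ∑ α ∈ (MvPolynomial.rename f q).support,
      ‖(MvPolynomial.rename f q).coeff α‖ ^ 2 / divisorWeight α =
      ∑ α ∈ q.support, ‖q.coeff α‖ ^ 2 / divisorWeight α := by
    rw [MvPolynomial.support_rename_of_injective hf,
      Finset.sum_image (Finsupp.mapDomain_injective hf).injOn]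
    refine Finset.sum_congr rfl fun α _ => ?_
    rw [MvPolynomial.coeff_rename_mapDomain f hf, divisorWeight,
      Finsupp.prod_mapDomain_index_inj hf]
    rfl
  rw [← h2]
  refine (Finset.sum_filter_of_ne (p := fun α => α ∈ (MvPolynomial.rename f q).support)
    (fun α _ hne => ?_)).symm.trans_le (Finset.sum_le_sum_of_subset_of_nonneg ?_ ?_)
  · rw [MvPolynomial.mem_support_iff]
    intro h0
    simp [h0] at hne
  · exact fun α hα => (Finset.mem_filter.1 hα).2
  · exact fun α _ _ => by have := divisorWeight_pos α; positivity

/-! ### Fejér means on the polytorus -/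

/-- The box `{0, …, n - 1}^n` of multi-indices. -/
def fejerBox (n : ℕ) : Finset (ℕ →₀ ℕ) := Finset.finsupp (Finset.range n) fun _ => Finset.range n

/-- The Fejér multiplier. -/
def fejerWeight (n : ℕ) (α : ℕ →₀ ℕ) : ℝ :=
  (((fejerBox n).filter fun γ => γ + α ∈ fejerBox n).card : ℝ) / (fejerBox n).card

open Classical in
/-- The Fejér mean of order `n` of the formal power series with coefficients `a`. -/
def fejerMean (n : ℕ) (a : (ℕ →₀ ℕ) → ℂ) : MvPolynomial ℕ ℂ :=
  ∑ γ ∈ fejerBox n, ∑ β ∈ fejerBox n,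
    if γ ≤ β then MvPolynomial.monomial (β - γ) (a (β - γ) / ((fejerBox n).card : ℂ)) else 0

lemma mem_fejerBox {n : ℕ} {γ : ℕ →₀ ℕ} :
    γ ∈ fejerBox n ↔ γ.support ⊆ Finset.range n ∧ ∀ i < n, γ i < n := by
  simp [fejerBox, Finset.mem_finsupp_iff]

lemma card_fejerBox (n : ℕ) : (fejerBox n).card = n ^ n := by
  simp [fejerBox, Finset.card_finsupp]

lemma card_fejerBox_pos (n : ℕ) : 0 < (fejerBox n).card := by
  rw [card_fejerBox]
  rcases n.eq_zero_or_pos with rfl | h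
  · simp
  · positivity

lemma fejerWeight_nonneg (n : ℕ) (α : ℕ →₀ ℕ) : 0 ≤ fejerWeight n α := by
  unfold fejerWeight; positivity

lemma fejerWeight_le_one (n : ℕ) (α : ℕ →₀ ℕ) : fejerWeight n α ≤ 1 :=
  div_le_one_of_le₀ (by exact_mod_cast Finset.card_filter_le _ _) (by positivity)

lemma norm_fejerWeight_le_one (n : ℕ) (α : ℕ →₀ ℕ) : ‖(fejerWeight n α : ℂ)‖ ≤ 1 := by
  rw [Complex.norm_of_nonneg (fejerWeight_nonneg n α)]
  exact fejerWeight_le_one n α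

/-- Shifting by α leaves n - α_i admissible values of γ in each direction i, so the proportion of
the box is a product. -/
lemma fejerWeight_eq {n : ℕ} {α : ℕ →₀ ℕ} (hn : 0 < n) (hs : α.support ⊆ Finset.range n)
    (hα : ∀ i, α i ≤ n) : fejerWeight n α = ∏ i ∈ α.support, (1 - (α i : ℝ) / n) := by
  have h1 : ((fejerBox n).filter fun γ => γ + α ∈ fejerBox n) =
      Finset.finsupp (Finset.range n) fun i => Finset.range (n - α i) := by
    ext γ
    simp only [Finset.mem_filter, mem_fejerBox, Finset.mem_finsupp_iff, Finset.mem_range,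
      Finsupp.add_apply]
    constructor
    · rintro ⟨⟨h, -⟩, -, h3⟩
      exact ⟨h, fun i hi => by have := h3 i hi; omega⟩
    · rintro ⟨h, h2⟩
      refine ⟨⟨h, fun i hi => by have := h2 i hi; omega⟩, ?_,
        fun i hi => by have := h2 i hi; omega⟩
      exact Finsupp.support_add.trans (Finset.union_subset h hs)
  have hn' : (n : ℝ) ≠ 0 := by positivity
  rw [fejerWeight, h1, card_fejerBox, Finset.card_finsupp]
  simp only [Finset.card_range]
  push_cast
  have h2 : ((n : ℝ) ^ n) = ∏ i ∈ Finset.range n, (n : ℝ) := by simp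
  rw [h2, ← Finset.prod_div_distrib]
  rw [Finset.prod_subset hs (f := fun i => 1 - (α i : ℝ) / n) fun i _ hi => by
    simp [Finsupp.notMem_support_iff.1 hi]]
  exact Finset.prod_congr rfl fun i _ => by rw [Nat.cast_sub (hα i), sub_div, div_self hn']

lemma tendsto_fejerWeight (α : ℕ →₀ ℕ) : Tendsto (fun n => fejerWeight n α) atTop (𝓝 1) := by
  have h1 : Tendsto (fun n : ℕ => ∏ i ∈ α.support, (1 - (α i : ℝ) / n)) atTop (𝓝 1) := by
    have : Tendsto (fun n : ℕ => ∏ i ∈ α.support, (1 - (α i : ℝ) / n)) atTop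
        (𝓝 (∏ i ∈ α.support, (1 - 0))) :=
      tendsto_finsetProd _ fun i _ => tendsto_const_nhds.sub
        (tendsto_const_nhds.div_atTop tendsto_natCast_atTop_atTop)
    simpa using this
  refine h1.congr' ?_
  filter_upwards [eventually_gt_atTop 0, eventually_ge_atTop (α.support.sup fun i => α i),
    eventually_gt_atTop (α.support.sup id)] with n h0 h1 h2
  refine (fejerWeight_eq h0 (fun i hi => ?_) fun i => ?_).symm
  · exact Finset.mem_range.2 ((Finset.le_sup (f := id) hi).trans_lt h2)
  · by_cases hi : i ∈ α.support
    · exact (Finset.le_sup (f := fun i => α i) hi).trans h1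
    · rw [Finsupp.notMem_support_iff.1 hi]; exact Nat.zero_le _

/-- Each γ contributes to the monomial α through the single choice β = γ + α, provided this lies in
the box; counting such γ yields the weight. -/
lemma coeff_fejerMean (n : ℕ) (a : (ℕ →₀ ℕ) → ℂ) (α : ℕ →₀ ℕ) :
    (fejerMean n a).coeff α = fejerWeight n α * a α := by
  classical
  rw [fejerMean, MvPolynomial.coeff_sum]
  have h1 : ∀ γ ∈ fejerBox n, MvPolynomial.coeff α (∑ β ∈ fejerBox n,
      if γ ≤ β then MvPolynomial.monomial (β - γ) (a (β - γ) / ((fejerBox n).card : ℂ)) else 0) =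
      if γ + α ∈ fejerBox n then a α / ((fejerBox n).card : ℂ) else 0 := by
    intro γ _
    rw [MvPolynomial.coeff_sum, ← Finset.sum_ite_eq' (fejerBox n) (γ + α)
      (fun _ => a α / ((fejerBox n).card : ℂ))]
    refine Finset.sum_congr rfl fun β _ => ?_
    by_cases h : β = γ + α
    · subst h; simp
    · rw [if_neg h]
      split_ifs with h2
      · rw [MvPolynomial.coeff_monomial, if_neg]
        rintro rfl
        exact h (add_tsub_cancel_of_le h2).symm
      · simp
  rw [Finset.sum_congr rfl h1, ← Finset.sum_filter, Finset.sum_const, fejerWeight]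
  push_cast
  rw [nsmul_eq_mul]
  ring

/-- The Fejér kernel. -/
def fejerKernel (n : ℕ) (w : ℕ → Circle) : ℝ :=
  ‖∑ β ∈ fejerBox n, torusChar (natExp β) w‖ ^ 2 / (fejerBox n).card

lemma fejerKernel_nonneg (n : ℕ) (w : ℕ → Circle) : 0 ≤ fejerKernel n w := by
  unfold fejerKernel; positivity

lemma continuous_fejerKernel (n : ℕ) : Continuous (fejerKernel n) :=
  ((continuous_finsetSum _ fun _ _ => continuous_torusChar _).norm.pow 2).div_const _

/-- Parseval: the kernel is the squared modulus of a sum of `card` characters with unimodular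
coefficients, divided by `card`. -/
lemma integral_fejerKernel_left (n : ℕ) (w : ℕ → Circle) :
    ∫ v, fejerKernel n (w * v⁻¹) ∂polytorusMeasure = 1 := by
  simp_rw [fejerKernel, torusChar_mul, torusChar_inv]
  rw [integral_div, integral_norm_sq_sum_torusChar]
  · simp [norm_torusChar, (card_fejerBox_pos n).ne']
  · intro a _ b _ h
    exact natExp_injective (neg_injective h)

lemma integral_fejerKernel_right (n : ℕ) (v : ℕ → Circle) :
    ∫ w, fejerKernel n (w * v⁻¹) ∂polytorusMeasure = 1 := by
  have h1 : ∀ w, fejerKernel n (w * v⁻¹) = ‖∑ β ∈ fejerBox n,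
      torusChar (natExp β) v⁻¹ * torusChar (natExp β) w‖ ^ 2 / (fejerBox n).card := fun w => by
    simp_rw [fejerKernel, torusChar_mul, mul_comm]
  simp_rw [h1]
  rw [integral_div, integral_norm_sq_sum_torusChar]
  · simp [norm_torusChar, (card_fejerBox_pos n).ne']
  · exact natExp_injective.injOn

lemma fejerKernel_eq_sum (n : ℕ) (w v : ℕ → Circle) : (fejerKernel n (w * v⁻¹) : ℂ) =
    ∑ γ ∈ fejerBox n, ∑ β ∈ fejerBox n, torusChar (natExp β - natExp γ) w /
      (fejerBox n).card * torusChar (-(natExp β - natExp γ)) v := by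
  rw [fejerKernel, Complex.ofReal_div, ← Complex.normSq_eq_norm_sq, ← Complex.mul_conj, map_sum,
    Finset.sum_mul_sum, Finset.sum_comm, Finset.sum_div]
  refine Finset.sum_congr rfl fun γ _ => ?_
  rw [Finset.sum_div]
  refine Finset.sum_congr rfl fun β _ => ?_
  rw [← torusChar_neg, ← torusChar_add, torusChar_mul, ← sub_eq_add_neg, torusChar_inv]
  push_cast
  ring

/-- The kernel contains all differences β - γ. Those with a negative entry meet vanishing Fourier
coefficients of u, so only the pairs γ ≤ β kept in `fejerMean` survive. -/
lemma eval_fejerMean_eq_integral {u : (ℕ → Circle) → ℂ} (hu : Integrable u polytorusMeasure)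
    (hneg : ∀ k : ℕ →₀ ℤ, (∃ i, k i < 0) → polytorusFourierCoeff u k = 0) (n : ℕ)
    (w : ℕ → Circle) :
    MvPolynomial.eval (torusPoint w) (fejerMean n fun α => polytorusFourierCoeff u (natExp α)) =
      ∫ v, u v * fejerKernel n (w * v⁻¹) ∂polytorusMeasure := by
  classical
  have hint : ∀ c : ℂ, ∀ k : ℕ →₀ ℤ,
      Integrable (fun v => u v * (c * torusChar k v)) polytorusMeasure := by
    intro c k
    refine hu.mul_bdd (c := ‖c‖) (continuous_const.mul (continuous_torusChar k)).aestronglyMeasurable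
      (ae_of_all _ fun v => ?_)
    rw [norm_mul, norm_torusChar, mul_one]
  simp_rw [fejerKernel_eq_sum, Finset.mul_sum]
  rw [integral_finsetSum _ fun γ _ => integrable_finsetSum _ fun β _ => hint _ _,
    fejerMean, map_sum]
  refine Finset.sum_congr rfl fun γ _ => ?_
  rw [integral_finsetSum _ fun β _ => hint _ _, map_sum]
  refine Finset.sum_congr rfl fun β _ => ?_
  have h1 : ∫ v, u v * (torusChar (natExp β - natExp γ) w / (fejerBox n).card *
      torusChar (-(natExp β - natExp γ)) v) ∂polytorusMeasure =
      torusChar (natExp β - natExp γ) w / (fejerBox n).card *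
        polytorusFourierCoeff u (natExp β - natExp γ) := by
    rw [polytorusFourierCoeff_eq, ← integral_const_mul]
    refine integral_congr_ae (ae_of_all _ fun v => ?_)
    ring
  rw [h1]
  split_ifs with h
  · have h2 : natExp β - natExp γ = natExp (β - γ) := by
      rw [sub_eq_iff_eq_add, ← natExp_add, tsub_add_cancel_of_le h]
    rw [h2, MvPolynomial.eval_monomial, prod_torusPoint]
    ring
  · obtain ⟨i, hi⟩ : ∃ i, β i < γ i := by
      by_contra! hc
      exact h fun i => hc i
    rw [hneg _ ⟨i, by simpa [natExp_apply] using hi⟩]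
    simp

lemma norm_eval_fejerMean_le {u : (ℕ → Circle) → ℂ} {C : ℝ}
    (hum : AEStronglyMeasurable u polytorusMeasure) (hC : ∀ᵐ w ∂polytorusMeasure, ‖u w‖ ≤ C)
    (hneg : ∀ k : ℕ →₀ ℤ, (∃ i, k i < 0) → polytorusFourierCoeff u k = 0) (n : ℕ)
    (w : ℕ → Circle) :
    ‖MvPolynomial.eval (torusPoint w)
      (fejerMean n fun α => polytorusFourierCoeff u (natExp α))‖ ≤ C := by
  rw [eval_fejerMean_eq_integral (Integrable.of_bound hum C hC) hneg]
  have hk : Integrable (fun v => C * fejerKernel n (w * v⁻¹)) polytorusMeasure :=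
    integrable_of_continuous_polytorus (continuous_const.mul
      ((continuous_fejerKernel n).comp (continuous_const.mul continuous_inv)))
  refine (norm_integral_le_of_norm_le hk (hC.mono fun v hv => ?_)).trans_eq ?_
  · rw [norm_mul, Complex.norm_of_nonneg (fejerKernel_nonneg _ _)]
    exact mul_le_mul_of_nonneg_right hv (fejerKernel_nonneg _ _)
  · rw [integral_const_mul, integral_fejerKernel_left, mul_one]

/-- Convolution with a nonnegative kernel of total mass 1 contracts L_1, by Fubini. -/
lemma integral_norm_eval_fejerMean_le {u : (ℕ → Circle) → ℂ} (hu : Integrable u polytorusMeasure)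
    (hneg : ∀ k : ℕ →₀ ℤ, (∃ i, k i < 0) → polytorusFourierCoeff u k = 0) (n : ℕ) :
    ∫ w, ‖MvPolynomial.eval (torusPoint w)
      (fejerMean n fun α => polytorusFourierCoeff u (natExp α))‖ ∂polytorusMeasure ≤
      ∫ w, ‖u w‖ ∂polytorusMeasure := by
  have hkc : Continuous fun p : (ℕ → Circle) × (ℕ → Circle) => fejerKernel n (p.1 * p.2⁻¹) :=
    (continuous_fejerKernel n).comp (continuous_fst.mul continuous_snd.inv)
  obtain ⟨K, hK⟩ := (isCompact_range hkc).isBounded.exists_norm_le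
  have hint : Integrable (fun p : (ℕ → Circle) × (ℕ → Circle) =>
      ‖u p.2‖ * fejerKernel n (p.1 * p.2⁻¹)) (polytorusMeasure.prod polytorusMeasure) :=
    (hu.norm.comp_snd polytorusMeasure).mul_bdd (c := K) hkc.aestronglyMeasurable
      (ae_of_all _ fun p => hK _ (Set.mem_range_self p))
  calc ∫ w, ‖MvPolynomial.eval (torusPoint w)
          (fejerMean n fun α => polytorusFourierCoeff u (natExp α))‖ ∂polytorusMeasure
      ≤ ∫ w, (∫ v, ‖u v‖ * fejerKernel n (w * v⁻¹) ∂polytorusMeasure) ∂polytorusMeasure := by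
        refine integral_mono (integrable_of_continuous_polytorus
          (continuous_eval_torusPoint _).norm) hint.integral_prod_left fun w => ?_
        rw [eval_fejerMean_eq_integral hu hneg]
        refine (norm_integral_le_integral_norm _).trans_eq ?_
        refine integral_congr_ae (ae_of_all _ fun v => ?_)
        simp only [norm_mul, Complex.norm_of_nonneg (fejerKernel_nonneg _ _)]
    _ = ∫ v, (∫ w, ‖u v‖ * fejerKernel n (w * v⁻¹) ∂polytorusMeasure) ∂polytorusMeasure :=
        integral_integral_swap hint
    _ = ∫ w, ‖u w‖ ∂polytorusMeasure := by
        simp_rw [integral_const_mul, integral_fejerKernel_right, mul_one]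

/-- Carleman's inequality for functions in `H_1` of the polytorus. -/
theorem sum_fourierCoeff_sq_div_divisorWeight_le {u : (ℕ → Circle) → ℂ}
    (hu : Integrable u polytorusMeasure)
    (hneg : ∀ k : ℕ →₀ ℤ, (∃ i, k i < 0) → polytorusFourierCoeff u k = 0)
    (A : Finset (ℕ →₀ ℕ)) :
    ∑ α ∈ A, ‖polytorusFourierCoeff u (natExp α)‖ ^ 2 / divisorWeight α ≤
      (∫ w, ‖u w‖ ∂polytorusMeasure) ^ 2 := by
  have h1 : ∀ n, ∑ α ∈ A, ‖(fejerWeight n α : ℂ) * polytorusFourierCoeff u (natExp α)‖ ^ 2 /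
      divisorWeight α ≤ (∫ w, ‖u w‖ ∂polytorusMeasure) ^ 2 := by
    intro n
    simp_rw [← coeff_fejerMean n (fun α => polytorusFourierCoeff u (natExp α))]
    exact (sum_coeff_sq_div_divisorWeight_le _ A).trans
      (pow_le_pow_left₀ (integral_nonneg fun _ => norm_nonneg _)
        (integral_norm_eval_fejerMean_le hu hneg n) 2)
  refine le_of_tendsto' (x := atTop) (tendsto_finsetSum _ fun α _ => ?_) h1
  have h2 : Tendsto (fun n => (fejerWeight n α : ℂ)) atTop (𝓝 1) := by
    have := (Complex.continuous_ofReal.tendsto 1).comp (tendsto_fejerWeight α)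
    rwa [Complex.ofReal_one] at this
  have h3 := (((h2.mul_const (polytorusFourierCoeff u (natExp α))).norm.pow 2).div_const
    (divisorWeight α))
  simpa using h3

/-! ### Square summable points of the polydisc -/

lemma sum_finsupp_prod_eq (S : Finset ℕ) (M : ℕ) (f : ℕ → ℕ → ℝ) :
    ∑ α ∈ Finset.finsupp S (fun _ => Finset.range M), ∏ i ∈ S, f i (α i) =
      ∏ i ∈ S, ∑ k ∈ Finset.range M, f i k := by
  classical
  rw [Finset.prod_sum, Finset.finsupp, Finset.sum_map]
  refine Finset.sum_congr (by congr!) fun p _ => ?_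
  rw [← Finset.prod_attach]
  refine Finset.prod_congr rfl fun i _ => ?_
  simp

/-- Euler product: A is enlarged to a box of exponents, over which the sum factors. The
normalisation `f i 0 = 1` lets indices of S outside the support enter the product freely. -/
lemma sum_finsuppProd_le {A : Finset (ℕ →₀ ℕ)} {S : Finset ℕ} (hA : ∀ α ∈ A, α.support ⊆ S)
    {f : ℕ → ℕ → ℝ} (hf : ∀ i k, 0 ≤ f i k) (hf0 : ∀ i, f i 0 = 1) {B : ℕ → ℝ}
    (hB : ∀ i ∈ S, ∀ M, ∑ k ∈ Finset.range M, f i k ≤ B i) :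
    ∑ α ∈ A, α.prod f ≤ ∏ i ∈ S, B i := by
  set M := A.sup (fun α => α.support.sup α) + 1
  calc ∑ α ∈ A, α.prod f = ∑ α ∈ A, ∏ i ∈ S, f i (α i) :=
        Finset.sum_congr rfl fun α hα =>
          Finsupp.prod_of_support_subset _ (hA α hα) _ fun i _ => hf0 i
    _ ≤ ∑ α ∈ Finset.finsupp S (fun _ => Finset.range M), ∏ i ∈ S, f i (α i) := by
        refine Finset.sum_le_sum_of_subset_of_nonneg (fun α hα => ?_)
          fun _ _ _ => Finset.prod_nonneg fun _ _ => hf _ _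
        refine Finset.mem_finsupp_iff.2 ⟨hA α hα, fun i _ => Finset.mem_range.2 ?_⟩
        refine Nat.lt_succ_of_le ?_
        by_cases hi : i ∈ α.support
        · exact (Finset.le_sup (f := α) hi).trans
            (Finset.le_sup (f := fun α : ℕ →₀ ℕ => α.support.sup α) hα)
        · rw [Finsupp.notMem_support_iff.1 hi]; exact Nat.zero_le _
    _ = ∏ i ∈ S, ∑ k ∈ Finset.range M, f i k := sum_finsupp_prod_eq S M f
    _ ≤ ∏ i ∈ S, B i := Finset.prod_le_prod (fun i _ => Finset.sum_nonneg fun _ _ => hf _ _)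
        fun i hi => hB i hi M

lemma norm_seqMonomial (z : EllInfty) (α : ℕ →₀ ℕ) :
    ‖seqMonomial z α‖ = α.prod fun i k => ‖z i‖ ^ k := by
  simp [seqMonomial, Finsupp.prod, norm_prod]

lemma norm_coord_le (z : EllInfty) (i : ℕ) : ‖z i‖ ≤ ‖z‖ :=
  lp.norm_apply_le_norm ENNReal.top_ne_zero z i

lemma mem_polydisc {z : EllInfty} : z ∈ polydisc ↔ ‖z‖ < 1 := by
  simp [polydisc]

lemma inv_one_sub_le_exp {x ρ : ℝ} (hx : 0 ≤ x) (hxρ : x ≤ ρ) (hρ : ρ < 1) :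
    (1 - x)⁻¹ ≤ Real.exp (x / (1 - ρ)) := by
  have h1 : 0 < 1 - x := by linarith
  have h2 : 0 < 1 - ρ := by linarith
  calc (1 - x)⁻¹ = x / (1 - x) + 1 := by field_simp; ring
    _ ≤ x / (1 - ρ) + 1 := by gcongr
    _ ≤ _ := Real.add_one_le_exp _

lemma sum_succ_mul_pow_le {x : ℝ} (h0 : 0 ≤ x) (h1 : x < 1) (M : ℕ) :
    ∑ k ∈ Finset.range M, (k + 1 : ℝ) * x ^ k ≤ ((1 - x)⁻¹) ^ 2 := by
  have h := hasSum_choose_mul_geometric_of_norm_lt_one (𝕜 := ℝ) 1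
    (by rwa [Real.norm_of_nonneg h0])
  have h2 := sum_le_hasSum (Finset.range M) (fun k _ => by positivity) h
  simpa using h2

lemma memlp_two_iff (z : ℕ → ℂ) : Memℓp z 2 ↔ Summable fun n => ‖z n‖ ^ 2 := by
  rw [memℓp_gen_iff (by norm_num)]
  simp

lemma summable_fourierCoeff_mul_seqMonomial {z : EllInfty} (hz : z ∈ polydisc)
    (hz2 : Summable fun n => ‖z n‖ ^ 2) {u : (ℕ → Circle) → ℂ}
    (hu : Integrable u polytorusMeasure)
    (hneg : ∀ k : ℕ →₀ ℤ, (∃ i, k i < 0) → polytorusFourierCoeff u k = 0) :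
    Summable fun α : ℕ →₀ ℕ => ‖polytorusFourierCoeff u (natExp α) * seqMonomial z α‖ := by
  classical
  set ρ := ‖z‖ ^ 2
  have hρ : ρ < 1 := pow_lt_one₀ (norm_nonneg _) (mem_polydisc.1 hz) two_ne_zero
  have hzρ : ∀ i, ‖z i‖ ^ 2 ≤ ρ := fun i =>
    pow_le_pow_left₀ (norm_nonneg _) (norm_coord_le z i) 2
  -- Cauchy–Schwarz with weights ∏(α_i+1)^{±1/2} leaves ∑∏(α_i+1)|z^α|² ≤ ∏(1-|z_i|²)^{-2}, and each
  -- factor is at most exp(2|z_i|²/(1-ρ)) since |z_i|² ≤ ρ < 1.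
  set K := Real.exp (2 * (∑' i, ‖z i‖ ^ 2) / (1 - ρ))
  refine summable_of_sum_le (c := √((∫ w, ‖u w‖ ∂polytorusMeasure) ^ 2) * √K)
    (fun _ => norm_nonneg _) fun A => ?_
  have h1 : ∀ α, ‖polytorusFourierCoeff u (natExp α) * seqMonomial z α‖ =
      (‖polytorusFourierCoeff u (natExp α)‖ / √(divisorWeight α)) *
        (√(divisorWeight α) * ‖seqMonomial z α‖) := by
    intro α
    have := Real.sqrt_pos.2 (divisorWeight_pos α)
    rw [norm_mul]
    field_simp
  rw [Finset.sum_congr rfl fun α _ => h1 α]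
  refine (Real.sum_mul_le_sqrt_mul_sqrt _ _ _).trans ?_
  refine mul_le_mul (Real.sqrt_le_sqrt ?_) (Real.sqrt_le_sqrt ?_) (Real.sqrt_nonneg _)
    (Real.sqrt_nonneg _)
  · refine le_trans (Finset.sum_le_sum fun α _ => ?_)
      (sum_fourierCoeff_sq_div_divisorWeight_le hu hneg A)
    rw [div_pow, Real.sq_sqrt (divisorWeight_pos α).le]
  · have h2 : ∀ α, (√(divisorWeight α) * ‖seqMonomial z α‖) ^ 2 =
        α.prod fun i k => (k + 1 : ℝ) * (‖z i‖ ^ 2) ^ k := by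
      intro α
      rw [mul_pow, Real.sq_sqrt (divisorWeight_pos α).le, norm_seqMonomial, divisorWeight,
        Finsupp.prod, Finsupp.prod, Finsupp.prod, ← Finset.prod_pow, ← Finset.prod_mul_distrib]
      refine Finset.prod_congr rfl fun i _ => ?_
      rw [← pow_mul, ← pow_mul, mul_comm 2]
    rw [Finset.sum_congr rfl fun α _ => h2 α]
    set S := A.biUnion fun α => α.support
    refine (sum_finsuppProd_le (S := S) (B := fun i => ((1 - ‖z i‖ ^ 2)⁻¹) ^ 2)
      (fun α hα => Finset.subset_biUnion_of_mem (fun α : ℕ →₀ ℕ => α.support) hα)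
      (fun i k => by positivity) (fun i => by simp) fun i _ M =>
        sum_succ_mul_pow_le (sq_nonneg _) ((hzρ i).trans_lt hρ) M).trans ?_
    calc ∏ i ∈ S, ((1 - ‖z i‖ ^ 2)⁻¹) ^ 2
        ≤ ∏ i ∈ S, Real.exp (2 * (‖z i‖ ^ 2 / (1 - ρ))) := by
          refine Finset.prod_le_prod (fun i _ => by positivity) fun i _ => ?_
          have h3 : 0 ≤ (1 - ‖z i‖ ^ 2)⁻¹ := inv_nonneg.2 (by linarith [hzρ i])
          refine (pow_le_pow_left₀ h3 (inv_one_sub_le_exp (sq_nonneg _) (hzρ i) hρ) 2).trans_eq ?_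
          rw [← Real.exp_nat_mul]
          simp
      _ = Real.exp (2 * (∑ i ∈ S, ‖z i‖ ^ 2) / (1 - ρ)) := by
          rw [← Real.exp_sum, ← Finset.mul_sum, ← Finset.sum_div, mul_div_assoc]
      _ ≤ K := by
          refine Real.exp_le_exp.2 (div_le_div_of_nonneg_right ?_ (by linarith))
          exact mul_le_mul_of_nonneg_left (hz2.sum_le_tsum _ fun _ _ => sq_nonneg _) two_pos.le

lemma integrable_of_Lp {p : ℝ≥0∞} (hp : 1 ≤ p) (f : Lp ℂ p polytorusMeasure) :
    Integrable f polytorusMeasure :=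
  (Lp.memLp f).integrable hp

lemma mem_monHardy_of_summable {p : ℝ≥0∞} (hp : 1 ≤ p) {z : EllInfty} (hz : z ∈ polydisc)
    (hz2 : Summable fun n => ‖z n‖ ^ 2) : z ∈ monHardy p :=
  ⟨hz, fun f hf => summable_fourierCoeff_mul_seqMonomial hz hz2 (integrable_of_Lp hp f) hf⟩

/-! ### Moments of Steinhaus sums -/

/-- The Khinchine–Steinhaus inequality for even exponents. -/
lemma integral_norm_pow_steinhaus_le (s : Finset ℕ) (b : ℕ → ℂ) (q : ℕ) :
    ∫ w : ℕ → Circle, ‖∑ i ∈ s, b i * (w i : ℂ)‖ ^ (2 * q) ∂polytorusMeasure ≤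
      q.factorial * (∑ i ∈ s, ‖b i‖ ^ 2) ^ q := by
  classical
  set e : (ℕ → ℕ) → ℕ →₀ ℤ := fun k => Finsupp.indicator s fun i _ => (k i : ℤ)
  have hek : ∀ k, ∀ i ∈ s, e k i = k i := fun k i hi => Finsupp.indicator_of_mem hi _
  have h1 : ∀ w : ℕ → Circle, ‖∑ i ∈ s, b i * (w i : ℂ)‖ ^ (2 * q) =
      ‖∑ k ∈ s.piAntidiag q, ((Nat.multinomial s k : ℂ) * ∏ i ∈ s, b i ^ k i) *
        torusChar (e k) w‖ ^ 2 := by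
    intro w
    rw [mul_comm 2 q, pow_mul, ← norm_pow, Finset.sum_pow_eq_sum_piAntidiag]
    congr 2
    refine Finset.sum_congr rfl fun k _ => ?_
    rw [torusChar_eq_prod _ w (Finsupp.support_indicator_subset s _), mul_assoc,
      ← Finset.prod_mul_distrib]
    congr 1
    refine Finset.prod_congr rfl fun i hi => ?_
    rw [hek k i hi, mul_pow, zpow_natCast]
  simp_rw [h1]
  rw [integral_norm_sq_sum_torusChar]
  · rw [Finset.sum_pow_eq_sum_piAntidiag, Finset.mul_sum]
    refine Finset.sum_le_sum fun k hk => ?_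
    -- After Parseval the multinomial coefficient appears squared. One copy is bounded by q!; the
    -- other rebuilds the multinomial expansion of (∑|b_i|²)^q.
    have h2 : (Nat.multinomial s k : ℝ) ≤ q.factorial := by
      rw [Nat.multinomial, (Finset.mem_piAntidiag.1 hk).1]
      exact_mod_cast Nat.div_le_self _ _
    rw [norm_mul, mul_pow, norm_prod, Complex.norm_natCast, sq, mul_assoc]
    have h3 : (∏ i ∈ s, ‖b i ^ k i‖) ^ 2 = ∏ i ∈ s, (‖b i‖ ^ 2) ^ k i := by
      rw [← Finset.prod_pow]
      refine Finset.prod_congr rfl fun i _ => ?_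
      rw [norm_pow, ← pow_mul, ← pow_mul, mul_comm]
    rw [h3]
    exact mul_le_mul_of_nonneg_right h2 (by positivity)
  · intro k hk l hl h
    funext i
    by_cases hi : i ∈ s
    · have := DFunLike.congr_fun h i
      rw [hek k i hi, hek l i hi] at this
      exact_mod_cast this
    · have hk' := (Finset.mem_piAntidiag.1 hk).2 i
      have hl' := (Finset.mem_piAntidiag.1 hl).2 i
      rw [not_imp_comm.1 hk' hi, not_imp_comm.1 hl' hi]

/-! ### Uniform boundedness for the sets of monomial convergence -/

lemma integral_norm_le_norm_Lp {p : ℝ≥0∞} [Fact (1 ≤ p)] (f : Lp ℂ p polytorusMeasure) :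
    ∫ w, ‖f w‖ ∂polytorusMeasure ≤ ‖f‖ := by
  rw [integral_norm_eq_lintegral_enorm (Lp.aestronglyMeasurable f), Lp.norm_def,
    ← eLpNorm_one_eq_lintegral_enorm]
  exact ENNReal.toReal_mono (Lp.eLpNorm_ne_top f)
    (eLpNorm_le_eLpNorm_of_exponent_le Fact.out (Lp.aestronglyMeasurable f))

lemma integrable_mul_torusChar {f : (ℕ → Circle) → ℂ} (hf : Integrable f polytorusMeasure)
    (n : ℕ →₀ ℤ) : Integrable (fun w => f w * torusChar n w) polytorusMeasure :=
  hf.mul_bdd (c := 1) (continuous_torusChar n).aestronglyMeasurable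
    (ae_of_all _ fun w => (norm_torusChar n w).le)

/-- The Fourier coefficient as a continuous linear functional on `L_p`. -/
def fourierCoeffCLM (p : ℝ≥0∞) [Fact (1 ≤ p)] (n : ℕ →₀ ℤ) :
    Lp ℂ p polytorusMeasure →L[ℂ] ℂ :=
  LinearMap.mkContinuous
    { toFun := fun f => polytorusFourierCoeff f n
      map_add' := fun f g => by
        rw [polytorusFourierCoeff_congr_ae (Lp.coeFn_add f g)]
        simp only [polytorusFourierCoeff_eq, Pi.add_apply, add_mul]
        exact integral_add (integrable_mul_torusChar (integrable_of_Lp Fact.out f) _)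
          (integrable_mul_torusChar (integrable_of_Lp Fact.out g) _)
      map_smul' := fun c f => by
        rw [polytorusFourierCoeff_congr_ae (Lp.coeFn_smul c f)]
        simp only [polytorusFourierCoeff_eq, Pi.smul_apply, smul_eq_mul, mul_assoc,
          RingHom.id_apply]
        exact integral_const_mul _ _ }
    1 fun f => by
      rw [one_mul]
      exact (norm_polytorusFourierCoeff_le _ n).trans (integral_norm_le_norm_Lp f)

lemma fourierCoeffCLM_apply (p : ℝ≥0∞) [Fact (1 ≤ p)] (n : ℕ →₀ ℤ)
    (f : Lp ℂ p polytorusMeasure) : fourierCoeffCLM p n f = polytorusFourierCoeff f n := rfl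

/-- The Hardy space as a closed subspace of `L_p`. -/
def hardySubmodule (p : ℝ≥0∞) [Fact (1 ≤ p)] : Submodule ℂ (Lp ℂ p polytorusMeasure) :=
  ⨅ n : {n : ℕ →₀ ℤ // ∃ i, n i < 0}, (fourierCoeffCLM p n.1).ker

lemma mem_hardySubmodule {p : ℝ≥0∞} [Fact (1 ≤ p)] {f : Lp ℂ p polytorusMeasure} :
    f ∈ hardySubmodule p ↔ f ∈ hardySpace p := by
  simp only [hardySubmodule, Submodule.mem_iInf, LinearMap.mem_ker, Subtype.forall, hardySpace,
    Set.mem_ofPred_eq]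
  rfl

lemma isClosed_hardySubmodule (p : ℝ≥0∞) [Fact (1 ≤ p)] :
    IsClosed (hardySubmodule p : Set (Lp ℂ p polytorusMeasure)) := by
  rw [hardySubmodule, Submodule.coe_iInf]
  exact isClosed_iInter fun n => (fourierCoeffCLM p n.1).isClosed_ker

lemma exists_unimodular_mul (x : ℂ) : ∃ θ : ℂ, ‖θ‖ ≤ 1 ∧ θ * x = ‖x‖ := by
  rcases eq_or_ne x 0 with rfl | hx
  · exact ⟨0, by simp, by simp⟩
  · have h : (‖x‖ : ℂ) ≠ 0 := by exact_mod_cast norm_ne_zero_iff.2 hx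
    refine ⟨(starRingEnd ℂ) x / ‖x‖, ?_, ?_⟩
    · rw [norm_div, RCLike.norm_conj, Complex.norm_real, norm_norm,
        div_self (norm_ne_zero_iff.2 hx)]
    · rw [div_mul_eq_mul_div, mul_comm, Complex.mul_conj, Complex.normSq_eq_norm_sq]
      push_cast
      field_simp

/-- Banach–Steinhaus on the closed subspace H_p, for the functionals f ↦ ∑_{α∈A} θ_α f̂(α)z^α with A
finite and |θ_α| ≤ 1. They are bounded at each f by the convergent sum of |f̂(α)z^α|. -/
lemma exists_bound_of_mem_monHardy {p : ℝ≥0∞} (hp : 1 ≤ p) {z : EllInfty} (hz : z ∈ monHardy p) :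
    ∃ C : ℝ, 0 ≤ C ∧ ∀ (Q : MvPolynomial ℕ ℂ) (A : Finset (ℕ →₀ ℕ)),
      ∑ α ∈ A, ‖Q.coeff α * seqMonomial z α‖ ≤
        C * (eLpNorm (fun w => MvPolynomial.eval (torusPoint w) Q) p polytorusMeasure).toReal := by
  have : Fact (1 ≤ p) := ⟨hp⟩
  have : CompleteSpace (hardySubmodule p) :=
    (isClosed_hardySubmodule p).completeSpace_coe
  let g : Finset (ℕ →₀ ℕ) × {θ : (ℕ →₀ ℕ) → ℂ // ∀ α, ‖θ α‖ ≤ 1} → hardySubmodule p →L[ℂ] ℂ :=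
    fun i => ∑ α ∈ i.1, (i.2.1 α * seqMonomial z α) •
      (fourierCoeffCLM p (natExp α)).comp (hardySubmodule p).subtypeL
  have hg : ∀ i f, g i f = ∑ α ∈ i.1, i.2.1 α *
      (polytorusFourierCoeff (f : Lp ℂ p polytorusMeasure) (natExp α) * seqMonomial z α) := by
    intro i f
    simp only [g, sum_apply, smul_apply, smul_eq_mul]
    refine Finset.sum_congr rfl fun α _ => ?_
    rw [mul_assoc, mul_comm (seqMonomial z α)]
    rfl
  obtain ⟨C, hC⟩ := banach_steinhaus (g := g) fun f => by
    have hs : Summable fun α : ℕ →₀ ℕ => ‖polytorusFourierCoeff (f : Lp ℂ p polytorusMeasure)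
      (natExp α) * seqMonomial z α‖ := hz.2 f (mem_hardySubmodule.1 f.2)
    refine ⟨∑' α, ‖polytorusFourierCoeff (f : Lp ℂ p polytorusMeasure)
      (natExp α) * seqMonomial z α‖, fun i => ?_⟩
    rw [hg]
    refine (norm_sum_le _ _).trans (le_trans (Finset.sum_le_sum fun α _ => ?_)
      (hs.sum_le_tsum i.1 fun _ _ => norm_nonneg _))
    rw [norm_mul]
    exact mul_le_of_le_one_left (norm_nonneg _) (i.2.2 α)
  have hC0 : 0 ≤ C := le_trans (norm_nonneg (g (∅, ⟨0, by simp⟩))) (hC (∅, ⟨0, by simp⟩))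
  refine ⟨C, hC0, fun Q A => ?_⟩
  have hmem : MemLp (fun w => MvPolynomial.eval (torusPoint w) Q) p polytorusMeasure := by
    obtain ⟨K, hK⟩ := (isCompact_range (continuous_eval_torusPoint Q)).isBounded.exists_norm_le
    exact MemLp.of_bound (continuous_eval_torusPoint Q).aestronglyMeasurable K
      (ae_of_all _ fun w => hK _ (Set.mem_range_self w))
  set F := hmem.toLp
  have hF : F ∈ hardySubmodule p := by
    refine mem_hardySubmodule.2 fun n hn => ?_
    rw [polytorusFourierCoeff_congr_ae hmem.coeFn_toLp, polytorusFourierCoeff_eval_of_neg Q hn]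
  -- These phases turn the functional at Q into the sum of absolute values.
  choose θ hθ1 hθ2 using fun α => exists_unimodular_mul (Q.coeff α * seqMonomial z α)
  have h1 := (g (A, ⟨θ, hθ1⟩)).le_of_opNorm_le (hC _) ⟨F, hF⟩
  have h2 : g (A, ⟨θ, hθ1⟩) ⟨F, hF⟩ = ((∑ α ∈ A, ‖Q.coeff α * seqMonomial z α‖ : ℝ) : ℂ) := by
    rw [hg]
    push_cast
    refine Finset.sum_congr rfl fun α _ => ?_
    rw [polytorusFourierCoeff_congr_ae hmem.coeFn_toLp, polytorusFourierCoeff_eval, hθ2]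
  rw [h2, Complex.norm_of_nonneg (Finset.sum_nonneg fun _ _ => norm_nonneg _)] at h1
  rwa [← Lp.norm_toLp _ hmem]

lemma eLpNorm_toReal_le_of_integral_pow_le {f : (ℕ → Circle) → ℂ} (hf : Continuous f)
    {p : ℝ≥0∞} {q : ℕ} (hq : 0 < q) (hp : p ≤ (2 * q : ℕ)) {D : ℝ} (hD : 0 ≤ D)
    (h : ∫ w, ‖f w‖ ^ (2 * q) ∂polytorusMeasure ≤ D ^ (2 * q)) :
    (eLpNorm f p polytorusMeasure).toReal ≤ D := by
  obtain ⟨K, hK⟩ := (isCompact_range hf).isBounded.exists_norm_le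
  have hmem : MemLp f (2 * q : ℕ) polytorusMeasure := MemLp.of_bound hf.aestronglyMeasurable K
    (ae_of_all _ fun w => hK _ (Set.mem_range_self w))
  refine ENNReal.toReal_le_of_le_ofReal hD
    ((eLpNorm_le_eLpNorm_of_exponent_le hp hf.aestronglyMeasurable).trans ?_)
  rw [hmem.eLpNorm_eq_integral_rpow_norm (by positivity) (ENNReal.natCast_ne_top _)]
  refine ENNReal.ofReal_le_ofReal ?_
  simp only [ENNReal.toReal_natCast, Real.rpow_natCast]
  refine (Real.rpow_le_rpow (integral_nonneg fun _ => by positivity) h (by positivity)).trans_eq ?_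
  exact Real.pow_rpow_inv_natCast hD (by positivity)

/-- On linear polynomials every L_p norm with p finite is dominated by the ℓ_2 norm of the
coefficients. The uniform bound then reads T ≤ C·q!·√T for the partial sums T of ∑|z_i|², with q
depending only on p. -/
lemma summable_of_mem_monHardy {p : ℝ≥0∞} (hp : 1 ≤ p) (hp' : p < ∞) {z : EllInfty}
    (hz : z ∈ monHardy p) : Summable fun n => ‖z n‖ ^ 2 := by
  classical
  obtain ⟨C, hC0, hC⟩ := exists_bound_of_mem_monHardy hp hz
  obtain ⟨q, hq⟩ := ENNReal.exists_nat_gt hp'.ne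
  have hq0 : 0 < q := by
    rcases q.eq_zero_or_pos with rfl | h
    · simp at hq
    · exact h
  have hpq : p ≤ (2 * q : ℕ) := hq.le.trans (by exact_mod_cast (by omega : q ≤ 2 * q))
  refine summable_of_sum_le (c := (C * q.factorial) ^ 2) (fun _ => sq_nonneg _) fun s => ?_
  set Q : MvPolynomial ℕ ℂ :=
    ∑ i ∈ s, MvPolynomial.monomial (Finsupp.single i 1) ((starRingEnd ℂ) (z i))
  set T := ∑ i ∈ s, ‖z i‖ ^ 2
  have hT : 0 ≤ T := Finset.sum_nonneg fun _ _ => sq_nonneg _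
  have hsum : ∑ α ∈ s.image (fun i => Finsupp.single i 1), ‖Q.coeff α * seqMonomial z α‖ = T := by
    rw [Finset.sum_image (fun a _ b _ h => Finsupp.single_left_injective one_ne_zero h)]
    refine Finset.sum_congr rfl fun i hi => ?_
    have h1 : Q.coeff (Finsupp.single i 1) = (starRingEnd ℂ) (z i) := by
      simp only [Q, MvPolynomial.coeff_sum, MvPolynomial.coeff_monomial,
        (Finsupp.single_left_injective (one_ne_zero (α := ℕ))).eq_iff]
      rw [Finset.sum_ite_eq' s i, if_pos hi]
    rw [h1, norm_mul, RCLike.norm_conj, seqMonomial, Finsupp.prod_single_index (by simp), pow_one,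
      sq]
  have hnorm : (eLpNorm (fun w => MvPolynomial.eval (torusPoint w) Q) p polytorusMeasure).toReal ≤
      q.factorial * √T := by
    refine eLpNorm_toReal_le_of_integral_pow_le (continuous_eval_torusPoint Q) hq0 hpq
      (by positivity) ?_
    have h1 : ∀ w, MvPolynomial.eval (torusPoint w) Q =
        ∑ i ∈ s, (starRingEnd ℂ) (z i) * (w i : ℂ) := by
      intro w
      rw [map_sum]
      refine Finset.sum_congr rfl fun i _ => ?_
      rw [MvPolynomial.eval_monomial, Finsupp.prod_single_index (by simp), pow_one]
      rfl
    simp_rw [h1]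
    refine (integral_norm_pow_steinhaus_le s _ q).trans ?_
    simp_rw [RCLike.norm_conj]
    rw [mul_pow, pow_mul (√T), Real.sq_sqrt hT]
    refine mul_le_mul_of_nonneg_right ?_ (by positivity)
    -- The root of q! is replaced by q! itself; only finiteness of the constant matters.
    exact le_self_pow₀ (by exact_mod_cast Nat.one_le_iff_ne_zero.2 q.factorial_ne_zero)
      (by positivity)
  have h2 : T ≤ C * q.factorial * √T := by
    have := (hC Q (s.image fun i => Finsupp.single i 1)).trans (mul_le_mul_of_nonneg_left hnorm hC0)
    rwa [hsum, ← mul_assoc] at this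
  rcases hT.eq_or_lt with h0 | hpos
  · exact h0.symm.le.trans (sq_nonneg _)
  · have h3 : √T ≤ C * q.factorial := by
      refine le_of_mul_le_mul_right ?_ (Real.sqrt_pos.2 hpos)
      rwa [Real.mul_self_sqrt hT]
    calc T = √T ^ 2 := (Real.sq_sqrt hT).symm
      _ ≤ _ := pow_le_pow_left₀ (Real.sqrt_nonneg _) h3 2

/-- For finite `p`, the set of monomial convergence of `H_p` is `ℓ_2 ∩ 𝔻^∞`. -/
theorem monHardy_eq_of_lt_top {p : ℝ≥0∞} (hp : 1 ≤ p) (hp' : p < ∞) :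
    monHardy p = {z : EllInfty | Memℓp (fun n => z n) 2} ∩ polydisc := by
  ext z
  simp only [Set.mem_inter_iff, Set.mem_ofPred_eq, memlp_two_iff]
  exact ⟨fun h => ⟨summable_of_mem_monHardy hp hp' h, h.1⟩,
    fun h => mem_monHardy_of_summable hp h.2 h.1⟩

/-! ### The decreasing rearrangement -/

lemma bddAbove_norm_coord (z : EllInfty) {p : ℕ → Prop} :
    BddAbove (Set.range fun j : {j // p j} => ‖z j‖) :=
  ⟨‖z‖, by rintro _ ⟨j, rfl⟩; exact norm_coord_le z j⟩

lemma bddBelow_rearrangement (z : EllInfty) (n : ℕ) : BddBelow (Set.range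
    fun J : {J : Finset ℕ // J.card < n} => ⨆ j : {j : ℕ // j ∉ J.1}, ‖z j‖) :=
  ⟨0, by rintro _ ⟨J, rfl⟩; exact Real.iSup_nonneg fun _ => norm_nonneg _⟩

lemma decreasingRearrangement_nonneg (z : EllInfty) (n : ℕ) :
    0 ≤ decreasingRearrangement z n :=
  Real.iInf_nonneg fun _ => Real.iSup_nonneg fun _ => norm_nonneg _

/-- A set J with fewer elements than S misses some point of S, so every supremum in the definition
is at least δ. -/
lemma le_decreasingRearrangement {z : EllInfty} {S : Finset ℕ} {δ : ℝ} (hS : S.Nonempty)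
    (h : ∀ i ∈ S, δ ≤ ‖z i‖) : δ ≤ decreasingRearrangement z S.card := by
  have : Nonempty {J : Finset ℕ // J.card < S.card} := ⟨∅, by simpa using hS⟩
  refine le_ciInf fun J => ?_
  obtain ⟨i, hi, hiJ⟩ := Finset.exists_mem_notMem_of_card_lt_card J.2
  exact (h i hi).trans (le_ciSup (f := fun j : {j : ℕ // j ∉ J.1} => ‖z j‖)
    (bddAbove_norm_coord z) ⟨i, hiJ⟩)

/-- Induction by removing from S a coordinate of smallest modulus, which is at most the
rearrangement at index `S.card`. -/
lemma sum_norm_sq_le_sum_rearrangement (z : EllInfty) (S : Finset ℕ) :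
    ∑ i ∈ S, ‖z i‖ ^ 2 ≤ ∑ k ∈ Finset.Icc 1 S.card, decreasingRearrangement z k ^ 2 := by
  induction hn : S.card generalizing S with
  | zero => simp [Finset.card_eq_zero.1 hn]
  | succ n ih =>
    have hS : S.Nonempty := Finset.card_pos.1 (by omega)
    obtain ⟨i, hi, hmin⟩ := Finset.exists_min_image S (fun i => ‖z i‖) hS
    have h1 := le_decreasingRearrangement hS hmin
    rw [hn] at h1
    rw [Finset.sum_Icc_succ_top (by omega), ← Finset.sum_erase_add S _ hi]
    exact add_le_add (ih _ (by rw [Finset.card_erase_of_mem hi, hn]; rfl))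
      (pow_le_pow_left₀ (norm_nonneg _) h1 2)

/-- Greedy choice: a set S of n coordinates is admissible in the infimum defining z*_{n+1}, so some
coordinate outside S nearly reaches that value. The ε is needed because the supremum over the
complement may not be attained. -/
lemma exists_sum_rearrangement_le (z : EllInfty) (n : ℕ) {ε : ℝ} (hε : 0 < ε) :
    ∃ S : Finset ℕ, S.card = n ∧
      ∑ k ∈ Finset.Icc 1 n, decreasingRearrangement z k ^ 2 ≤ ∑ i ∈ S, ‖z i‖ ^ 2 + ε := by
  induction n generalizing ε with
  | zero => exact ⟨∅, rfl, by simpa using hε.le⟩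
  | succ n ih =>
    obtain ⟨S, hS, h⟩ := ih (half_pos hε)
    set r := decreasingRearrangement z (n + 1)
    have hr : 0 ≤ r := decreasingRearrangement_nonneg z _
    obtain ⟨j₀, hj₀⟩ := Infinite.exists_notMem_finset S
    have : Nonempty {j : ℕ // j ∉ S} := ⟨j₀, hj₀⟩
    obtain ⟨j, hj, hjr⟩ : ∃ j, j ∉ S ∧ r ^ 2 - ε / 2 ≤ ‖z j‖ ^ 2 := by
      by_contra! hc
      have h1 : r ≤ √(r ^ 2 - ε / 2) := by
        refine (ciInf_le (bddBelow_rearrangement z (n + 1)) ⟨S, by omega⟩).trans ?_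
        exact ciSup_le fun j => Real.le_sqrt_of_sq_le (hc j j.2).le
      have h2 : 0 ≤ r ^ 2 - ε / 2 := (sq_nonneg _).trans (hc j₀ hj₀).le
      have h3 := pow_le_pow_left₀ hr h1 2
      rw [Real.sq_sqrt h2] at h3
      linarith
    refine ⟨insert j S, by rw [Finset.card_insert_of_notMem hj, hS], ?_⟩
    rw [Finset.sum_Icc_succ_top (by omega), Finset.sum_insert hj]
    linarith

lemma eventually_sum_rearrangement_le {z : EllInfty} {A : ℝ} (h : logLimsup z < (A : EReal)) :
    ∀ᶠ n : ℕ in atTop,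
      ∑ k ∈ Finset.Icc 1 n, decreasingRearrangement z k ^ 2 ≤ A * Real.log n := by
  filter_upwards [eventually_lt_of_limsup_lt h, eventually_gt_atTop 1] with n hn hn1
  have hlog : 0 < Real.log n := Real.log_pos (by exact_mod_cast hn1)
  have h1 := EReal.coe_lt_coe_iff.1 hn
  rw [one_div, inv_mul_lt_iff₀ hlog, mul_comm] at h1
  exact h1.le

/-- Points with finite logarithmic limsup are null sequences. -/
lemma finite_setOf_le_norm {z : EllInfty} {A : ℝ} (h : logLimsup z < (A : EReal)) {δ : ℝ}
    (hδ : 0 < δ) : {i | δ ≤ ‖z i‖}.Finite := by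
  by_contra hinf
  -- Infinitely many coordinates above δ would make the partial sums grow linearly, against a
  -- logarithmic bound.
  have h1 : ∀ᶠ n : ℕ in atTop, (n : ℝ) * δ ^ 2 ≤ A * Real.log n := by
    filter_upwards [eventually_sum_rearrangement_le h] with n hn
    obtain ⟨S, hS, hcard⟩ := Set.Infinite.exists_subset_card_eq hinf n
    have h2 := sum_norm_sq_le_sum_rearrangement z S
    rw [hcard] at h2
    refine le_trans ?_ (h2.trans hn)
    rw [← hcard, ← nsmul_eq_mul]
    exact Finset.card_nsmul_le_sum _ _ _ fun i hi => pow_le_pow_left₀ hδ.le (hS hi) 2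
  have h2 : Tendsto (fun n : ℕ => A * (Real.log n / n)) atTop (𝓝 (A * 0)) := by
    have h3 : Tendsto (fun x : ℝ => Real.log x / x) atTop (𝓝 0) := by
      simpa using Real.tendsto_pow_log_div_mul_add_atTop 1 0 1 one_ne_zero
    exact (h3.comp tendsto_natCast_atTop_atTop).const_mul A
  rw [mul_zero] at h2
  obtain ⟨n, h3, h4, h5⟩ := (h1.and ((h2.eventually_lt_const (pow_pos hδ 2)).and
    (eventually_gt_atTop 0))).exists
  have h6 : (0 : ℝ) < n := by exact_mod_cast h5
  rw [mul_div_assoc', div_lt_iff₀ h6, mul_comm (δ ^ 2)] at h4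
  linarith

/-! ### Random polynomials of small sup norm -/

/-- A Nikolskii type inequality on the polytorus. -/
lemma norm_eval_pow_le_integral {P : MvPolynomial ℕ ℂ} {S : Finset ℕ} {m : ℕ}
    (hS : ∀ α ∈ P.support, α.support ⊆ S) (hm : ∀ α ∈ P.support, ∀ i, α i ≤ m) (q : ℕ)
    (w : ℕ → Circle) :
    ‖MvPolynomial.eval (torusPoint w) P‖ ^ (2 * q) ≤ ((q * m + 1 : ℕ) : ℝ) ^ S.card *
      ∫ v, ‖MvPolynomial.eval (torusPoint v) P‖ ^ (2 * q) ∂polytorusMeasure := by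
  classical
  have hpow : ∀ v, ‖MvPolynomial.eval (torusPoint v) P‖ ^ (2 * q) =
      ‖MvPolynomial.eval (torusPoint v) (P ^ q)‖ ^ 2 := by
    intro v
    rw [map_pow, norm_pow, ← pow_mul, mul_comm]
  simp_rw [hpow]
  rw [integral_norm_sq_eval]
  -- P^q has at most (qm+1)^{card S} monomials, so Cauchy–Schwarz bounds its squared sup norm by
  -- that number times its squared L_2 norm.
  have hcard : (P ^ q).support.card ≤ (q * m + 1) ^ S.card := by
    have hsub : (P ^ q).support ⊆ Finset.finsupp S fun _ => Finset.range (q * m + 1) := by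
      intro α hα
      refine Finset.mem_finsupp_iff.2 ⟨fun i hi => ?_, fun i _ => Finset.mem_range.2 ?_⟩
      · have h1 := MvPolynomial.vars_pow P q
          ((MvPolynomial.mem_vars_iff_mem_support i).2 ⟨α, hα, hi⟩)
        obtain ⟨d, hd, hid⟩ := (MvPolynomial.mem_vars_iff_mem_support i).1 h1
        exact hS d hd hid
      · refine Nat.lt_succ_of_le ((MvPolynomial.monomial_le_degreeOf i hα).trans
          ((MvPolynomial.degreeOf_pow_le i P q).trans (Nat.mul_le_mul_left q ?_)))
        exact MvPolynomial.degreeOf_le_iff.2 fun d hd => hm d hd i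
    simpa [Finset.card_finsupp] using Finset.card_le_card hsub
  have h1 : ‖MvPolynomial.eval (torusPoint w) (P ^ q)‖ ≤
      ∑ α ∈ (P ^ q).support, ‖(P ^ q).coeff α‖ := by
    rw [eval_torusPoint]
    refine (norm_sum_le _ _).trans_eq (Finset.sum_congr rfl fun α _ => ?_)
    rw [norm_mul, norm_torusChar, mul_one]
  refine (pow_le_pow_left₀ (norm_nonneg _) h1 2).trans (sq_sum_le_card_mul_sum_sq.trans ?_)
  refine mul_le_mul_of_nonneg_right ?_ (Finset.sum_nonneg fun _ _ => sq_nonneg _)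
  exact_mod_cast hcard

lemma integral_norm_pow_steinhaus_le_of_injOn {ι : Type*} (A : Finset ι) (e : ι → ℕ)
    (he : Set.InjOn e A) (c : ι → ℂ) (q : ℕ) :
    ∫ s : ℕ → Circle, ‖∑ a ∈ A, c a * (s (e a) : ℂ)‖ ^ (2 * q) ∂polytorusMeasure ≤
      q.factorial * (∑ a ∈ A, ‖c a‖ ^ 2) ^ q := by
  classical
  rcases A.eq_empty_or_nonempty with rfl | ⟨a₀, -⟩
  · rcases q.eq_zero_or_pos with rfl | hq
    · simp
    · simp [hq.ne']
  have : Nonempty ι := ⟨a₀⟩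
  have h := integral_norm_pow_steinhaus_le (A.image e) (fun i => c (Function.invFunOn e A i)) q
  rw [Finset.sum_image he] at h
  simp_rw [Finset.sum_image he] at h
  have hinv : ∀ a ∈ A, Function.invFunOn e A (e a) = a := fun a ha => he.leftInvOn_invFunOn ha
  rw [Finset.sum_congr rfl fun a ha => by rw [hinv a ha]] at h
  refine le_of_eq_of_le (integral_congr_ae (ae_of_all _ fun s => ?_)) h
  have h1 : ∑ a ∈ A, c a * (s (e a) : ℂ) =
      ∑ a ∈ A, c (Function.invFunOn e A (e a)) * (s (e a) : ℂ) :=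
    Finset.sum_congr rfl fun a ha => by rw [hinv a ha]
  simp only [h1]

/-- Existence of polynomials with prescribed moduli of the coefficients and small sup norm. -/
lemma exists_polynomial_small_sup (A : Finset (ℕ →₀ ℕ)) (a : (ℕ →₀ ℕ) → ℝ) {S : Finset ℕ} {m : ℕ}
    (hS : ∀ α ∈ A, α.support ⊆ S) (hm : ∀ α ∈ A, ∀ i, α i ≤ m) (q : ℕ) :
    ∃ P : MvPolynomial ℕ ℂ, (∀ α ∈ A, ‖P.coeff α‖ = |a α|) ∧
      ∀ w, ‖MvPolynomial.eval (torusPoint w) P‖ ^ (2 * q) ≤ ((q * m + 1 : ℕ) : ℝ) ^ S.card *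
        (q.factorial * (∑ α ∈ A, a α ^ 2) ^ q) := by
  classical
  -- The injection e gives each multi-index its own independent Steinhaus variable s (e α).
  obtain ⟨e, he⟩ := exists_injective_nat (ℕ →₀ ℕ)
  set P : (ℕ → Circle) → MvPolynomial ℕ ℂ := fun s =>
    ∑ α ∈ A, MvPolynomial.monomial α ((a α : ℂ) * (s (e α) : ℂ))
  have hcoeff : ∀ s α, (P s).coeff α = if α ∈ A then (a α : ℂ) * (s (e α) : ℂ) else 0 := by
    intro s α
    simp only [P, MvPolynomial.coeff_sum, MvPolynomial.coeff_monomial]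
    rw [Finset.sum_ite_eq' A α]
  have hmemA : ∀ s, ∀ α ∈ (P s).support, α ∈ A := by
    intro s α hα
    by_contra h
    rw [MvPolynomial.mem_support_iff, hcoeff, if_neg h] at hα
    exact hα rfl
  have heval : ∀ s w, MvPolynomial.eval (torusPoint w) (P s) =
      ∑ α ∈ A, (a α * torusChar (natExp α) w) * (s (e α) : ℂ) := by
    intro s w
    rw [map_sum]
    refine Finset.sum_congr rfl fun α _ => ?_
    rw [MvPolynomial.eval_monomial, prod_torusPoint]
    ring
  have hcont : Continuous fun p : (ℕ → Circle) × (ℕ → Circle) =>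
      ‖MvPolynomial.eval (torusPoint p.2) (P p.1)‖ ^ (2 * q) := by
    simp_rw [heval]
    refine (continuous_finsetSum _ fun α _ => ?_).norm.pow _
    exact (continuous_const.mul ((continuous_torusChar _).comp continuous_snd)).mul
      (continuous_circle_coe.comp ((continuous_apply _).comp continuous_fst))
  have hint : Integrable (fun p : (ℕ → Circle) × (ℕ → Circle) =>
      ‖MvPolynomial.eval (torusPoint p.2) (P p.1)‖ ^ (2 * q))
      (polytorusMeasure.prod polytorusMeasure) := by
    obtain ⟨K, hK⟩ := (isCompact_range hcont).isBounded.exists_norm_le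
    exact Integrable.of_bound hcont.aestronglyMeasurable K
      (ae_of_all _ fun p => hK _ (Set.mem_range_self p))
  -- By Fubini the average over s is taken first. For fixed w the characters change only the phases
  -- of the coefficients, so Khinchine–Steinhaus gives a bound independent of w; some s does at
  -- least as well as the mean.
  have havg : ∫ s, (∫ w, ‖MvPolynomial.eval (torusPoint w) (P s)‖ ^ (2 * q) ∂polytorusMeasure)
      ∂polytorusMeasure ≤ q.factorial * (∑ α ∈ A, a α ^ 2) ^ q := by
    rw [integral_integral_swap hint]
    have h1 : ∀ w, ∫ s, ‖MvPolynomial.eval (torusPoint w) (P s)‖ ^ (2 * q) ∂polytorusMeasure ≤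
        q.factorial * (∑ α ∈ A, a α ^ 2) ^ q := by
      intro w
      simp_rw [heval]
      refine (integral_norm_pow_steinhaus_le_of_injOn A e he.injOn _ q).trans_eq ?_
      simp [norm_torusChar]
    refine (integral_mono hint.integral_prod_right (integrable_const _) h1).trans_eq ?_
    simp
  obtain ⟨s, hs⟩ := exists_le_integral hint.integral_prod_left
  refine ⟨P s, fun α hα => ?_, fun w => ?_⟩
  · rw [hcoeff, if_pos hα, norm_mul, Circle.norm_coe, mul_one, Complex.norm_real, Real.norm_eq_abs]
  · refine (norm_eval_pow_le_integral (S := S) (m := m) (fun α hα => hS α (hmemA s α hα))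
      (fun α hα => hm α (hmemA s α hα)) q w).trans ?_
    exact mul_le_mul_of_nonneg_left (hs.trans havg) (by positivity)

/-- Multinomial theorem with each multinomial coefficient bounded by m!; A consists of the
multi-indices of degree m on S. It converts a bound on ∑|z^α|² into one on (∑|z_i|²)^m. -/
lemma pow_sum_le_factorial_mul_sum (S : Finset ℕ) (x : ℕ → ℝ) (hx : ∀ i, 0 ≤ x i) (m : ℕ) :
    ∃ A : Finset (ℕ →₀ ℕ), (∀ α ∈ A, α.support ⊆ S) ∧ (∀ α ∈ A, ∀ i, α i ≤ m) ∧
      (∑ i ∈ S, x i) ^ m ≤ m.factorial * ∑ α ∈ A, α.prod fun i k => x i ^ k := by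
  classical
  set e : (ℕ → ℕ) → ℕ →₀ ℕ := fun k => Finsupp.indicator S fun i _ => k i
  have hek : ∀ k, ∀ i ∈ S, e k i = k i := fun k i hi => Finsupp.indicator_of_mem hi _
  have hsupp : ∀ k, (e k).support ⊆ S := fun k => Finsupp.support_indicator_subset S _
  refine ⟨(S.piAntidiag m).image e, ?_, ?_, ?_⟩
  · intro α hα
    obtain ⟨k, -, rfl⟩ := Finset.mem_image.1 hα
    exact hsupp k
  · intro α hα i
    obtain ⟨k, hk, rfl⟩ := Finset.mem_image.1 hα
    by_cases hi : i ∈ S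
    · rw [hek k i hi, ← (Finset.mem_piAntidiag.1 hk).1]
      exact Finset.single_le_sum (fun _ _ => Nat.zero_le _) hi
    · rw [Finsupp.notMem_support_iff.1 fun h => hi (hsupp k h)]
      exact Nat.zero_le _
  · rw [Finset.sum_image, Finset.sum_pow_eq_sum_piAntidiag, Finset.mul_sum]
    · refine Finset.sum_le_sum fun k hk => ?_
      have hprod : ∏ i ∈ S, x i ^ e k i = ∏ i ∈ S, x i ^ k i :=
        Finset.prod_congr rfl fun i hi => by rw [hek k i hi]
      rw [Finsupp.prod_of_support_subset _ (hsupp k) _ (by simp), hprod]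
      refine mul_le_mul_of_nonneg_right ?_ (Finset.prod_nonneg fun i _ => pow_nonneg (hx i) _)
      rw [Nat.multinomial, (Finset.mem_piAntidiag.1 hk).1]
      exact_mod_cast Nat.div_le_self _ _
    · intro k hk l hl h
      funext i
      by_cases hi : i ∈ S
      · have := DFunLike.congr_fun h i
        rwa [hek k i hi, hek l i hi] at this
      · have hk' := (Finset.mem_piAntidiag.1 hk).2 i
        have hl' := (Finset.mem_piAntidiag.1 hl).2 i
        rw [not_imp_comm.1 hk' hi, not_imp_comm.1 hl' hi]

lemma eLpNorm_top_toReal_le {f : (ℕ → Circle) → ℂ} {D : ℝ} (hD : 0 ≤ D) (h : ∀ w, ‖f w‖ ≤ D) :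
    (eLpNorm f ∞ polytorusMeasure).toReal ≤ D := by
  rw [eLpNorm_exponent_top]
  exact ENNReal.toReal_le_of_le_ofReal hD (eLpNormEssSup_le_of_ae_bound (ae_of_all _ h))

/-- The fundamental growth restriction for points of monomial convergence of `H_∞`. -/
lemma exists_pow_sum_norm_sq_le {z : EllInfty} (hz : z ∈ monHardy ∞) :
    ∃ C : ℝ, 1 ≤ C ∧ ∀ (S : Finset ℕ) (m q : ℕ), 0 < q →
      ((∑ i ∈ S, ‖z i‖ ^ 2) ^ m) ^ q ≤
        (m.factorial * (C ^ 2 * q)) ^ q * ((q * m + 1 : ℕ) : ℝ) ^ S.card := by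
  obtain ⟨C, hC0, hC⟩ := exists_bound_of_mem_monHardy le_top hz
  refine ⟨max C 1, le_max_right _ _, fun S m q hq => ?_⟩
  obtain ⟨A, hAS, hAm, hA⟩ := pow_sum_le_factorial_mul_sum S (fun i => ‖z i‖ ^ 2)
    (fun i => sq_nonneg _) m
  have hprod : ∀ α : ℕ →₀ ℕ, (α.prod fun i k => (‖z i‖ ^ 2) ^ k) = ‖seqMonomial z α‖ ^ 2 := by
    intro α
    rw [norm_seqMonomial, Finsupp.prod, Finsupp.prod, ← Finset.prod_pow]
    exact Finset.prod_congr rfl fun i _ => by rw [← pow_mul, ← pow_mul, mul_comm]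
  simp_rw [hprod] at hA
  set σ := ∑ α ∈ A, ‖seqMonomial z α‖ ^ 2
  have hσ : 0 ≤ σ := Finset.sum_nonneg fun _ _ => sq_nonneg _
  set L : ℝ := ((q * m + 1 : ℕ) : ℝ) ^ S.card
  have hL : 0 ≤ L := by positivity
  obtain ⟨P, hP1, hP2⟩ := exists_polynomial_small_sup A (fun α => ‖seqMonomial z α‖) hAS hAm q
  -- D bounds the sup norm of the random polynomial, so testing the uniform bound on it gives σ ≤
  -- C·D. The (2q)-th power of this has σ^{2q} on the left and only σ^q on the right, so σ^q
  -- cancels.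
  set D : ℝ := (L * (q.factorial * σ ^ q)) ^ (((2 * q : ℕ) : ℝ)⁻¹)
  have hD0 : 0 ≤ D := by positivity
  have hDpow : D ^ (2 * q) = L * (q.factorial * σ ^ q) :=
    Real.rpow_inv_natCast_pow (by positivity) (by positivity)
  have hPD : ∀ w, ‖MvPolynomial.eval (torusPoint w) P‖ ≤ D := fun w =>
    le_of_pow_le_pow_left₀ (by positivity : 2 * q ≠ 0) hD0 ((hP2 w).trans_eq hDpow.symm)
  have h1 : σ ≤ max C 1 * D := by
    have h2 := (hC P A).trans (mul_le_mul_of_nonneg_left (eLpNorm_top_toReal_le hD0 hPD) hC0)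
    refine le_trans (le_of_eq ?_) (h2.trans (mul_le_mul_of_nonneg_right (le_max_left _ _) hD0))
    refine Finset.sum_congr rfl fun α hα => ?_
    rw [norm_mul, hP1 α hα, abs_norm, sq]
  have h3 : σ ^ q ≤ ((max C 1) ^ 2 * q) ^ q * L := by
    rcases hσ.eq_or_lt with h0 | hpos
    · rw [← h0, zero_pow hq.ne']; positivity
    have h4 := pow_le_pow_left₀ hσ h1 (2 * q)
    rw [mul_pow, hDpow] at h4
    have h5 : σ ^ q * σ ^ q ≤ ((max C 1) ^ (2 * q) * L * q.factorial) * σ ^ q := by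
      calc σ ^ q * σ ^ q = σ ^ (2 * q) := by ring
        _ ≤ _ := h4
        _ = _ := by ring
    have h6 := le_of_mul_le_mul_right h5 (pow_pos hpos q)
    have h7 : (q.factorial : ℝ) ≤ (q : ℝ) ^ q := by exact_mod_cast Nat.factorial_le_pow q
    calc σ ^ q ≤ (max C 1) ^ (2 * q) * L * q.factorial := h6
      _ ≤ (max C 1) ^ (2 * q) * L * (q : ℝ) ^ q := by gcongr
      _ = _ := by rw [mul_pow, ← pow_mul]; ring
  calc ((∑ i ∈ S, ‖z i‖ ^ 2) ^ m) ^ q ≤ (m.factorial * σ) ^ q :=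
        pow_le_pow_left₀ (by positivity) hA q
    _ = (m.factorial : ℝ) ^ q * σ ^ q := mul_pow _ _ _
    _ ≤ (m.factorial : ℝ) ^ q * (((max C 1) ^ 2 * q) ^ q * L) := by gcongr
    _ = _ := by rw [← mul_assoc, ← mul_pow]

/-- The decay e^{-m} against m^m is what matters: in `sum_norm_sq_le_of_pow_le` it cancels `S.card`
≤ e^m, and this is the origin of the constant 1 in the definition of B̄. The inductive step is
((m+1)/(m+2))^{m+2} ≤ 1/e. -/
lemma factorial_le_stirling (m : ℕ) :
    ((m + 1).factorial : ℝ) ≤ Real.exp 1 * (m + 1) * ((m + 1) / Real.exp 1) ^ (m + 1) := by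
  induction m with
  | zero => simp [(Real.exp_pos 1).ne']
  | succ m ih =>
    have he := Real.exp_pos 1
    have hm : (0 : ℝ) < m + 1 := by positivity
    have h1 : ((m + 1 : ℝ) / (m + 2)) ^ (m + 2) ≤ (Real.exp 1)⁻¹ := by
      have h2 : (m + 1 : ℝ) / (m + 2) ≤ Real.exp (-(1 / (m + 2 : ℝ))) := by
        refine le_trans (le_of_eq ?_) (Real.add_one_le_exp _)
        field_simp
        ring
      refine (pow_le_pow_left₀ (by positivity) h2 (m + 2)).trans_eq ?_
      rw [← Real.exp_nat_mul, ← Real.exp_neg]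
      congr 1
      push_cast
      field_simp
    rw [Nat.factorial_succ]
    push_cast
    calc (m + 1 + 1 : ℝ) * ((m + 1).factorial : ℝ)
        ≤ (m + 1 + 1) * (Real.exp 1 * (m + 1) * ((m + 1) / Real.exp 1) ^ (m + 1)) := by gcongr
      _ = Real.exp 1 * (m + 1 + 1) * ((m + 2) ^ (m + 2) * (((m + 1 : ℝ) / (m + 2)) ^ (m + 2)) /
            Real.exp 1 ^ (m + 1)) := by
          rw [div_pow, div_pow]
          field_simp
          ring
      _ ≤ Real.exp 1 * (m + 1 + 1) * ((m + 2) ^ (m + 2) * (Real.exp 1)⁻¹ /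
            Real.exp 1 ^ (m + 1)) := by gcongr
      _ = _ := by
          rw [div_pow]
          field_simp
          ring

/-! ### The upper inclusion for `H_∞` -/

lemma tendsto_const_mul_pow_rpow_inv (K : ℝ) (hK : 0 < K) (j : ℕ) :
    Tendsto (fun m : ℕ => (K * (m : ℝ) ^ j) ^ ((m : ℝ)⁻¹)) atTop (𝓝 1) := by
  have h1 : Tendsto (fun m : ℕ => K ^ ((m : ℝ)⁻¹)) atTop (𝓝 1) := by
    have h := (Real.continuous_const_rpow hK.ne').tendsto 0
    rw [Real.rpow_zero] at h
    exact h.comp (tendsto_inv_atTop_zero.comp tendsto_natCast_atTop_atTop)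
  have h2 : Tendsto (fun m : ℕ => ((m : ℝ) ^ ((m : ℝ)⁻¹)) ^ j) atTop (𝓝 (1 ^ j)) := by
    refine Tendsto.pow ?_ j
    have := tendsto_rpow_div.comp (tendsto_natCast_atTop_atTop (R := ℝ))
    simpa [Function.comp_def] using this
  have h3 := h1.mul h2
  rw [one_pow, one_mul] at h3
  refine h3.congr fun m => ?_
  rw [Real.mul_rpow hK.le (by positivity), ← Real.rpow_natCast, ← Real.rpow_natCast,
    ← Real.rpow_mul (by positivity), ← Real.rpow_mul (by positivity), mul_comm (j : ℝ)]

lemma sum_norm_sq_le_of_pow_le {z : EllInfty} {C : ℝ} (hC : 1 ≤ C)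
    (h : ∀ (S : Finset ℕ) (m q : ℕ), 0 < q → ((∑ i ∈ S, ‖z i‖ ^ 2) ^ m) ^ q ≤
        (m.factorial * (C ^ 2 * q)) ^ q * ((q * m + 1 : ℕ) : ℝ) ^ S.card)
    (S : Finset ℕ) {m : ℕ} (hm : 0 < m) (hS : 0 < S.card) (hSm : (S.card : ℝ) ≤ Real.exp m) :
    ∑ i ∈ S, ‖z i‖ ^ 2 ≤
      m * (2 * Real.exp 1 ^ 2 * C ^ 2 * (m : ℝ) ^ 4) ^ ((m : ℝ)⁻¹) := by
  set n := S.card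
  set T := ∑ i ∈ S, ‖z i‖ ^ 2
  have hT : 0 ≤ T := Finset.sum_nonneg fun _ _ => sq_nonneg _
  have hm1 : (1 : ℝ) ≤ m := by exact_mod_cast hm
  have hn1 : (1 : ℝ) ≤ n := by exact_mod_cast hS
  have he := Real.exp_pos 1
  have hexp : Real.exp m = Real.exp 1 ^ m := by rw [← Real.exp_nat_mul, mul_one]
  -- The moment exponent is q = nm: the q-th root of (qm+1)^n is then (nm²+1)^{1/m}, which n ≤ e^m
  -- keeps below 2em², while q itself costs only one factor n.
  have hq : 0 < n * m := Nat.mul_pos hS hm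
  have h1 : (((n * m) * m + 1 : ℕ) : ℝ) ^ n ≤ (2 * m ^ 2 * Real.exp 1) ^ (n * m) := by
    rw [mul_comm n m, pow_mul]
    refine pow_le_pow_left₀ (by positivity) ?_ n
    have h2 : (2 * m ^ 2 : ℝ) ≤ (2 * m ^ 2) ^ m :=
      le_self_pow₀ (by nlinarith) hm.ne'
    push_cast
    have h6 : (1 : ℝ) ≤ m ^ 2 * n :=
      one_le_mul_of_one_le_of_one_le (one_le_pow₀ hm1) hn1
    calc (m * n * m + 1 : ℝ) = m ^ 2 * n + 1 := by ring
      _ ≤ 2 * m ^ 2 * n := by linarith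
      _ ≤ (2 * m ^ 2) ^ m * Real.exp 1 ^ m := by rw [← hexp]; gcongr
      _ = _ := by rw [← mul_pow]
  have h3 : T ^ m ≤ m.factorial * (C ^ 2 * (n * m : ℕ)) * (2 * m ^ 2 * Real.exp 1) := by
    refine le_of_pow_le_pow_left₀ hq.ne' (by positivity) ((h S m (n * m) hq).trans ?_)
    rw [mul_pow (_ * _) (2 * (m : ℝ) ^ 2 * Real.exp 1)]
    exact mul_le_mul_of_nonneg_left h1 (by positivity)
  have h4 : (m.factorial : ℝ) ≤ Real.exp 1 * m * (m / Real.exp 1) ^ m := by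
    obtain ⟨k, rfl⟩ := Nat.exists_eq_succ_of_ne_zero hm.ne'
    have := factorial_le_stirling k
    push_cast at this ⊢
    exact this
  have h5 : T ^ m ≤ (m * (2 * Real.exp 1 ^ 2 * C ^ 2 * (m : ℝ) ^ 4) ^ ((m : ℝ)⁻¹)) ^ m := by
    rw [mul_pow, Real.rpow_inv_natCast_pow (by positivity) hm.ne']
    calc T ^ m ≤ m.factorial * (C ^ 2 * (n * m : ℕ)) * (2 * m ^ 2 * Real.exp 1) := h3
      _ ≤ (Real.exp 1 * m * (m / Real.exp 1) ^ m) * (C ^ 2 * (Real.exp 1 ^ m * m)) *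
          (2 * m ^ 2 * Real.exp 1) := by
          push_cast
          rw [← hexp]
          gcongr
      _ = _ := by
          rw [div_pow]
          field_simp
  exact le_of_pow_le_pow_left₀ hm.ne' (by positivity) h5

/-- The upper inclusion `mon H_∞(𝕋^∞) ⊆ B̄`. -/
theorem monHardy_top_subset_setBbar : monHardy ∞ ⊆ setBbar := by
  intro z hz
  refine ⟨hz.1, ?_⟩
  obtain ⟨C, hC, h⟩ := exists_pow_sum_norm_sq_le hz
  set K := 2 * Real.exp 1 ^ 2 * C ^ 2
  set ψ : ℕ → ℝ := fun m => (K * (m : ℝ) ^ 4) ^ ((m : ℝ)⁻¹)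
  have hlog : Tendsto (fun n : ℕ => Real.log n) atTop atTop :=
    Real.tendsto_log_atTop.comp tendsto_natCast_atTop_atTop
  -- The degree m = ⌈log n⌉ is the least allowed by n ≤ e^m; it is asymptotic to log n, and the m-th
  -- root of a polynomial in m tends to 1.
  have hlim : Tendsto (fun n : ℕ => (⌈Real.log n⌉₊ : ℝ) / Real.log n * ψ ⌈Real.log n⌉₊)
      atTop (𝓝 1) := by
    have h1 : Tendsto (fun n : ℕ => (⌈Real.log n⌉₊ : ℝ) / Real.log n) atTop (𝓝 1) :=
      tendsto_nat_ceil_div_atTop.comp hlog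
    have h2 : Tendsto (fun n : ℕ => ψ ⌈Real.log n⌉₊) atTop (𝓝 1) :=
      (tendsto_const_mul_pow_rpow_inv K (by positivity) 4).comp (tendsto_nat_ceil_atTop.comp hlog)
    simpa using h1.mul h2
  have hle : ∀ᶠ n : ℕ in atTop,
      1 / Real.log n * ∑ j ∈ Finset.Icc 1 n, decreasingRearrangement z j ^ 2 ≤
        (⌈Real.log n⌉₊ : ℝ) / Real.log n * ψ ⌈Real.log n⌉₊ := by
    filter_upwards [eventually_gt_atTop 1] with n hn
    have hl : 0 < Real.log n := Real.log_pos (by exact_mod_cast hn)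
    have h1 : ∑ j ∈ Finset.Icc 1 n, decreasingRearrangement z j ^ 2 ≤
        ⌈Real.log n⌉₊ * ψ ⌈Real.log n⌉₊ := by
      refine le_of_forall_pos_le_add fun ε hε => ?_
      obtain ⟨S, hS, hle⟩ := exists_sum_rearrangement_le z n hε
      refine hle.trans (add_le_add_left (sum_norm_sq_le_of_pow_le hC h S (Nat.ceil_pos.2 hl)
        (by omega) ?_) ε)
      rw [hS, ← Real.log_le_iff_le_exp (by positivity)]
      exact Nat.le_ceil _
    rw [one_div, div_mul_eq_mul_div, inv_mul_eq_div]
    exact div_le_div_of_nonneg_right h1 hl.le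
  have hlim' : Tendsto (fun n : ℕ => (((⌈Real.log n⌉₊ : ℝ) / Real.log n *
      ψ ⌈Real.log n⌉₊ : ℝ) : EReal)) atTop (𝓝 ((1 : ℝ) : EReal)) :=
    (continuous_coe_real_ereal.tendsto 1).comp hlim
  calc logLimsup z ≤ limsup (fun n : ℕ => (((⌈Real.log n⌉₊ : ℝ) / Real.log n *
      ψ ⌈Real.log n⌉₊ : ℝ) : EReal)) atTop :=
        limsup_le_limsup (hle.mono fun n hn => EReal.coe_le_coe_iff.2 hn)
    _ = 1 := by rw [hlim'.limsup_eq]; rfl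

/-! ### Polynomials on the polydisc -/

lemma hasDerivAt_eval_mvPolynomial (Q : MvPolynomial ℕ ℂ) {γ : ℂ → ℕ → ℂ} {γ' : ℕ → ℂ} {t : ℂ}
    (hγ : ∀ i, HasDerivAt (fun s => γ s i) (γ' i) t) {J : Finset ℕ} (hJ : ∀ i ∉ J, γ' i = 0) :
    HasDerivAt (fun s => MvPolynomial.eval (γ s) Q)
      (∑ i ∈ J, γ' i * MvPolynomial.eval (γ t) (MvPolynomial.pderiv i Q)) t := by
  classical
  induction Q using MvPolynomial.induction_on with
  | C a => simpa using hasDerivAt_const t a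
  | add P Q hP hQ =>
    simp only [map_add, mul_add, Finset.sum_add_distrib]
    exact hP.add hQ
  | mul_X P i hP =>
    simp only [map_mul, MvPolynomial.eval_X]
    refine (hP.mul (hγ i)).congr_deriv ?_
    simp only [Derivation.leibniz, smul_eq_mul, map_add, map_mul, MvPolynomial.eval_X,
      MvPolynomial.pderiv_X, mul_add, Finset.sum_add_distrib]
    have h1 : ∑ j ∈ J, γ' j * (MvPolynomial.eval (γ t) P *
        MvPolynomial.eval (γ t) (Pi.single (M := fun _ => MvPolynomial ℕ ℂ) j 1 i)) =
        MvPolynomial.eval (γ t) P * γ' i := by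
      by_cases hi : i ∈ J
      · rw [Finset.sum_eq_single i]
        · simp [mul_comm]
        · intro j _ hj
          simp [hj.symm]
        · exact fun h => absurd hi h
      · rw [hJ i hi, mul_zero]
        refine Finset.sum_eq_zero fun j hj => ?_
        have : i ≠ j := fun h => hi (h ▸ hj)
        simp [this]
    rw [h1, Finset.sum_mul, add_comm]
    congr 1
    exact Finset.sum_congr rfl fun j _ => by ring

lemma differentiable_eval_line (Q : MvPolynomial ℕ ℂ) (z u : ℕ → ℂ) {J : Finset ℕ}
    (hJ : ∀ i ∉ J, u i = 0) :
    Differentiable ℂ fun t : ℂ => MvPolynomial.eval (fun i => z i + t * u i) Q := fun t =>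
  (hasDerivAt_eval_mvPolynomial Q (γ := fun t i => z i + t * u i) (γ' := u) (J := J)
    (fun i => by simpa using ((hasDerivAt_id t).mul_const (u i)).const_add (z i))
    hJ).differentiableAt

lemma eval_eq_of_eqOn_vars {Q : MvPolynomial ℕ ℂ} {y z : ℕ → ℂ} (h : ∀ i ∈ Q.vars, y i = z i) :
    MvPolynomial.eval y Q = MvPolynomial.eval z Q := by
  rw [MvPolynomial.eval_eq, MvPolynomial.eval_eq]
  refine Finset.sum_congr rfl fun α hα => ?_
  congr 1
  refine Finset.prod_congr rfl fun i hi => ?_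
  rw [h i ((MvPolynomial.mem_vars_iff_mem_support i).2 ⟨α, hα, hi⟩)]

/-- The maximum principle for polynomials on the polydisc. -/
lemma norm_eval_le_of_polytorus {Q : MvPolynomial ℕ ℂ} {C : ℝ}
    (hQ : ∀ w, ‖MvPolynomial.eval (torusPoint w) Q‖ ≤ C) {z : ℕ → ℂ} (hz : ∀ i, ‖z i‖ ≤ 1) :
    ‖MvPolynomial.eval z Q‖ ≤ C := by
  classical
  -- J collects the coordinates that may lie inside the disc. The one-variable maximum principle
  -- pushes them to the circle one at a time.
  have key : ∀ (J : Finset ℕ) (z : ℕ → ℂ), (∀ i, ‖z i‖ ≤ 1) → (∀ i ∉ J, ‖z i‖ = 1) →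
      ‖MvPolynomial.eval z Q‖ ≤ C := by
    intro J
    induction J using Finset.induction_on with
    | empty =>
      intro z _ h
      exact hQ fun i => ⟨z i, mem_sphere_zero_iff_norm.2 (h i (Finset.notMem_empty i))⟩
    | insert j J hj ih =>
      intro z hz h
      set z₀ : ℕ → ℂ := Function.update z j 0
      set f : ℂ → ℂ := fun t =>
        MvPolynomial.eval (fun i => z₀ i + t * Pi.single (M := fun _ => ℂ) j 1 i) Q
      have hf : Differentiable ℂ f := differentiable_eval_line Q z₀ _ (J := {j}) fun i hi => by
        simp [Finset.notMem_singleton.1 hi]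
      have hft : ∀ t, f t = MvPolynomial.eval (Function.update z j t) Q := by
        intro t
        simp only [f]
        congr 2
        funext i
        rcases eq_or_ne i j with rfl | hij
        · simp [z₀]
        · simp [z₀, hij]
      have h1 : ‖f (z j)‖ ≤ C := by
        refine Complex.norm_le_of_forall_mem_frontier_norm_le (U := Metric.ball 0 1)
          Metric.isBounded_ball hf.diffContOnCl (fun t ht => ?_) ?_
        · rw [frontier_ball _ one_ne_zero, mem_sphere_zero_iff_norm] at ht
          rw [hft]
          refine ih _ (fun i => ?_) fun i hi => ?_
          · rcases eq_or_ne i j with rfl | hij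
            · simp [ht]
            · simpa [hij] using hz i
          · rcases eq_or_ne i j with rfl | hij
            · simp [ht]
            · simpa [hij] using h i (by simp [hij, hi])
        · rw [closure_ball _ one_ne_zero]
          simpa using hz j
      rwa [hft, Function.update_eq_self] at h1
  -- Coordinates absent from Q are reset to 1, so only finitely many remain inside the disc.
  rw [eval_eq_of_eqOn_vars (z := fun i => if i ∈ Q.vars then z i else 1)
    fun i hi => by simp [hi]]
  refine key Q.vars _ (fun i => ?_) fun i hi => by simp [hi]
  split_ifs
  · exact hz i
  · simp

/-! ### Weighted coefficient bounds through partial derivatives. -/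

/-- With suitable phases u_j of modulus at most 1, the sum is the derivative at 0 of t ↦ Q(rw + tu).
This line stays in the closed polydisc for |t| ≤ 1 - r, so Cauchy's estimate applies and the bound
does not depend on J. -/
lemma sum_norm_pderiv_le {Q : MvPolynomial ℕ ℂ} {C : ℝ}
    (hQ : ∀ w, ‖MvPolynomial.eval (torusPoint w) Q‖ ≤ C) {r : ℝ} (hr0 : 0 ≤ r) (hr1 : r < 1)
    (w : ℕ → Circle) (J : Finset ℕ) :
    ∑ j ∈ J, ‖MvPolynomial.eval (fun i => r * torusPoint w i) (MvPolynomial.pderiv j Q)‖ ≤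
      C / (1 - r) := by
  classical
  choose θ hθ1 hθ2 using fun j => exists_unimodular_mul
    (MvPolynomial.eval (fun i => r * torusPoint w i) (MvPolynomial.pderiv j Q))
  set u : ℕ → ℂ := fun j => if j ∈ J then θ j else 0
  have hu : ∀ i ∉ J, u i = 0 := fun i hi => by simp [u, hi]
  have hu1 : ∀ i, ‖u i‖ ≤ 1 := by
    intro i
    simp only [u]
    split_ifs
    · exact hθ1 i
    · simp
  have hd := hasDerivAt_eval_mvPolynomial Q (γ := fun t i => r * torusPoint w i + t * u i)
    (γ' := u) (t := 0) (J := J)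
    (fun i => by
      simpa using ((hasDerivAt_id (0 : ℂ)).mul_const (u i)).const_add (r * torusPoint w i)) hu
  have h1 := Complex.norm_deriv_le_of_forall_mem_sphere_norm_le (c := 0) (R := 1 - r) (C := C)
    (sub_pos.2 hr1) (differentiable_eval_line Q (fun i => r * torusPoint w i) u hu).diffContOnCl
    fun t ht => norm_eval_le_of_polytorus hQ fun i => by
      rw [mem_sphere_zero_iff_norm] at ht
      refine (norm_add_le _ _).trans ?_
      rw [norm_mul, norm_mul, ht, torusPoint, Circle.norm_coe, Complex.norm_of_nonneg hr0, mul_one]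
      nlinarith [hu1 i]
  rw [hd.deriv] at h1
  refine le_of_eq_of_le ?_ h1
  rw [← Complex.norm_of_nonneg (Finset.sum_nonneg fun _ _ => norm_nonneg _)]
  push_cast
  congr 1
  refine Finset.sum_congr rfl fun j hj => ?_
  simp only [zero_mul, add_zero, u, if_pos hj]
  exact (hθ2 j).symm

/-- The dilation `z ↦ Q (r z)` of a polynomial. -/
def dilatePolynomial (r : ℂ) (Q : MvPolynomial ℕ ℂ) : MvPolynomial ℕ ℂ :=
  ∑ α ∈ Q.support, MvPolynomial.monomial α (r ^ α.degree * Q.coeff α)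

lemma coeff_dilatePolynomial (r : ℂ) (Q : MvPolynomial ℕ ℂ) (α : ℕ →₀ ℕ) :
    (dilatePolynomial r Q).coeff α = r ^ α.degree * Q.coeff α := by
  classical
  simp only [dilatePolynomial, MvPolynomial.coeff_sum, MvPolynomial.coeff_monomial]
  rw [Finset.sum_ite_eq' Q.support α]
  split_ifs with h
  · rfl
  · rw [MvPolynomial.notMem_support_iff.1 h, mul_zero]

lemma eval_dilatePolynomial (r : ℂ) (Q : MvPolynomial ℕ ℂ) (z : ℕ → ℂ) :
    MvPolynomial.eval z (dilatePolynomial r Q) = MvPolynomial.eval (fun i => r * z i) Q := by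
  rw [dilatePolynomial, map_sum, MvPolynomial.eval_eq]
  refine Finset.sum_congr rfl fun α _ => ?_
  rw [MvPolynomial.eval_monomial, Finsupp.prod, Finsupp.degree_apply, ← Finset.prod_pow_eq_pow_sum]
  simp only [mul_pow, Finset.prod_mul_distrib]
  ring

lemma divisorWeight_le_two_pow (α : ℕ →₀ ℕ) : divisorWeight α ≤ 2 ^ α.degree := by
  rw [divisorWeight, Finsupp.prod, Finsupp.degree_apply, ← Finset.prod_pow_eq_pow_sum]
  refine Finset.prod_le_prod (fun _ _ => by positivity) fun i _ => ?_
  have h : α i + 1 ≤ 2 ^ α i := Nat.lt_two_pow_self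
  exact_mod_cast h

/-- Carleman's inequality for w ↦ ∂_jQ(rw), whose coefficient at β is r^{|β|}(β_j+1) times that of Q
at β + e_j. Bounding Carleman's weight by 2^{|β|} produces the base r²/2, and the L_1 norms are
summed over j under the integral. -/
lemma sum_sqrt_coeff_le {Q : MvPolynomial ℕ ℂ} {C : ℝ}
    (hQ : ∀ w, ‖MvPolynomial.eval (torusPoint w) Q‖ ≤ C) {r : ℝ} (hr0 : 0 ≤ r) (hr1 : r < 1)
    (J : Finset ℕ) (A : ℕ → Finset (ℕ →₀ ℕ)) :
    ∑ j ∈ J, √(∑ β ∈ A j, (r ^ 2 / 2) ^ β.degree * ‖Q.coeff (β + Finsupp.single j 1)‖ ^ 2) ≤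
      C / (1 - r) := by
  set P : ℕ → MvPolynomial ℕ ℂ := fun j => dilatePolynomial r (MvPolynomial.pderiv j Q)
  have h1 : ∀ j, √(∑ β ∈ A j, (r ^ 2 / 2) ^ β.degree * ‖Q.coeff (β + Finsupp.single j 1)‖ ^ 2) ≤
      ∫ w, ‖MvPolynomial.eval (torusPoint w) (P j)‖ ∂polytorusMeasure := by
    intro j
    refine Real.sqrt_le_iff.2 ⟨integral_nonneg fun _ => norm_nonneg _, ?_⟩
    refine le_trans (Finset.sum_le_sum fun β _ => ?_) (sum_coeff_sq_div_divisorWeight_le (P j) (A j))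
    rw [coeff_dilatePolynomial, MvPolynomial.coeff_pderiv, le_div_iff₀ (divisorWeight_pos β),
      norm_mul, norm_mul, norm_pow, Complex.norm_of_nonneg hr0]
    have h2 : (1 : ℝ) ≤ ‖((β j : ℂ) + 1)‖ := by
      have : ((β j : ℂ) + 1) = ((β j + 1 : ℕ) : ℂ) := by push_cast; ring
      rw [this, Complex.norm_natCast]
      exact_mod_cast Nat.le_add_left 1 (β j)
    set c := ‖Q.coeff (β + Finsupp.single j 1)‖
    have hc : 0 ≤ c := norm_nonneg _
    calc (r ^ 2 / 2) ^ β.degree * c ^ 2 * divisorWeight β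
        ≤ (r ^ 2 / 2) ^ β.degree * c ^ 2 * 2 ^ β.degree := by
          gcongr
          exact divisorWeight_le_two_pow β
      _ = (r ^ β.degree * c) ^ 2 := by
          rw [div_pow, mul_pow, ← pow_mul, ← pow_mul, mul_comm 2]
          field_simp
      _ ≤ (r ^ β.degree * (c * ‖((β j : ℂ) + 1)‖)) ^ 2 := by
          gcongr
          exact le_mul_of_one_le_right hc h2
  refine (Finset.sum_le_sum fun j _ => h1 j).trans ?_
  rw [← integral_finsetSum _ fun j _ => integrable_of_continuous_polytorus
    (continuous_eval_torusPoint (P j)).norm]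
  refine (integral_mono (integrable_of_continuous_polytorus (continuous_finsetSum _ fun j _ =>
    (continuous_eval_torusPoint (P j)).norm)) (integrable_const (C / (1 - r))) fun w => ?_).trans_eq
    (by simp)
  simp only [P, eval_dilatePolynomial]
  exact sum_norm_pderiv_le hQ hr0 hr1 w J

lemma tendsto_ofReal_fejerWeight (α : ℕ →₀ ℕ) :
    Tendsto (fun n => (fejerWeight n α : ℂ)) atTop (𝓝 1) := by
  have := (Complex.continuous_ofReal.tendsto 1).comp (tendsto_fejerWeight α)
  rwa [Complex.ofReal_one] at this

lemma sum_sqrt_fourierCoeff_le {u : (ℕ → Circle) → ℂ} {C : ℝ}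
    (hum : AEStronglyMeasurable u polytorusMeasure) (hC : ∀ᵐ w ∂polytorusMeasure, ‖u w‖ ≤ C)
    (hneg : ∀ k : ℕ →₀ ℤ, (∃ i, k i < 0) → polytorusFourierCoeff u k = 0)
    {r : ℝ} (hr0 : 0 ≤ r) (hr1 : r < 1) (J : Finset ℕ) (A : ℕ → Finset (ℕ →₀ ℕ)) :
    ∑ j ∈ J, √(∑ β ∈ A j, (r ^ 2 / 2) ^ β.degree *
      ‖polytorusFourierCoeff u (natExp (β + Finsupp.single j 1))‖ ^ 2) ≤ C / (1 - r) := by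
  have h1 := fun n => sum_sqrt_coeff_le (norm_eval_fejerMean_le hum hC hneg n) hr0 hr1 J A
  simp_rw [coeff_fejerMean] at h1
  refine le_of_tendsto' (x := atTop) (tendsto_finsetSum _ fun j _ => ?_) h1
  refine (tendsto_finsetSum _ fun β _ => ?_).sqrt
  have h3 := (((tendsto_ofReal_fejerWeight (β + Finsupp.single j 1)).mul_const
    (polytorusFourierCoeff u (natExp (β + Finsupp.single j 1)))).norm.pow 2).const_mul
    ((r ^ 2 / 2) ^ β.degree)
  rwa [one_mul] at h3

/-! ### The lower inclusion for `H_∞` -/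

lemma exists_log_bound {y : EllInfty} (hy : y ∈ polydisc) {A : ℝ} (hA : 0 ≤ A)
    (h : logLimsup y < (A : EReal)) : ∃ B : ℝ, 0 ≤ B ∧ ∀ S : Finset ℕ, S.Nonempty →
      ∑ i ∈ S, ‖y i‖ ^ 2 ≤ A * Real.log S.card + B := by
  obtain ⟨N, hN⟩ := eventually_atTop.1 (eventually_sum_rearrangement_le h)
  refine ⟨N, by positivity, fun S hS => ?_⟩
  have hlog : 0 ≤ A * Real.log S.card := mul_nonneg hA (Real.log_natCast_nonneg _)
  rcases le_total N S.card with hle | hle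
  · have := (sum_norm_sq_le_sum_rearrangement y S).trans (hN _ hle)
    have h0 : (0 : ℝ) ≤ N := by positivity
    linarith
  · have h1 : ∑ i ∈ S, ‖y i‖ ^ 2 ≤ S.card := by
      have : ∀ i ∈ S, ‖y i‖ ^ 2 ≤ 1 := fun i _ =>
        pow_le_one₀ (norm_nonneg _) ((norm_coord_le y i).trans (mem_polydisc.1 hy).le)
      simpa using Finset.sum_le_sum this
    have h2 : (S.card : ℝ) ≤ N := by exact_mod_cast hle
    linarith

lemma mul_log_add_mul_rpow_le {A B a : ℝ} (hA : 0 ≤ A) (hB : 0 ≤ B) (ha : a < 1) {N : ℝ}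
    (hN : 1 ≤ N) : (A * Real.log N + B) * N ^ a ≤ (A / (1 - a) + B) * N := by
  have h1 : 0 < 1 - a := by linarith
  have hN0 : 0 < N := by linarith
  have h2 := Real.log_le_rpow_div hN0.le h1
  have h3 : N ^ (1 - a) * N ^ a = N := by
    rw [← Real.rpow_add hN0]; simp
  have h4 : N ^ a ≤ N := by
    simpa using Real.rpow_le_rpow_of_exponent_le hN ha.le
  calc (A * Real.log N + B) * N ^ a ≤ (A * (N ^ (1 - a) / (1 - a)) + B) * N ^ a := by gcongr
    _ = A / (1 - a) * (N ^ (1 - a) * N ^ a) + B * N ^ a := by ring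
    _ ≤ A / (1 - a) * N + B * N := by rw [h3]; gcongr
    _ = _ := by ring

/-- Let N = card S. As y_j is smallest, N|y_j|² ≤ A log N + B with A < 1, while the product over S
is at most a constant times N^{a'} with a' < 1. Hence the expression is O((log N + 1) N^{a'-1}). -/
lemma exists_product_bound {y : EllInfty} (hy : y ∈ setB) :
    ∃ r D : ℝ, 0 < r ∧ r < 1 ∧ ‖y‖ < r ∧ 0 ≤ D ∧ ∀ (j : ℕ) (S : Finset ℕ),
      (∀ i ∈ S, ‖y j‖ ≤ ‖y i‖) → ‖y j‖ ^ 2 * ∏ i ∈ S, (1 - (‖y i‖ / r) ^ 2)⁻¹ ≤ D := by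
  classical
  obtain ⟨hy1, hy2⟩ := hy
  have hy1' := mem_polydisc.1 hy1
  obtain ⟨A₀, hA₀, hA₀1⟩ := EReal.lt_iff_exists_real_btwn.1 hy2
  have hA₀1' : A₀ < 1 := by exact_mod_cast hA₀1
  set A := max A₀ 0
  have hA0 : 0 ≤ A := le_max_right _ _
  have hA1 : A < 1 := max_lt hA₀1' one_pos
  have hA : logLimsup y < (A : EReal) :=
    hA₀.trans_le (EReal.coe_le_coe_iff.2 (le_max_left _ _))
  -- Besides r > ‖y‖, r² > A is required, so that the rescaled point y/r still has logarithmic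
  -- constant a = A/r² < 1.
  obtain ⟨r, hr, hr1⟩ := exists_between (max_lt (Real.sqrt_lt' one_pos |>.2 (by simpa using hA1))
    hy1' : max (√A) ‖y‖ < 1)
  have hyr : ‖y‖ < r := (le_max_right _ _).trans_lt hr
  have hr0 : 0 < r := (norm_nonneg _).trans_lt hyr
  have hAr : A < r ^ 2 := (Real.sqrt_lt' hr0).1 ((le_max_left _ _).trans_lt hr)
  set a := A / r ^ 2
  have ha0 : 0 ≤ a := by positivity
  have ha1 : a < 1 := (div_lt_one (by positivity)).2 hAr
  -- Then 1 - δ = (1 + a)/2 > a, which makes a' = a/(1 - δ) less than 1.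
  set δ := (1 - a) / 2
  have hδ0 : 0 < δ := by simp only [δ]; linarith
  have hδ1 : 0 < 1 - δ := by simp only [δ]; linarith
  set a' := a / (1 - δ)
  have ha'1 : a' < 1 := by rw [div_lt_one hδ1]; simp only [δ]; linarith
  set ρ := (‖y‖ / r) ^ 2
  have hρ1 : ρ < 1 := pow_lt_one₀ (by positivity) ((div_lt_one hr0).2 hyr) two_ne_zero
  have hx : ∀ i, (‖y i‖ / r) ^ 2 ≤ ρ := fun i => by
    have := norm_coord_le y i
    simp only [ρ]; gcongr
  obtain ⟨B, hB0, hB⟩ := exists_log_bound hy1 hA0 hA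
  -- The finitely many coordinates with (|y_i|/r)² ≥ δ cost a fixed factor K. The others satisfy
  -- (1-x)^{-1} ≤ exp(x/(1-δ)), which feeds the logarithmic bound.
  have hfin : {i | r * √δ ≤ ‖y i‖}.Finite := finite_setOf_le_norm hA (by positivity)
  set T := hfin.toFinset
  set K := ((1 - ρ)⁻¹) ^ T.card
  have hρinv : 1 ≤ (1 - ρ)⁻¹ := (one_le_inv₀ (by linarith)).2 (by
    have : 0 ≤ ρ := by positivity
    linarith)
  have hK1 : 1 ≤ K := one_le_pow₀ hρinv
  set E := Real.exp (B / (r ^ 2 * (1 - δ)))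
  have hfactor : ∀ i, (1 - (‖y i‖ / r) ^ 2)⁻¹ ≤
      Real.exp ((‖y i‖ / r) ^ 2 / (1 - δ)) * (if i ∈ T then (1 - ρ)⁻¹ else 1) := by
    intro i
    split_ifs with hi
    · exact (inv_anti₀ (by linarith) (by linarith [hx i])).trans
        (le_mul_of_one_le_left (by linarith) (Real.one_le_exp
          (div_nonneg (by positivity) (by linarith))))
    · rw [mul_one]
      refine inv_one_sub_le_exp (by positivity) ?_ (by linarith)
      have hi' : ‖y i‖ < r * √δ := by
        simpa [T] using hi
      rw [div_pow, div_le_iff₀ (by positivity)]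
      calc ‖y i‖ ^ 2 ≤ (r * √δ) ^ 2 := pow_le_pow_left₀ (norm_nonneg _) hi'.le 2
        _ = δ * r ^ 2 := by rw [mul_pow, Real.sq_sqrt hδ0.le]; ring
  have hprod : ∀ S : Finset ℕ, ∏ i ∈ S, (1 - (‖y i‖ / r) ^ 2)⁻¹ ≤
      Real.exp ((∑ i ∈ S, ‖y i‖ ^ 2) / (r ^ 2 * (1 - δ))) * K := by
    intro S
    refine (Finset.prod_le_prod (fun i _ => inv_nonneg.2 (by linarith [hx i]))
      fun i _ => hfactor i).trans ?_
    rw [Finset.prod_mul_distrib, ← Real.exp_sum]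
    refine mul_le_mul (le_of_eq ?_) ?_ (Finset.prod_nonneg fun i _ => by
      split_ifs <;> linarith) (Real.exp_nonneg _)
    · congr 1
      rw [Finset.sum_div]
      refine Finset.sum_congr rfl fun i _ => ?_
      rw [div_pow, div_div]
    · rw [Finset.prod_ite, Finset.prod_const, Finset.prod_const_one, mul_one]
      exact pow_le_pow_right₀ hρinv (Finset.card_le_card fun i hi => (Finset.mem_filter.1 hi).2)
  refine ⟨r, max 1 (K * E * (A / (1 - a') + B)), hr0, hr1, hyr, by positivity, fun j S hS => ?_⟩
  rcases S.eq_empty_or_nonempty with rfl | hne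
  · refine le_trans ?_ (le_max_left _ _)
    simpa using (norm_coord_le y j).trans hy1'.le
  refine le_trans ?_ (le_max_right _ _)
  set N : ℝ := (S.card : ℝ)
  have hN1 : 1 ≤ N := Nat.one_le_cast.2 hne.card_pos
  have hN0 : 0 < N := by linarith
  set s := ∑ i ∈ S, ‖y i‖ ^ 2
  have hs : s ≤ A * Real.log N + B := hB S hne
  have h1 : ‖y j‖ ^ 2 * N ≤ A * Real.log N + B := by
    refine le_trans ?_ hs
    rw [mul_comm, ← nsmul_eq_mul]
    exact Finset.card_nsmul_le_sum _ _ _ fun i hi => pow_le_pow_left₀ (norm_nonneg _) (hS i hi) 2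
  have h2 : ∏ i ∈ S, (1 - (‖y i‖ / r) ^ 2)⁻¹ ≤ K * E * N ^ a' := by
    refine (hprod S).trans ?_
    rw [mul_comm, mul_assoc]
    refine mul_le_mul_of_nonneg_left ?_ (by positivity)
    rw [Real.rpow_def_of_pos hN0, ← Real.exp_add]
    refine Real.exp_le_exp.2 ((div_le_div_of_nonneg_right hs (by positivity)).trans_eq ?_)
    simp only [a', a]
    field_simp
    ring
  have h3 := mul_log_add_mul_rpow_le hA0 hB0 ha'1 hN1
  have h4 : ‖y j‖ ^ 2 ≤ (A * Real.log N + B) / N := (le_div_iff₀ hN0).2 h1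
  calc ‖y j‖ ^ 2 * ∏ i ∈ S, (1 - (‖y i‖ / r) ^ 2)⁻¹
      ≤ (A * Real.log N + B) / N * (K * E * N ^ a') := by
        refine mul_le_mul h4 h2 (Finset.prod_nonneg fun i _ =>
          inv_nonneg.2 (by linarith [hx i])) ((sq_nonneg _).trans h4)
    _ = K * E * (((A * Real.log N + B) * N ^ a') / N) := by ring
    _ ≤ K * E * (A / (1 - a') + B) := by
        refine mul_le_mul_of_nonneg_left ?_ (by positivity)
        rwa [div_le_iff₀ hN0]

lemma seqMonomial_add_single (z : EllInfty) (β : ℕ →₀ ℕ) (j : ℕ) :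
    seqMonomial z (β + Finsupp.single j 1) = seqMonomial z β * z j := by
  classical
  rw [seqMonomial, Finsupp.prod_add_index' (by simp) (fun _ _ _ => pow_add _ _ _),
    Finsupp.prod_single_index (by simp), pow_one]
  rfl

lemma sum_geometric_le_inv {x : ℝ} (h0 : 0 ≤ x) (h1 : x < 1) (M : ℕ) :
    ∑ k ∈ Finset.range M, x ^ k ≤ (1 - x)⁻¹ :=
  sum_le_hasSum _ (fun _ _ => by positivity) (hasSum_geometric_of_lt_one h0 h1)

/-- The block of the monomial series in which the `j`-th coordinate is the smallest one. -/
lemma sum_block_le {y z : EllInfty} (hz : ∀ i, ‖z i‖ = ‖y i‖ / √2) {r D : ℝ} (hr0 : 0 < r)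
    (hyr : ‖y‖ < r) {j : ℕ} {S : Finset ℕ}
    (hD : ‖y j‖ ^ 2 * ∏ i ∈ S, (1 - (‖y i‖ / r) ^ 2)⁻¹ ≤ D) {B : Finset (ℕ →₀ ℕ)}
    (hB : ∀ β ∈ B, β.support ⊆ S) (c : (ℕ →₀ ℕ) → ℂ) :
    ∑ β ∈ B, ‖c β * (seqMonomial z β * z j)‖ ≤
      √D * √(∑ β ∈ B, (r ^ 2 / 2) ^ β.degree * ‖c β‖ ^ 2) := by
  have h2 : (0 : ℝ) < √2 := by positivity
  have hsq : ∀ d : ℕ, √((r ^ 2 / 2) ^ d) = (r / √2) ^ d := by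
    intro d
    have h : r ^ 2 / 2 = (r / √2) ^ 2 := by rw [div_pow, Real.sq_sqrt two_pos.le]
    rw [h, ← pow_mul, mul_comm, pow_mul, Real.sqrt_sq (by positivity)]
  -- |z^β| splits as (r/√2)^{|β|}∏(|y_i|/r)^{β_i}: the first factor joins the coefficients and is
  -- the weight of `sum_sqrt_coeff_le`, the second is summed as a geometric product. The spare 1/√2
  -- in z_j is dropped.
  have hterm : ∀ β : ℕ →₀ ℕ, ‖c β * (seqMonomial z β * z j)‖ ≤
      ‖y j‖ * ((√((r ^ 2 / 2) ^ β.degree) * ‖c β‖) * β.prod fun i k => (‖y i‖ / r) ^ k) := by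
    intro β
    have h3 : ‖seqMonomial z β‖ =
        √((r ^ 2 / 2) ^ β.degree) * β.prod fun i k => (‖y i‖ / r) ^ k := by
      rw [hsq, norm_seqMonomial, Finsupp.degree_apply, Finsupp.prod, Finsupp.prod,
        ← Finset.prod_pow_eq_pow_sum, ← Finset.prod_mul_distrib]
      refine Finset.prod_congr rfl fun i _ => ?_
      rw [← mul_pow, hz]
      congr 1
      field_simp
    rw [norm_mul, norm_mul, h3]
    have h4 : ‖z j‖ ≤ ‖y j‖ := by
      rw [hz]
      exact div_le_self (norm_nonneg _) (Real.one_le_sqrt.2 one_le_two)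
    have h5 : 0 ≤ β.prod fun i k => (‖y i‖ / r) ^ k :=
      Finset.prod_nonneg fun i _ => by positivity
    calc ‖c β‖ * (√((r ^ 2 / 2) ^ β.degree) * (β.prod fun i k => (‖y i‖ / r) ^ k) * ‖z j‖)
        ≤ ‖c β‖ * (√((r ^ 2 / 2) ^ β.degree) * (β.prod fun i k => (‖y i‖ / r) ^ k) * ‖y j‖) := by
          gcongr
      _ = _ := by ring
  refine (Finset.sum_le_sum fun β _ => hterm β).trans ?_
  rw [← Finset.mul_sum]
  have hcs := Real.sum_mul_le_sqrt_mul_sqrt B (fun β => √((r ^ 2 / 2) ^ β.degree) * ‖c β‖)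
    (fun β => β.prod fun i k => (‖y i‖ / r) ^ k)
  have e1 : ∀ β : ℕ →₀ ℕ, (√((r ^ 2 / 2) ^ β.degree) * ‖c β‖) ^ 2 =
      (r ^ 2 / 2) ^ β.degree * ‖c β‖ ^ 2 := fun β => by
    rw [mul_pow, Real.sq_sqrt (by positivity)]
  have e2 : ∀ β : ℕ →₀ ℕ, (β.prod fun i k => (‖y i‖ / r) ^ k) ^ 2 =
      β.prod fun i k => ((‖y i‖ / r) ^ 2) ^ k := fun β => by
    rw [Finsupp.prod, Finsupp.prod, ← Finset.prod_pow]
    exact Finset.prod_congr rfl fun i _ => by rw [← pow_mul, ← pow_mul, mul_comm]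
  simp_rw [e1, e2] at hcs
  have h6 : ∑ β ∈ B, (β.prod fun i k => ((‖y i‖ / r) ^ 2) ^ k) ≤
      ∏ i ∈ S, (1 - (‖y i‖ / r) ^ 2)⁻¹ :=
    sum_finsuppProd_le (f := fun i k => ((‖y i‖ / r) ^ 2) ^ k) hB (fun i k => by positivity)
      (fun i => pow_zero _) fun i _ M => sum_geometric_le_inv (by positivity)
        (pow_lt_one₀ (by positivity) ((div_lt_one hr0).2 ((norm_coord_le y i).trans_lt hyr))
          two_ne_zero) M
  set X := √(∑ β ∈ B, (r ^ 2 / 2) ^ β.degree * ‖c β‖ ^ 2)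
  calc ‖y j‖ * ∑ β ∈ B, √((r ^ 2 / 2) ^ β.degree) * ‖c β‖ * (β.prod fun i k => (‖y i‖ / r) ^ k)
      ≤ ‖y j‖ * (X * √(∏ i ∈ S, (1 - (‖y i‖ / r) ^ 2)⁻¹)) := by
        refine mul_le_mul_of_nonneg_left (hcs.trans ?_) (norm_nonneg _)
        gcongr
    _ = √(‖y j‖ ^ 2 * ∏ i ∈ S, (1 - (‖y i‖ / r) ^ 2)⁻¹) * X := by
        rw [Real.sqrt_mul (sq_nonneg _), Real.sqrt_sq (norm_nonneg _)]
        ring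
    _ ≤ √D * X := by gcongr

/-- Blocks are indexed by the coordinate of smallest |y_j| in the support of α. Minimality makes the
product bound uniform over the blocks, and the weighted ℓ_2 norms of the blocks are summable in j.
-/
lemma summable_of_mem_setB {y z : EllInfty} (hy : y ∈ setB) (hz : ∀ i, ‖z i‖ = ‖y i‖ / √2)
    {u : (ℕ → Circle) → ℂ} {C : ℝ} (hum : AEStronglyMeasurable u polytorusMeasure)
    (hC : ∀ᵐ w ∂polytorusMeasure, ‖u w‖ ≤ C)
    (hneg : ∀ k : ℕ →₀ ℤ, (∃ i, k i < 0) → polytorusFourierCoeff u k = 0) :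
    Summable fun α : ℕ →₀ ℕ => ‖polytorusFourierCoeff u (natExp α) * seqMonomial z α‖ := by
  classical
  obtain ⟨r, D, hr0, hr1, hyr, _, hD⟩ := exists_product_bound hy
  set c : (ℕ →₀ ℕ) → ℂ := fun α => polytorusFourierCoeff u (natExp α)
  refine summable_of_sum_le (c := ‖c 0 * seqMonomial z 0‖ + √D * (C / (1 - r)))
    (fun _ => norm_nonneg _) fun A₀ => ?_
  set A₁ := A₀.filter fun α => α ≠ 0
  have hsplit : ∑ α ∈ A₀, ‖c α * seqMonomial z α‖ ≤
      ‖c 0 * seqMonomial z 0‖ + ∑ α ∈ A₁, ‖c α * seqMonomial z α‖ := by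
    rw [← Finset.sum_filter_add_sum_filter_not A₀ (fun α => α = 0)]
    refine add_le_add_left ?_ _
    refine (Finset.sum_le_sum_of_subset_of_nonneg (t := {0}) (fun α hα => ?_)
      fun _ _ _ => norm_nonneg _).trans_eq (Finset.sum_singleton _ _)
    exact Finset.mem_singleton.2 (Finset.mem_filter.1 hα).2
  refine hsplit.trans (add_le_add_right ?_ _)
  have hmin : ∀ α : ℕ →₀ ℕ, α ≠ 0 → ∃ j ∈ α.support, ∀ i ∈ α.support, ‖y j‖ ≤ ‖y i‖ := fun α hα =>
    Finset.exists_min_image _ _ (Finsupp.support_nonempty_iff.2 hα)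
  choose! j hj hjmin using hmin
  set J := A₁.image j
  set B : ℕ → Finset (ℕ →₀ ℕ) := fun k =>
    (A₁.filter fun α => j α = k).image fun α => α - Finsupp.single k 1
  have hsub : ∀ α ∈ A₁, α - Finsupp.single (j α) 1 + Finsupp.single (j α) 1 = α := by
    intro α hα
    have h1 := Finsupp.mem_support_iff.1 (hj α (Finset.mem_filter.1 hα).2)
    exact tsub_add_cancel_of_le (Finsupp.single_le_iff.2 (by omega))
  have hblocks : ∑ α ∈ A₁, ‖c α * seqMonomial z α‖ = ∑ k ∈ J, ∑ β ∈ B k,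
      ‖c (β + Finsupp.single k 1) * (seqMonomial z β * z k)‖ := by
    rw [← Finset.sum_fiberwise_of_maps_to (t := J) (g := j)
      fun α hα => Finset.mem_image_of_mem j hα]
    refine Finset.sum_congr rfl fun k _ => ?_
    rw [Finset.sum_image]
    · refine Finset.sum_congr rfl fun α hα => ?_
      obtain ⟨hα1, rfl⟩ := Finset.mem_filter.1 hα
      rw [← seqMonomial_add_single, hsub α hα1]
    · intro α hα α' hα' h
      obtain ⟨hα1, hk⟩ := Finset.mem_filter.1 hα
      obtain ⟨hα1', hk'⟩ := Finset.mem_filter.1 hα'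
      have e1 := hsub α hα1
      have e2 := hsub α' hα1'
      rw [hk] at e1
      rw [hk'] at e2
      rw [← e1, ← e2]
      exact congrArg (· + Finsupp.single k 1) h
  rw [hblocks]
  have hbound := sum_sqrt_fourierCoeff_le hum hC hneg hr0.le hr1 J B
  refine le_trans ?_ (mul_le_mul_of_nonneg_left hbound (Real.sqrt_nonneg D))
  rw [Finset.mul_sum]
  refine Finset.sum_le_sum fun k _ => ?_
  refine sum_block_le hz hr0 hyr (S := (B k).biUnion fun β => β.support) (hD k _ fun i hi => ?_)
    (fun β hβ => Finset.subset_biUnion_of_mem (fun β : ℕ →₀ ℕ => β.support) hβ)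
    (fun β => c (β + Finsupp.single k 1))
  obtain ⟨β, hβ, hi⟩ := Finset.mem_biUnion.1 hi
  obtain ⟨α, hα, rfl⟩ := Finset.mem_image.1 hβ
  obtain ⟨hα1, rfl⟩ := Finset.mem_filter.1 hα
  exact hjmin α (Finset.mem_filter.1 hα1).2 i (Finsupp.support_tsub hi)

lemma exists_ae_bound_of_Lp_top (f : Lp ℂ ∞ polytorusMeasure) :
    ∃ C : ℝ, ∀ᵐ w ∂polytorusMeasure, ‖f w‖ ≤ C := by
  refine ⟨(eLpNormEssSup f polytorusMeasure).toReal, ?_⟩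
  have hne : eLpNormEssSup f polytorusMeasure ≠ ∞ := by
    rw [← eLpNorm_exponent_top]; exact Lp.eLpNorm_ne_top f
  filter_upwards [ae_le_eLpNormEssSup (f := f) (μ := polytorusMeasure)] with w hw
  rw [← toReal_enorm]
  exact ENNReal.toReal_mono hne hw

/-- The lower inclusion `2^{-1/2} B ⊆ mon H_∞(𝕋^∞)`. -/
theorem smul_setB_subset_monHardy_top : (1 / Real.sqrt 2 : ℝ) • setB ⊆ monHardy ∞ := by
  rintro _ ⟨y, hy, rfl⟩
  have h1 : (1 : ℝ) ≤ √2 := Real.one_le_sqrt.2 one_le_two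
  have hz : ∀ i, ‖((1 / √2 : ℝ) • y) i‖ = ‖y i‖ / √2 := by
    intro i
    rw [lp.coeFn_smul, Pi.smul_apply, norm_smul, Real.norm_of_nonneg (by positivity)]
    ring
  refine ⟨mem_polydisc.2 ?_, fun f hf => ?_⟩
  · show ‖(1 / √2 : ℝ) • y‖ < 1
    rw [norm_smul, Real.norm_of_nonneg (by positivity)]
    refine lt_of_le_of_lt ?_ (mem_polydisc.1 hy.1)
    exact mul_le_of_le_one_left (norm_nonneg _) (by rw [one_div]; exact inv_le_one_of_one_le₀ h1)
  · obtain ⟨C, hC⟩ := exists_ae_bound_of_Lp_top f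
    exact summable_of_mem_setB hy hz (Lp.aestronglyMeasurable f) hC hf

/-! ### Cauchy's formula on polydiscs and monomial coefficients -/

lemma norm_prod_geometric {N : ℕ} (x : Fin N → ℂ) (α : Fin N → ℕ) :
    ‖∏ i, x i ^ α i‖ = ∏ i, ‖x i‖ ^ α i := by
  simp [norm_prod]

/-- The multivariate geometric series. -/
lemma hasSum_prod_geometric (N : ℕ) (x : Fin N → ℂ) (hx : ∀ i, ‖x i‖ < 1) :
    (Summable fun α : Fin N → ℕ => ‖∏ i, x i ^ α i‖) ∧
      HasSum (fun α : Fin N → ℕ => ∏ i, x i ^ α i) (∏ i, (1 - x i)⁻¹) := by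
  induction N with
  | zero =>
    refine ⟨(hasSum_fintype _).summable, ?_⟩
    convert hasSum_fintype fun α : Fin 0 → ℕ => ∏ i, x i ^ α i using 1
    simp
  | succ N ih =>
    obtain ⟨h1, h2⟩ := ih (fun i => x i.succ) fun i => hx i.succ
    have h3 := hasSum_geometric_of_norm_lt_one (hx 0)
    have h4 : Summable fun k : ℕ => ‖x 0 ^ k‖ :=
      (summable_geometric_of_lt_one (norm_nonneg _) (hx 0)).congr fun k => (norm_pow _ _).symm
    have h5 : Summable fun p : ℕ × (Fin N → ℕ) => ‖x 0 ^ p.1 * ∏ i : Fin N, x i.succ ^ p.2 i‖ :=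
      Summable.mul_norm (f := fun k : ℕ => x 0 ^ k)
        (g := fun α : Fin N → ℕ => ∏ i : Fin N, x i.succ ^ α i) h4 h1
    have h6 : HasSum (fun p : ℕ × (Fin N → ℕ) => x 0 ^ p.1 * ∏ i : Fin N, x i.succ ^ p.2 i) _ :=
      HasSum.mul (f := fun k : ℕ => x 0 ^ k)
        (g := fun α : Fin N → ℕ => ∏ i : Fin N, x i.succ ^ α i) h3 h2 h5.of_norm
    have h7 : ∀ p : ℕ × (Fin N → ℕ), ∏ i, x i ^ (Fin.consEquiv (fun _ => ℕ) p) i =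
        x 0 ^ p.1 * ∏ i : Fin N, x i.succ ^ p.2 i := by
      intro p
      rw [Fin.prod_univ_succ]
      rfl
    constructor
    · rw [← (Fin.consEquiv fun _ : Fin (N + 1) => ℕ).summable_iff]
      exact h5.congr fun p => by rw [Function.comp_apply, h7]
    · rw [← (Fin.consEquiv fun _ : Fin (N + 1) => ℕ).hasSum_iff, Fin.prod_univ_succ]
      convert h6 using 1
      exact funext h7

lemma continuous_torusMap {N : ℕ} (c : Fin N → ℂ) (R : Fin N → ℝ) : Continuous (torusMap c R) := by
  unfold torusMap
  fun_prop

lemma norm_torusMap_zero {N : ℕ} {r : ℝ} (hr : 0 ≤ r) (θ : Fin N → ℝ) (i : Fin N) :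
    ‖torusMap 0 (fun _ => r) θ i‖ = r := by
  simp [torusMap, abs_of_nonneg hr]

/-- The Cauchy integral formula for a polydisc. -/
lemma torusIntegral_cauchy {r : ℝ} (hr0 : 0 < r) (hr1 : r < 1) : ∀ (N : ℕ) (G : (Fin N → ℂ) → ℂ),
    DifferentiableOn ℂ G (Metric.ball 0 1) → ∀ z : Fin N → ℂ, (∀ i, ‖z i‖ < r) →
      torusIntegral (fun ζ => (∏ i, (ζ i - z i)⁻¹) * G ζ) 0 (fun _ => r) =
        (2 * (Real.pi : ℂ) * Complex.I) ^ N * G z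
  | 0, G, _, z, _ => by
    rw [torusIntegral_dim0]
    simp [Subsingleton.elim z 0]
  | N + 1, G, hG, z, hz => by
    have hne : ∀ (ζ : Fin (N + 1) → ℂ), (∀ i, ‖ζ i‖ = r) → ∀ i, ζ i - z i ≠ 0 := by
      intro ζ hζ i h
      have := hz i
      rw [← sub_eq_zero.1 h, hζ i] at this
      exact lt_irrefl _ this
    have hball : ∀ ζ : Fin (N + 1) → ℂ, (∀ i, ‖ζ i‖ ≤ r) → ζ ∈ Metric.ball (0 : Fin (N + 1) → ℂ) 1 :=
      fun ζ hζ => mem_ball_zero_iff.2 (((pi_norm_le_iff_of_nonneg hr0.le).2 hζ).trans_lt hr1)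
    have hint : TorusIntegrable (fun ζ => (∏ i, (ζ i - z i)⁻¹) * G ζ) 0 fun _ => r := by
      refine Continuous.integrableOn_Icc ?_
      refine Continuous.mul ?_ ?_
      · refine continuous_finsetProd _ fun i _ => Continuous.inv₀ ?_ fun θ => ?_
        · exact ((continuous_apply i).comp (continuous_torusMap 0 fun _ => r)).sub
            (continuous_const (y := z i))
        · exact hne _ (norm_torusMap_zero hr0.le θ) i
      · exact hG.continuousOn.comp_continuous (continuous_torusMap _ _) fun θ =>
          hball _ fun i => (norm_torusMap_zero hr0.le θ i).le
    rw [torusIntegral_succ hint]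
    -- The last N variables are integrated by induction with the first frozen at x; what remains is
    -- Cauchy's formula in one variable.
    have hinner : ∀ x : ℂ, ‖x‖ ≤ r →
        torusIntegral (fun y : Fin N → ℂ => (∏ i : Fin (N + 1),
          ((Fin.cons x y : Fin (N + 1) → ℂ) i - z i)⁻¹) * G (Fin.cons x y)) 0 (fun _ => r) =
        (2 * (Real.pi : ℂ) * Complex.I) ^ N *
          ((x - z 0)⁻¹ • G (Fin.cons x fun i => z i.succ)) := by
      intro x hx
      have h1 : DifferentiableOn ℂ (fun y : Fin N → ℂ => G (Fin.cons x y)) (Metric.ball 0 1) := by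
        refine hG.comp ?_ ?_
        · refine Differentiable.differentiableOn ?_
          refine differentiable_pi.2 fun i => ?_
          refine Fin.cases ?_ (fun j => ?_) i
          · simp
          · simp only [Fin.cons_succ]
            fun_prop
        · intro y hy
          rw [mem_ball_zero_iff, pi_norm_lt_iff one_pos] at hy ⊢
          refine Fin.cases ?_ (fun j => ?_)
          · simpa using hx.trans_lt hr1
          · simpa using hy j
      have h2 := torusIntegral_cauchy hr0 hr1 N _ h1 (fun i => z i.succ) fun i => hz i.succ
      simp only [Fin.prod_univ_succ, Fin.cons_zero, Fin.cons_succ, mul_assoc]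
      rw [torusIntegral_const_mul, h2]
      rw [smul_eq_mul]
      ring
    have h3 : DiffContOnCl ℂ (fun x : ℂ => G (Fin.cons x fun i => z i.succ)) (Metric.ball 0 r) := by
      refine DifferentiableOn.diffContOnCl ?_
      rw [closure_ball _ hr0.ne']
      refine hG.comp ?_ ?_
      · refine Differentiable.differentiableOn ?_
        refine differentiable_pi.2 fun i => ?_
        refine Fin.cases ?_ (fun j => ?_) i
        · simp only [Fin.cons_zero]
          fun_prop
        · simp
      · intro x hx
        refine hball _ (Fin.cases ?_ fun j => ?_)
        · simpa using hx
        · simpa using (hz j.succ).le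
    have h4 := h3.circleIntegral_sub_inv_smul (mem_ball_zero_iff.2 (hz 0))
    refine (circleIntegral.integral_congr hr0.le fun x hx => hinner x ?_).trans ?_
    · exact (mem_sphere_zero_iff_norm.1 hx).le
    · rw [circleIntegral.integral_const_mul]
      simp only [Pi.zero_apply]
      rw [h4, show (Fin.cons (z 0) fun i => z i.succ : Fin (N + 1) → ℂ) = z from
        Fin.cons_self_tail z, smul_eq_mul]
      ring

/-- The power series expansion in a polydisc, with Cauchy's estimates. -/
lemma exists_hasSum_prod {N : ℕ} {r C : ℝ} (hr0 : 0 < r) (hr1 : r < 1) {G : (Fin N → ℂ) → ℂ}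
    (hG : DifferentiableOn ℂ G (Metric.ball 0 1)) (hC : ∀ ζ ∈ Metric.ball 0 1, ‖G ζ‖ ≤ C) :
    ∃ a : (Fin N → ℕ) → ℂ, ∀ z : Fin N → ℂ, (∀ i, ‖z i‖ < r) →
      (Summable fun α => ‖a α * ∏ i, z i ^ α i‖) ∧ HasSum (fun α => a α * ∏ i, z i ^ α i) (G z) := by
  have hball : ∀ ζ : Fin N → ℂ, (∀ i, ‖ζ i‖ ≤ r) → ζ ∈ Metric.ball (0 : Fin N → ℂ) 1 :=
    fun ζ hζ => mem_ball_zero_iff.2 (((pi_norm_le_iff_of_nonneg hr0.le).2 hζ).trans_lt hr1)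
  have hT : ∀ (θ : Fin N → ℝ) i, ‖torusMap 0 (fun _ => r) θ i‖ = r := norm_torusMap_zero hr0.le
  have hT0 : ∀ (θ : Fin N → ℝ) i, torusMap 0 (fun _ => r) θ i ≠ 0 := fun θ i h => by
    have := hT θ i
    rw [h, norm_zero] at this
    exact hr0.ne this
  set c : ℂ := (2 * (Real.pi : ℂ) * Complex.I) ^ N
  have hc : c ≠ 0 := pow_ne_zero _ (by simp [Real.pi_ne_zero])
  -- These coefficients formally depend on r; `monomialCoeff_eq_of_hasSum` later identifies the
  -- relevant ones with the canonical ones.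
  refine ⟨fun α => c⁻¹ * torusIntegral (fun ζ => (∏ i, (ζ i)⁻¹ ^ (α i + 1)) * G ζ) 0 fun _ => r,
    fun z hz => ?_⟩
  set D : ℝ := ∏ _i : Fin N, r
  have hD : ∀ θ : Fin N → ℝ, ‖(∏ i, (r : ℂ) * Complex.exp (θ i * Complex.I) * Complex.I : ℂ)‖ = D := by
    intro θ
    simp [norm_prod, D, Complex.norm_exp_ofReal_mul_I, abs_of_pos hr0]
  have hC0 : 0 ≤ C := (norm_nonneg _).trans (hC 0 (Metric.mem_ball_self one_pos))
  obtain ⟨hgeo, -⟩ := hasSum_prod_geometric N (fun i => ((‖z i‖ / r : ℝ) : ℂ)) fun i => by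
    rw [Complex.norm_real, Real.norm_of_nonneg (by positivity), div_lt_one hr0]
    exact hz i
  have hgeo' : Summable fun α : Fin N → ℕ => ∏ i, (‖z i‖ / r) ^ α i := by
    refine hgeo.congr fun α => ?_
    rw [norm_prod_geometric]
    refine Finset.prod_congr rfl fun i _ => ?_
    rw [Complex.norm_real, Real.norm_of_nonneg (by positivity)]
  have hterm : ∀ (α : Fin N → ℕ) (ζ : Fin N → ℂ),
      ((∏ i, (ζ i)⁻¹ ^ (α i + 1)) * G ζ) * ∏ i, z i ^ α i =
        (∏ i, (ζ i)⁻¹) * G ζ * ∏ i, (z i / ζ i) ^ α i := by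
    intro α ζ
    simp only [pow_succ, Finset.prod_mul_distrib, mul_pow, div_eq_mul_inv, inv_pow]
    ring
  set b : (Fin N → ℕ) → ℝ := fun α => D * ((∏ _i : Fin N, r⁻¹) * C * ∏ i, (‖z i‖ / r) ^ α i)
  have hb : Summable b := (hgeo'.mul_left _).mul_left _
  have hbound : ∀ (α : Fin N → ℕ) (θ : Fin N → ℝ),
      ‖((∏ i, (torusMap 0 (fun _ => r) θ i)⁻¹ ^ (α i + 1)) * G (torusMap 0 (fun _ => r) θ)) *
        ∏ i, z i ^ α i‖ ≤ (∏ _i : Fin N, r⁻¹) * C * ∏ i, (‖z i‖ / r) ^ α i := by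
    intro α θ
    rw [hterm, norm_mul, norm_mul, norm_prod, norm_prod_geometric]
    simp only [norm_inv, norm_div, hT]
    gcongr
    exact hC _ (hball _ fun i => (hT θ i).le)
  -- The Cauchy kernel is expanded as a multivariate geometric series and integrated term by term,
  -- dominated by the series in |z_i|/r.
  have hmain : HasSum (fun α : Fin N → ℕ => torusIntegral
      (fun ζ => ((∏ i, (ζ i)⁻¹ ^ (α i + 1)) * G ζ) * ∏ i, z i ^ α i) 0 fun _ => r)
      (torusIntegral (fun ζ => (∏ i, (ζ i - z i)⁻¹) * G ζ) 0 fun _ => r) := by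
    refine hasSum_integral_of_dominated_convergence (fun α _ => b α) (fun α => ?_) (fun α => ?_)
      (ae_of_all _ fun _ => hb) ?_ (ae_of_all _ fun θ => ?_)
    · refine Continuous.aestronglyMeasurable ?_
      have h0 : Continuous fun θ : Fin N → ℝ =>
          (∏ i, (r : ℂ) * Complex.exp (θ i * Complex.I) * Complex.I : ℂ) := by fun_prop
      refine h0.smul (Continuous.mul (Continuous.mul ?_ ?_) continuous_const)
      · refine continuous_finsetProd _ fun i _ => (Continuous.inv₀ ?_ fun θ => hT0 θ i).pow _
        exact (continuous_apply i).comp (continuous_torusMap 0 fun _ => r)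
      · exact hG.continuousOn.comp_continuous (continuous_torusMap _ _) fun θ =>
          hball _ fun i => (hT θ i).le
    · refine ae_of_all _ fun θ => ?_
      rw [norm_smul, hD]
      exact mul_le_mul_of_nonneg_left (hbound α θ) (Finset.prod_nonneg fun _ _ => hr0.le)
    · exact integrableOn_const (by simp [measure_Icc_lt_top.ne])
    · refine HasSum.const_smul _ ?_
      simp only [hterm]
      have h1 : ∏ i, (torusMap 0 (fun _ => r) θ i - z i)⁻¹ = (∏ i, (torusMap 0 (fun _ => r) θ i)⁻¹) *
          ∏ i, (1 - z i / torusMap 0 (fun _ => r) θ i)⁻¹ := by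
        rw [← Finset.prod_mul_distrib]
        refine Finset.prod_congr rfl fun i _ => ?_
        rw [← mul_inv, mul_sub, mul_one, mul_div_cancel₀ _ (hT0 θ i)]
      rw [h1, mul_right_comm]
      refine HasSum.mul_left _ (hasSum_prod_geometric N _ fun i => ?_).2
      rw [norm_div, hT, div_lt_one hr0]
      exact hz i
  rw [torusIntegral_cauchy hr0 hr1 N G hG z hz] at hmain
  have hcomm : ∀ α : Fin N → ℕ, torusIntegral
      (fun ζ => ((∏ i, (ζ i)⁻¹ ^ (α i + 1)) * G ζ) * ∏ i, z i ^ α i) 0 (fun _ => r) =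
      torusIntegral (fun ζ => (∏ i, (ζ i)⁻¹ ^ (α i + 1)) * G ζ) 0 (fun _ => r) *
        ∏ i, z i ^ α i := by
    intro α
    simp only [mul_comm _ (∏ i, z i ^ α i)]
    exact torusIntegral_const_mul _ _ _ _
  constructor
  · refine Summable.of_nonneg_of_le (fun _ => norm_nonneg _) (fun α => ?_)
      (hgeo'.mul_left (‖c⁻¹‖ * (((2 * Real.pi) ^ N * ∏ _i : Fin N, |r|) *
        ((∏ _i : Fin N, r⁻¹) * C))))
    rw [mul_assoc c⁻¹, norm_mul, ← hcomm, mul_assoc, mul_assoc]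
    exact mul_le_mul_of_nonneg_left
      (norm_torusIntegral_le_of_norm_le_const (hbound α)) (norm_nonneg _)
  · have := hmain.mul_left c⁻¹
    simp only [hcomm, ← mul_assoc] at this
    rwa [inv_mul_cancel₀ hc, one_mul] at this

/-! ### Finitely supported points and uniqueness of monomial coefficients. -/

lemma embedFin_apply {N : ℕ} (z : Fin N → ℂ) (i : ℕ) :
    embedFin N z i = if h : i < N then z ⟨i, h⟩ else 0 := by
  rw [embedFin, lp.coeFn_sum, Finset.sum_apply]
  split_ifs with h
  · rw [Finset.sum_eq_single ⟨i, h⟩]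
    · simp
    · intro j _ hj
      rw [lp.single_apply, Pi.single_eq_of_ne]
      rintro rfl
      exact hj rfl
    · simp
  · refine Finset.sum_eq_zero fun j _ => ?_
    rw [lp.single_apply, Pi.single_eq_of_ne]
    rintro rfl
    exact h j.2

lemma embedFin_apply_fin {N : ℕ} (z : Fin N → ℂ) (i : Fin N) : embedFin N z i = z i := by
  rw [embedFin_apply, dif_pos i.2]

lemma embedFin_apply_of_le {N : ℕ} (z : Fin N → ℂ) {i : ℕ} (hi : N ≤ i) : embedFin N z i = 0 := by
  rw [embedFin_apply, dif_neg hi.not_gt]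

lemma embedFin_eq_of_forall_ge {N : ℕ} {z : EllInfty} (hz : ∀ i, N ≤ i → z i = 0) :
    embedFin N (fun i => z i) = z := by
  ext i
  rw [embedFin_apply]
  split_ifs with h
  · rfl
  · exact (hz i (not_lt.1 h)).symm

lemma norm_embedFin_le {N : ℕ} {z : Fin N → ℂ} {r : ℝ} (hr : 0 ≤ r) (hz : ∀ i, ‖z i‖ ≤ r) :
    ‖embedFin N z‖ ≤ r := by
  refine lp.norm_le_of_forall_le hr fun i => ?_
  rw [embedFin_apply]
  split_ifs with h
  · exact hz _
  · simpa using hr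

lemma differentiable_embedFin (N : ℕ) : Differentiable ℂ (embedFin N) := by
  let L : (Fin N → ℂ) →ₗ[ℂ] EllInfty :=
    { toFun := embedFin N
      map_add' := fun x y => by
        ext i
        rw [lp.coeFn_add, Pi.add_apply]
        simp only [embedFin_apply]
        split_ifs <;> simp
      map_smul' := fun c x => by
        ext i
        rw [lp.coeFn_smul, Pi.smul_apply]
        simp only [embedFin_apply]
        split_ifs <;> simp }
  exact (LinearMap.toContinuousLinearMap L).differentiable

lemma continuous_embedFin (N : ℕ) : Continuous (embedFin N) :=
  (differentiable_embedFin N).continuous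

lemma seqMonomial_eq_prod_range (z : EllInfty) {N : ℕ} {α : ℕ →₀ ℕ}
    (hα : α.support ⊆ Finset.range N) : seqMonomial z α = ∏ i : Fin N, z i ^ α i := by
  rw [seqMonomial, Finsupp.prod_of_support_subset _ hα _ (by simp), Finset.prod_range]

lemma seqMonomial_eq_zero {z : EllInfty} {N : ℕ} (hz : ∀ i, N ≤ i → z i = 0) {α : ℕ →₀ ℕ}
    (hα : ¬ α.support ⊆ Finset.range N) : seqMonomial z α = 0 := by
  obtain ⟨i, hi, hiN⟩ := Finset.not_subset.1 hα
  refine Finset.prod_eq_zero hi ?_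
  change z i ^ α i = 0
  rw [hz i (by simpa using hiN), zero_pow (Finsupp.mem_support_iff.1 hi)]

/-- Extension of a multi-index by zero. -/
def extendIndex {N : ℕ} (α : Fin N → ℕ) : ℕ →₀ ℕ :=
  (Finsupp.equivFunOnFinite.symm α).embDomain Fin.valEmbedding

lemma extendIndex_apply {N : ℕ} (α : Fin N → ℕ) (i : Fin N) : extendIndex α i = α i :=
  Finsupp.embDomain_apply_self Fin.valEmbedding _ i

lemma support_extendIndex {N : ℕ} (α : Fin N → ℕ) :
    (extendIndex α).support ⊆ Finset.range N := by
  intro i hi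
  rw [extendIndex, Finsupp.support_embDomain] at hi
  obtain ⟨j, -, rfl⟩ := Finset.mem_map.1 hi
  exact Finset.mem_range.2 j.2

lemma extendIndex_injective (N : ℕ) : Function.Injective (extendIndex (N := N)) := fun α β h =>
  funext fun i => by rw [← extendIndex_apply α, h, extendIndex_apply]

lemma extendIndex_restrict {N : ℕ} {β : ℕ →₀ ℕ} (hβ : β.support ⊆ Finset.range N) :
    extendIndex (fun i : Fin N => β i) = β := by
  ext i
  rcases lt_or_ge i N with h | h
  · exact extendIndex_apply _ ⟨i, h⟩
  · rw [Finsupp.notMem_support_iff.1 fun hi => h.not_gt (Finset.mem_range.1 (hβ hi)),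
      Finsupp.notMem_support_iff.1 fun hi =>
        h.not_gt (Finset.mem_range.1 (support_extendIndex _ hi))]

lemma seqMonomial_extendIndex (z : EllInfty) {N : ℕ} (α : Fin N → ℕ) :
    seqMonomial z (extendIndex α) = ∏ i : Fin N, z i ^ α i := by
  rw [seqMonomial_eq_prod_range z (support_extendIndex α)]
  simp only [extendIndex_apply]

/-- The monomial expansion of a bounded holomorphic function of finitely many variables. -/
lemma exists_hasSum_seqMonomial {f : EllInfty → ℂ} (hf : f ∈ HInftyPolydisc) (N : ℕ) {r : ℝ}
    (hr0 : 0 < r) (hr1 : r < 1) :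
    ∃ a : (ℕ →₀ ℕ) → ℂ, ∀ z : EllInfty, (∀ i, N ≤ i → z i = 0) → ‖z‖ < r →
      (Summable fun α => ‖a α * seqMonomial z α‖) ∧
        HasSum (fun α => a α * seqMonomial z α) (f z) := by
  obtain ⟨hd, C, hC⟩ := hf
  have hmaps : Set.MapsTo (embedFin N) (Metric.ball 0 1) polydisc := by
    intro ζ hζ
    rw [mem_polydisc]
    exact (norm_embedFin_le (norm_nonneg ζ) (norm_le_pi_norm ζ)).trans_lt
      (mem_ball_zero_iff.1 hζ)
  obtain ⟨a, ha⟩ := exists_hasSum_prod hr0 hr1 (G := fun ζ => f (embedFin N ζ))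
    (hd.comp (differentiable_embedFin N).differentiableOn hmaps) fun ζ hζ => hC _ (hmaps hζ)
  -- Multi-indices reaching beyond N receive arbitrary coefficients here; this is harmless, as their
  -- monomials vanish at the points considered.
  refine ⟨fun β => a fun i => β i, fun z hzN hz => ?_⟩
  obtain ⟨h1, h2⟩ := ha (fun i => z i) fun i => (norm_coord_le z i).trans_lt hz
  rw [embedFin_eq_of_forall_ge hzN] at h2
  have hoff : ∀ β : ℕ →₀ ℕ, β ∉ Set.range (extendIndex (N := N)) → seqMonomial z β = 0 :=
    fun β hβ => seqMonomial_eq_zero hzN fun h => hβ ⟨_, extendIndex_restrict h⟩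
  have hterm : ∀ α : Fin N → ℕ, (a fun i : Fin N => extendIndex α i) * seqMonomial z (extendIndex α) =
      a α * ∏ i : Fin N, z i ^ α i := by
    intro α
    rw [seqMonomial_extendIndex]
    simp only [extendIndex_apply]
  constructor
  · rw [← (extendIndex_injective N).summable_iff fun β hβ => by simp [hoff β hβ]]
    exact h1.congr fun α => by rw [Function.comp_apply, hterm]
  · rw [← (extendIndex_injective N).hasSum_iff fun β hβ => by simp [hoff β hβ]]
    convert h2 using 1
    exact funext hterm

lemma lt_multiIndexLength {α : ℕ →₀ ℕ} {i : ℕ} (hi : i ∈ α.support) : i < multiIndexLength α :=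
  Finset.le_sup (f := Nat.succ) hi

lemma support_subset_range_multiIndexLength (α : ℕ →₀ ℕ) :
    α.support ⊆ Finset.range (multiIndexLength α) := fun _ hi =>
  Finset.mem_range.2 (lt_multiIndexLength hi)

lemma multiIndexLength_le {α : ℕ →₀ ℕ} {N : ℕ} (hα : α.support ⊆ Finset.range N) :
    multiIndexLength α ≤ N :=
  Finset.sup_le fun _ hi => Nat.succ_le_of_lt (Finset.mem_range.1 (hα hi))

lemma integral_circle_pow_div (m n : ℕ) :
    ∫ t in Set.Icc 0 (2 * Real.pi), ((1 / 2 : ℝ) : ℂ) * Complex.exp (t * Complex.I) * Complex.I *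
      ((((1 / 2 : ℝ) : ℂ) * Complex.exp (t * Complex.I)) ^ m /
        (((1 / 2 : ℝ) : ℂ) * Complex.exp (t * Complex.I)) ^ (n + 1)) =
      if m = n then 2 * (Real.pi : ℂ) * Complex.I else 0 := by
  have h1 := circleIntegral_def_Icc (fun z : ℂ => (z - 0) ^ ((m : ℤ) - (n + 1 : ℕ))) 0 (1 / 2)
  have h2 : ∀ t : ℝ, circleMap 0 (1 / 2) t ≠ 0 := fun t => by simp [circleMap]
  have h3 : (∮ z in C(0, 1 / 2), (z - 0) ^ ((m : ℤ) - (n + 1 : ℕ))) =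
      if m = n then 2 * (Real.pi : ℂ) * Complex.I else 0 := by
    split_ifs with h
    · subst h
      have : (m : ℤ) - (m + 1 : ℕ) = -1 := by push_cast; ring
      simp only [this, zpow_neg_one]
      exact circleIntegral.integral_sub_center_inv 0 (by norm_num)
    · exact circleIntegral.integral_sub_zpow_of_ne (by push_cast; omega) _ _ _
  rw [← h3, h1]
  refine setIntegral_congr_fun measurableSet_Icc fun t _ => ?_
  simp only [deriv_circleMap, sub_zero, smul_eq_mul]
  rw [zpow_sub₀ (h2 t), zpow_natCast, zpow_natCast]
  simp [circleMap]

lemma torusIntegral_monomial {k : ℕ} (m n : Fin k → ℕ) :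
    torusIntegral (fun z : Fin k → ℂ => (∏ i, z i ^ m i) / ∏ i, z i ^ (n i + 1)) 0
      (fun _ => (1 / 2 : ℝ)) = if m = n then (2 * (Real.pi : ℂ) * Complex.I) ^ k else 0 := by
  have h1 : (volume : Measure (Fin k → ℝ)).restrict (Set.Icc (0 : Fin k → ℝ) fun _ => 2 * Real.pi) =
      Measure.pi fun _ : Fin k => (volume : Measure ℝ).restrict (Set.Icc 0 (2 * Real.pi)) := by
    rw [← Set.pi_univ_Icc, volume_pi, Measure.restrict_pi_pi]
    rfl
  rw [torusIntegral, h1]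
  have h2 := integral_fintype_prod_eq_prod (𝕜 := ℂ) (fun (i : Fin k) (t : ℝ) =>
    ((1 / 2 : ℝ) : ℂ) * Complex.exp (t * Complex.I) * Complex.I *
      ((((1 / 2 : ℝ) : ℂ) * Complex.exp (t * Complex.I)) ^ m i /
        (((1 / 2 : ℝ) : ℂ) * Complex.exp (t * Complex.I)) ^ (n i + 1)))
    (μ := fun _ => (volume : Measure ℝ).restrict (Set.Icc 0 (2 * Real.pi)))
  simp only [integral_circle_pow_div] at h2
  refine Eq.trans (integral_congr_ae (ae_of_all _ fun θ => ?_)) (h2.trans ?_)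
  · simp only [torusMap, Pi.zero_apply, zero_add, smul_eq_mul]
    rw [← Finset.prod_div_distrib, ← Finset.prod_mul_distrib]
  · split_ifs with h
    · simp [h]
    · obtain ⟨i, hi⟩ := Function.ne_iff.1 h
      exact Finset.prod_eq_zero (Finset.mem_univ i) (if_neg hi)

/-- The monomial coefficients of a function given by a convergent monomial series on finitely
many variables. -/
lemma monomialCoeff_eq_of_hasSum {f : EllInfty → ℂ} {a : (ℕ →₀ ℕ) → ℂ} (α : ℕ →₀ ℕ)
    (hf : ∀ z : EllInfty, (∀ i, multiIndexLength α ≤ i → z i = 0) → ‖z‖ ≤ 1 / 2 →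
      (Summable fun β => ‖a β * seqMonomial z β‖) ∧
        HasSum (fun β => a β * seqMonomial z β) (f z)) :
    monomialCoeff f α = a α := by
  set k := multiIndexLength α
  have hT : ∀ (θ : Fin k → ℝ) i, ‖torusMap 0 (fun _ => (1 / 2 : ℝ)) θ i‖ = 1 / 2 :=
    norm_torusMap_zero (by norm_num)
  have hnorm : ∀ z : Fin k → ℂ, (∀ i, ‖z i‖ = 1 / 2) → ‖embedFin k z‖ ≤ 1 / 2 :=
    fun z hz => norm_embedFin_le (by norm_num) fun i => (hz i).le
  have hc : (2 * (Real.pi : ℂ) * Complex.I) ^ k ≠ 0 := pow_ne_zero _ (by simp [Real.pi_ne_zero])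
  -- All points of the torus of radius 1/2 give a monomial the same modulus, so absolute convergence
  -- at this single point dominates the series on the whole torus.
  set z₀ : Fin k → ℂ := fun _ => ((1 / 2 : ℝ) : ℂ)
  have hz₀ : ∀ i, ‖z₀ i‖ = 1 / 2 := fun i => by
    rw [Complex.norm_real, Real.norm_of_nonneg (by norm_num)]
  have hsum := (hf (embedFin k z₀) (fun i hi => embedFin_apply_of_le _ hi) (hnorm _ hz₀)).1
  have hsize : ∀ (z : Fin k → ℂ), (∀ i, ‖z i‖ = 1 / 2) → ∀ β,
      ‖seqMonomial (embedFin k z) β‖ = ‖seqMonomial (embedFin k z₀) β‖ := by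
    intro z hz β
    by_cases hβ : β.support ⊆ Finset.range k
    · rw [seqMonomial_eq_prod_range _ hβ, seqMonomial_eq_prod_range _ hβ]
      simp only [embedFin_apply_fin, norm_prod, norm_pow, hz, hz₀]
    · rw [seqMonomial_eq_zero (fun i hi => embedFin_apply_of_le _ hi) hβ,
        seqMonomial_eq_zero (fun i hi => embedFin_apply_of_le _ hi) hβ]
  set D : ℝ := ‖(∏ _i : Fin k, ((1 / 2 : ℝ) : ℂ))‖
  have hD : ∀ θ : Fin k → ℝ,
      ‖(∏ i, ((1 / 2 : ℝ) : ℂ) * Complex.exp (θ i * Complex.I) * Complex.I : ℂ)‖ = D := by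
    intro θ
    simp only [norm_prod, D, norm_mul, Complex.norm_exp_ofReal_mul_I, Complex.norm_I, mul_one]
  set M : ℝ := ∏ i : Fin k, (1 / 2 : ℝ) ^ (α i + 1)
  have hM : ∀ z : Fin k → ℂ, (∀ i, ‖z i‖ = 1 / 2) → ‖∏ i : Fin k, z i ^ (α i + 1)‖ = M := by
    intro z hz
    simp only [norm_prod, norm_pow, hz, M]
  have hmain : HasSum (fun β => torusIntegral (fun z : Fin k → ℂ =>
      a β * seqMonomial (embedFin k z) β / ∏ i : Fin k, z i ^ (α i + 1)) 0 fun _ => (1 / 2 : ℝ))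
      (torusIntegral (fun z : Fin k → ℂ => f (embedFin k z) / ∏ i : Fin k, z i ^ (α i + 1)) 0
        fun _ => (1 / 2 : ℝ)) := by
    refine hasSum_integral_of_dominated_convergence
      (fun β _ => D * (‖a β * seqMonomial (embedFin k z₀) β‖ / M)) (fun β => ?_) (fun β => ?_)
      (ae_of_all _ fun _ => (hsum.div_const _).mul_left _) ?_ (ae_of_all _ fun θ => ?_)
    · refine Continuous.aestronglyMeasurable ?_
      have h0 : Continuous fun θ : Fin k → ℝ =>
          (∏ i, ((1 / 2 : ℝ) : ℂ) * Complex.exp (θ i * Complex.I) * Complex.I : ℂ) := by fun_prop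
      refine h0.smul (Continuous.div (continuous_const.mul ?_) ?_ fun θ h => ?_)
      · by_cases hβ : β.support ⊆ Finset.range k
        · simp only [seqMonomial_eq_prod_range _ hβ, embedFin_apply_fin]
          exact continuous_finsetProd _ fun i _ =>
            ((continuous_apply i).comp (continuous_torusMap 0 fun _ => (1 / 2 : ℝ))).pow _
        · simp only [seqMonomial_eq_zero (fun i hi => embedFin_apply_of_le _ hi) hβ]
          exact continuous_const
      · exact continuous_finsetProd _ fun i _ =>
          ((continuous_apply i).comp (continuous_torusMap 0 fun _ => (1 / 2 : ℝ))).pow _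
      · have := hM _ (hT θ)
        rw [h, norm_zero] at this
        exact (Finset.prod_pos fun i _ => by positivity : 0 < M).ne this
    · refine ae_of_all _ fun θ => ?_
      rw [norm_smul, hD, norm_div, hM _ (hT θ), norm_mul, hsize _ (hT θ), norm_mul]
    · exact integrableOn_const (by simp [measure_Icc_lt_top.ne])
    · exact ((hf _ (fun i hi => embedFin_apply_of_le _ hi) (hnorm _ (hT θ))).2.div_const _).const_smul _
  have hterm : ∀ β, torusIntegral (fun z : Fin k → ℂ =>
      a β * seqMonomial (embedFin k z) β / ∏ i : Fin k, z i ^ (α i + 1)) 0 (fun _ => (1 / 2 : ℝ)) =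
      if β = α then (2 * (Real.pi : ℂ) * Complex.I) ^ k * a α else 0 := by
    intro β
    by_cases hβ : β.support ⊆ Finset.range k
    · simp only [seqMonomial_eq_prod_range _ hβ, embedFin_apply_fin, mul_div_assoc]
      rw [torusIntegral_const_mul, torusIntegral_monomial (fun i => β i) fun i => α i]
      by_cases h : β = α
      · simp [h, mul_comm]
      · rw [if_neg h, if_neg, mul_zero]
        intro h'
        refine h ?_
        rw [← extendIndex_restrict hβ, h',
          extendIndex_restrict (support_subset_range_multiIndexLength α)]
    · rw [if_neg]
      · simp only [seqMonomial_eq_zero (fun i hi => embedFin_apply_of_le _ hi) hβ, mul_zero, zero_div]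
        simp [torusIntegral]
      · rintro rfl
        exact hβ (support_subset_range_multiIndexLength β)
  simp only [hterm] at hmain
  have := hmain.unique (hasSum_ite_eq α _)
  rw [monomialCoeff, this, inv_mul_cancel_left₀ hc]

/-- The monomial expansion of a bounded holomorphic function at finitely supported points. -/
lemma hasSum_monomialCoeff {f : EllInfty → ℂ} (hf : f ∈ HInftyPolydisc) {N : ℕ} {z : EllInfty}
    (hzN : ∀ i, N ≤ i → z i = 0) (hz : ‖z‖ < 1) :
    (Summable fun α => ‖monomialCoeff f α * seqMonomial z α‖) ∧
      HasSum (fun α => monomialCoeff f α * seqMonomial z α) (f z) := by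
  -- The radius must exceed ‖z‖ to reach z, and 1/2 to cover the torus on which the coefficients are
  -- defined.
  obtain ⟨r, hr, hr1⟩ := exists_between (max_lt hz (by norm_num : (1 / 2 : ℝ) < 1))
  obtain ⟨h1, h2⟩ := max_lt_iff.1 hr
  obtain ⟨a, ha⟩ := exists_hasSum_seqMonomial hf N (by linarith) hr1
  have hcoeff : ∀ α : ℕ →₀ ℕ,
      a α * seqMonomial z α = monomialCoeff f α * seqMonomial z α := by
    intro α
    by_cases hα : α.support ⊆ Finset.range N
    · rw [monomialCoeff_eq_of_hasSum α fun y hy hy' =>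
        ha y (fun i hi => hy i ((multiIndexLength_le hα).trans hi)) (hy'.trans_lt h2)]
    · simp [seqMonomial_eq_zero hzN hα]
  simpa only [hcoeff] using ha z hzN h1

/-! ### From the polydisc to the polytorus -/

lemma support_subset_of_fejerWeight_ne_zero {n : ℕ} {α : ℕ →₀ ℕ} (h : fejerWeight n α ≠ 0) :
    α.support ⊆ Finset.range n := by
  have h1 : ((fejerBox n).filter fun γ => γ + α ∈ fejerBox n).Nonempty := by
    rw [← Finset.card_ne_zero]
    intro h0
    exact h (by rw [fejerWeight, h0, Nat.cast_zero, zero_div])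
  obtain ⟨γ, hγ⟩ := h1
  refine Finset.Subset.trans ?_ (mem_fejerBox.1 (Finset.mem_filter.1 hγ).2).1
  intro i hi
  rw [Finsupp.mem_support_iff] at hi ⊢
  rw [Finsupp.add_apply]
  omega

lemma sum_norm_sq_le_of_norm_eval_le {Q : MvPolynomial ℕ ℂ} {C : ℝ}
    (hQ : ∀ w, ‖MvPolynomial.eval (torusPoint w) Q‖ ≤ C) :
    ∑ α ∈ Q.support, ‖Q.coeff α‖ ^ 2 ≤ C ^ 2 := by
  rw [← integral_norm_sq_eval]
  refine (integral_mono (integrable_of_continuous_polytorus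
    ((continuous_eval_torusPoint Q).norm.pow 2)) (integrable_const (C ^ 2))
    fun w => pow_le_pow_left₀ (norm_nonneg _) (hQ w) 2).trans_eq ?_
  simp

lemma sum_norm_coeff_sq_le (Q : MvPolynomial ℕ ℂ) (A : Finset (ℕ →₀ ℕ)) :
    ∑ α ∈ A, ‖Q.coeff α‖ ^ 2 ≤ ∑ α ∈ Q.support, ‖Q.coeff α‖ ^ 2 := by
  classical
  refine (Finset.sum_le_sum_of_subset_of_nonneg (Finset.subset_union_left (s₂ := Q.support))
    fun _ _ _ => sq_nonneg _).trans_eq ?_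
  refine (Finset.sum_subset Finset.subset_union_right fun α _ hα => ?_).symm
  rw [MvPolynomial.notMem_support_iff.1 hα, norm_zero, sq, zero_mul]

lemma summable_norm_sq_of_fejerMean_bounded {c : (ℕ →₀ ℕ) → ℂ} {C : ℝ}
    (hC : ∀ n w, ‖MvPolynomial.eval (torusPoint w) (fejerMean n c)‖ ≤ C) :
    Summable fun α => ‖c α‖ ^ 2 := by
  refine summable_of_sum_le (c := C ^ 2) (fun _ => sq_nonneg _) fun A => ?_
  have h1 : ∀ n, ∑ α ∈ A, ‖(fejerMean n c).coeff α‖ ^ 2 ≤ C ^ 2 := fun n =>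
    (sum_norm_coeff_sq_le _ A).trans (sum_norm_sq_le_of_norm_eval_le (hC n))
  refine le_of_tendsto' (x := atTop) (tendsto_finsetSum _ fun α _ => ?_) h1
  simp only [coeff_fejerMean]
  have := (((tendsto_ofReal_fejerWeight α).mul_const (c α)).norm).pow 2
  rwa [one_mul] at this

/-- Uniformly bounded Fejér means come from an essentially bounded function. -/
lemma exists_mem_hardySpace_top {c : (ℕ →₀ ℕ) → ℂ} {C : ℝ}
    (hC : ∀ n w, ‖MvPolynomial.eval (torusPoint w) (fejerMean n c)‖ ≤ C) :
    ∃ F : Lp ℂ ∞ polytorusMeasure, F ∈ hardySpace ∞ ∧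
      ∀ α, polytorusFourierCoeff F (natExp α) = c α := by
  have hc := summable_norm_sq_of_fejerMean_bounded hC
  have hmem : ∀ n, MemLp (fun w => MvPolynomial.eval (torusPoint w) (fejerMean n c)) 2
      polytorusMeasure := fun n =>
    MemLp.of_bound (continuous_eval_torusPoint _).aestronglyMeasurable C (ae_of_all _ (hC n))
  -- ε n is the squared ℓ_2 distance between c and the coefficients of its n-th Fejér mean. It tends
  -- to 0 by dominated convergence, which makes the means Cauchy in L_2.
  set ε : ℕ → ℝ := fun n => ∑' α, (1 - fejerWeight n α) ^ 2 * ‖c α‖ ^ 2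
  have hle : ∀ n α, (1 - fejerWeight n α) ^ 2 * ‖c α‖ ^ 2 ≤ ‖c α‖ ^ 2 := fun n α =>
    mul_le_of_le_one_left (sq_nonneg _) (pow_le_one₀
      (sub_nonneg.2 (fejerWeight_le_one n α)) (by linarith [fejerWeight_nonneg n α]))
  have hεs : ∀ n, Summable fun α => (1 - fejerWeight n α) ^ 2 * ‖c α‖ ^ 2 := fun n =>
    Summable.of_nonneg_of_le (fun _ => by positivity) (hle n) hc
  have hε : Tendsto ε atTop (𝓝 0) := by
    have := tendsto_tsum_of_dominated_convergence (𝓕 := atTop)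
      (f := fun n α => (1 - fejerWeight n α) ^ 2 * ‖c α‖ ^ 2) (g := fun _ => (0 : ℝ)) hc
      (fun α => by
        have := (((tendsto_fejerWeight α).const_sub 1).pow 2).mul_const (‖c α‖ ^ 2)
        simpa using this)
      (Eventually.of_forall fun n α => by
        rw [Real.norm_of_nonneg (by positivity)]
        exact hle n α)
    simpa using this
  have hdist : ∀ m n, dist (hmem m).toLp (hmem n).toLp ≤ √(2 * ε m + 2 * ε n) := by
    intro m n
    have hε0 : 0 ≤ 2 * ε m + 2 * ε n := by
      have h : ∀ k, 0 ≤ ε k := fun k => tsum_nonneg fun _ => by positivity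
      linarith [h m, h n]
    rw [dist_eq_norm, ← MemLp.toLp_sub, Lp.norm_toLp]
    have h1 : (fun w => MvPolynomial.eval (torusPoint w) (fejerMean m c)) -
        (fun w => MvPolynomial.eval (torusPoint w) (fejerMean n c)) =
        fun w => MvPolynomial.eval (torusPoint w) (fejerMean m c - fejerMean n c) := by
      ext w
      simp
    rw [h1]
    refine eLpNorm_toReal_le_of_integral_pow_le (q := 1) (continuous_eval_torusPoint _) one_pos
      (by norm_num) (Real.sqrt_nonneg _) ?_
    rw [mul_one, integral_norm_sq_eval, Real.sq_sqrt hε0]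
    refine (((hεs m).mul_left 2).add ((hεs n).mul_left 2)).sum_le_tsum _
      (fun _ _ => by positivity) |>.trans' (Finset.sum_le_sum fun α _ => ?_) |>.trans_eq ?_
    · rw [MvPolynomial.coeff_sub, coeff_fejerMean, coeff_fejerMean, ← sub_mul, norm_mul, mul_pow,
        ← Complex.ofReal_sub, Complex.norm_real, Real.norm_eq_abs, sq_abs]
      nlinarith [mul_nonneg (sq_nonneg ((1 - fejerWeight m α) + (1 - fejerWeight n α)))
        (sq_nonneg ‖c α‖)]
    · rw [Summable.tsum_add ((hεs m).mul_left 2) ((hεs n).mul_left 2), tsum_mul_left, tsum_mul_left]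
  have hcauchy : CauchySeq fun n => (hmem n).toLp := by
    rw [cauchySeq_iff_tendsto_dist_atTop_0]
    refine squeeze_zero (fun _ => dist_nonneg) (fun p => hdist p.1 p.2) ?_
    rw [← prod_atTop_atTop_eq]
    have := (((hε.comp (tendsto_fst (g := (atTop : Filter ℕ)))).const_mul 2).add
      ((hε.comp (tendsto_snd (f := (atTop : Filter ℕ)))).const_mul 2)).sqrt
    simpa using this
  obtain ⟨F, hF⟩ := cauchySeq_tendsto_of_complete hcauchy
  -- The limit is taken in L_2; an almost everywhere convergent subsequence transfers the uniform
  -- bound C to it and puts it in L_∞.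
  obtain ⟨ns, -, hns⟩ := (tendstoInMeasure_of_tendsto_Lp hF).exists_seq_tendsto_ae
  have hFC : ∀ᵐ w ∂polytorusMeasure, ‖F w‖ ≤ C := by
    filter_upwards [hns, ae_all_iff.2 fun n => (hmem n).coeFn_toLp] with w hw hw'
    refine le_of_tendsto' hw.norm fun i => ?_
    rw [hw']
    exact hC _ _
  have hF' : MemLp F ∞ polytorusMeasure := memLp_top_of_bound (Lp.aestronglyMeasurable F) C hFC
  have hcoeff : ∀ k : ℕ →₀ ℤ, Tendsto (fun n => polytorusFourierCoeff
      (fun w => MvPolynomial.eval (torusPoint w) (fejerMean n c)) k) atTop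
      (𝓝 (polytorusFourierCoeff F k)) := by
    intro k
    have := ((fourierCoeffCLM 2 k).continuous.tendsto F).comp hF
    refine this.congr fun n => ?_
    rw [Function.comp_apply, fourierCoeffCLM_apply]
    exact polytorusFourierCoeff_congr_ae (hmem n).coeFn_toLp k
  refine ⟨hF'.toLp, fun k hk => ?_, fun α => ?_⟩
  · rw [polytorusFourierCoeff_congr_ae hF'.coeFn_toLp]
    refine tendsto_nhds_unique (hcoeff k) ?_
    simp only [polytorusFourierCoeff_eval_of_neg _ hk]
    exact tendsto_const_nhds
  · rw [polytorusFourierCoeff_congr_ae hF'.coeFn_toLp]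
    refine tendsto_nhds_unique (hcoeff _) ?_
    simp only [polytorusFourierCoeff_eval, coeff_fejerMean]
    simpa using (tendsto_ofReal_fejerWeight α).mul_const (c α)

lemma polytorusFourierCoeff_of_hasSum {u : (ℕ → Circle) → ℂ} {b : (ℕ →₀ ℕ) → ℂ}
    (hb : Summable fun α => ‖b α‖) (hu : ∀ w, HasSum (fun α => b α * torusChar (natExp α) w) (u w))
    (k : ℕ →₀ ℤ) :
    HasSum (fun α => if natExp α = k then b α else 0) (polytorusFourierCoeff u k) := by
  have h1 : ∀ α, ∫ w, b α * torusChar (natExp α) w * torusChar (-k) w ∂polytorusMeasure =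
      if natExp α = k then b α else 0 := by
    intro α
    simp only [mul_assoc, ← torusChar_add]
    rw [integral_const_mul, integral_torusChar, ← sub_eq_add_neg]
    simp [sub_eq_zero]
  rw [polytorusFourierCoeff_eq]
  simp only [← h1]
  refine hasSum_integral_of_dominated_convergence (fun α _ => ‖b α‖) (fun α => ?_) (fun α => ?_)
    (ae_of_all _ fun _ => hb) (integrable_const _) (ae_of_all _ fun w => (hu w).mul_right _)
  · exact ((continuous_const.mul (continuous_torusChar _)).mul
      (continuous_torusChar _)).aestronglyMeasurable
  · refine ae_of_all _ fun w => ?_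
    rw [norm_mul, norm_mul, norm_torusChar, norm_torusChar, mul_one, mul_one]

/-- The Fejér means of the monomial series of a bounded holomorphic function are bounded. -/
lemma norm_eval_fejerMean_monomialCoeff_le {f : EllInfty → ℂ} (hf : f ∈ HInftyPolydisc) {C : ℝ}
    (hC : ∀ z ∈ polydisc, ‖f z‖ ≤ C) (n : ℕ) (w : ℕ → Circle) :
    ‖MvPolynomial.eval (torusPoint w) (fejerMean n (monomialCoeff f))‖ ≤ C := by
  have key : ∀ r : ℝ, 0 ≤ r → r < 1 → ‖MvPolynomial.eval (fun i => (r : ℂ) * torusPoint w i)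
      (fejerMean n (monomialCoeff f))‖ ≤ C := by
    intro r hr0 hr1
    -- f is restricted to the torus of radius r in the first n variables, where its series converges
    -- absolutely and its Fourier coefficients are b. The Fejér bound applies there, and r → 1
    -- removes the dilation.
    set ζ : (ℕ → Circle) → EllInfty := fun v => embedFin n fun i => (r : ℂ) * torusPoint v i
    have hζ : ∀ v, ζ v ∈ polydisc := fun v => mem_polydisc.2 <|
      (norm_embedFin_le hr0 fun i => by
        simp only [torusPoint, norm_mul, Circle.norm_coe, mul_one, Complex.norm_real,
          Real.norm_of_nonneg hr0, le_refl]).trans_lt hr1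
    have hζn : ∀ v i, n ≤ i → ζ v i = 0 := fun v i hi => embedFin_apply_of_le _ hi
    set b : (ℕ →₀ ℕ) → ℂ := fun α =>
      if α.support ⊆ Finset.range n then (r : ℂ) ^ α.degree * monomialCoeff f α else 0
    have hterm : ∀ v α, monomialCoeff f α * seqMonomial (ζ v) α = b α * torusChar (natExp α) v := by
      intro v α
      simp only [b]
      split_ifs with hα
      · have hdeg : α.degree = ∑ i : Fin n, α i := by
          rw [Finsupp.degree_apply, ← Finset.sum_range fun i => α i]
          exact Finset.sum_subset hα fun i _ hi => by simpa using hi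
        rw [← prod_torusPoint, Finsupp.prod_of_support_subset _ hα _ (by simp),
          seqMonomial_eq_prod_range _ hα, Finset.prod_range, hdeg, ← Finset.prod_pow_eq_pow_sum]
        simp only [ζ, embedFin_apply_fin, mul_pow, Finset.prod_mul_distrib]
        ring
      · rw [seqMonomial_eq_zero (hζn v) hα, mul_zero, zero_mul]
    have hsum : ∀ v, _ := fun v => hasSum_monomialCoeff hf (hζn v) (mem_polydisc.1 (hζ v))
    have hb : Summable fun α => ‖b α‖ := by
      refine (hsum 1).1.congr fun α => ?_
      rw [hterm, norm_mul, norm_torusChar, mul_one]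
    have hu : ∀ v, HasSum (fun α => b α * torusChar (natExp α) v) (f (ζ v)) := fun v => by
      simpa only [hterm] using (hsum v).2
    have hcoeff := polytorusFourierCoeff_of_hasSum hb hu
    have hcont : Continuous fun v => f (ζ v) := by
      refine hf.1.continuousOn.comp_continuous ((continuous_embedFin n).comp ?_) hζ
      exact continuous_pi fun i => continuous_const.mul
        ((continuous_apply (i : ℕ)).comp continuous_torusPoint)
    have hneg : ∀ k : ℕ →₀ ℤ, (∃ i, k i < 0) → polytorusFourierCoeff (fun v => f (ζ v)) k = 0 := by
      rintro k ⟨i, hi⟩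
      refine (hcoeff k).unique ?_
      convert hasSum_zero using 2 with α
      refine if_neg ?_
      rintro rfl
      rw [natExp_apply] at hi
      omega
    have hpos : ∀ α, polytorusFourierCoeff (fun v => f (ζ v)) (natExp α) = b α := by
      intro α
      refine (hcoeff _).unique ?_
      simp only [natExp_injective.eq_iff]
      convert hasSum_ite_eq α (b α) using 2 with β
      split_ifs with h <;> simp [h]
    have := norm_eval_fejerMean_le hcont.aestronglyMeasurable
      (ae_of_all _ fun v => hC _ (hζ v)) hneg n w
    simp only [hpos] at this
    -- The n-th Fejér weight vanishes on multi-indices using variables of index n or more, so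
    -- cutting to n variables loses nothing.
    have heq : fejerMean n b = dilatePolynomial r (fejerMean n (monomialCoeff f)) := by
      ext α
      rw [coeff_dilatePolynomial, coeff_fejerMean, coeff_fejerMean]
      by_cases h : fejerWeight n α = 0
      · simp [h]
      · simp only [b, if_pos (support_subset_of_fejerWeight_ne_zero h)]
        ring
    rwa [heq, eval_dilatePolynomial] at this
  have hcont : Continuous fun r : ℝ => MvPolynomial.eval (fun i => (r : ℂ) * torusPoint w i)
      (fejerMean n (monomialCoeff f)) :=
    (MvPolynomial.continuous_eval _).comp (by fun_prop)
  have hlim : Tendsto (fun r : ℝ => ‖MvPolynomial.eval (fun i => (r : ℂ) * torusPoint w i)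
      (fejerMean n (monomialCoeff f))‖) (𝓝[<] 1)
      (𝓝 ‖MvPolynomial.eval (torusPoint w) (fejerMean n (monomialCoeff f))‖) := by
    have := (hcont.norm.tendsto 1).mono_left (nhdsWithin_le_nhds (s := Set.Iio 1))
    simpa using this
  refine le_of_tendsto hlim ?_
  filter_upwards [Ioo_mem_nhdsLT (zero_lt_one' ℝ)] with r hr
  exact key r hr.1.le hr.2

lemma seqMonomial_truncate (z : EllInfty) (n : ℕ) (α : ℕ →₀ ℕ) :
    seqMonomial (embedFin n fun i => z i) α =
      if α.support ⊆ Finset.range n then seqMonomial z α else 0 := by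
  split_ifs with hα
  · simp only [seqMonomial_eq_prod_range _ hα, embedFin_apply_fin]
  · exact seqMonomial_eq_zero (fun i hi => embedFin_apply_of_le _ hi) hα

lemma tendsto_truncate {z : EllInfty} (hz : ∀ δ : ℝ, 0 < δ → {i | δ ≤ ‖z i‖}.Finite) :
    Tendsto (fun n => embedFin n fun i => z i) atTop (𝓝 z) := by
  rw [Metric.tendsto_atTop]
  intro δ hδ
  obtain ⟨N, hN⟩ := (hz (δ / 2) (by positivity)).bddAbove
  refine ⟨N + 1, fun n hn => ?_⟩
  rw [dist_eq_norm]
  refine lt_of_le_of_lt (lp.norm_le_of_forall_le (by positivity) fun i => ?_) (half_lt_self hδ)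
  rw [lp.coeFn_sub, Pi.sub_apply, embedFin_apply]
  split_ifs with h
  · rw [sub_self, norm_zero]
    positivity
  · rw [zero_sub, norm_neg]
    by_contra hi
    have : i ≤ N := hN (not_le.1 hi).le
    omega

/-- Summability is inherited from a function in H_∞(𝕋^∞) with the same coefficients. The value comes
from truncations of z, where the expansion is known: f is continuous at z, and the series converge
by domination. -/
theorem monHardy_top_subset_monHInftyPolydisc : monHardy ∞ ⊆ monHInftyPolydisc := by
  intro z hz
  refine ⟨hz.1, fun f hf => ?_⟩
  obtain ⟨C, hC⟩ := hf.2
  obtain ⟨F, hF, hFc⟩ := exists_mem_hardySpace_top (norm_eval_fejerMean_monomialCoeff_le hf hC)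
  have hsum : Summable fun α : ℕ →₀ ℕ => ‖monomialCoeff f α * seqMonomial z α‖ := by
    refine (hz.2 F hF).congr fun α => ?_
    rw [← hFc]
    rfl
  refine ⟨hsum, ?_⟩
  have hz1 := mem_polydisc.1 hz.1
  -- Any finite bound on the limsup would do: it makes z a null sequence, so that truncations
  -- approach z in the sup norm.
  have hlt : logLimsup z < ((2 : ℝ) : EReal) :=
    (monHardy_top_subset_setBbar hz).2.trans_lt (by exact_mod_cast one_lt_two)
  have h1 : Tendsto (fun n => f (embedFin n fun i => z i)) atTop (𝓝 (f z)) :=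
    ((hf.1.continuousOn.continuousAt (Metric.isOpen_ball.mem_nhds hz.1)).tendsto).comp
      (tendsto_truncate fun δ hδ => finite_setOf_le_norm hlt hδ)
  have h2 : ∀ n, f (embedFin n fun i => z i) =
      ∑' α, monomialCoeff f α * seqMonomial (embedFin n fun i => z i) α := fun n =>
    ((hasSum_monomialCoeff hf (fun i hi => embedFin_apply_of_le _ hi)
      ((norm_embedFin_le (norm_nonneg z) fun i => norm_coord_le z i).trans_lt hz1)).2.tsum_eq).symm
  have h3 : Tendsto (fun n => ∑' α, monomialCoeff f α * seqMonomial (embedFin n fun i => z i) α)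
      atTop (𝓝 (∑' α, monomialCoeff f α * seqMonomial z α)) := by
    refine tendsto_tsum_of_dominated_convergence hsum (fun α => ?_)
      (Eventually.of_forall fun n α => ?_)
    · refine tendsto_const_nhds.congr' ?_
      filter_upwards [eventually_ge_atTop (multiIndexLength α)] with n hn
      rw [seqMonomial_truncate, if_pos]
      exact (support_subset_range_multiIndexLength α).trans (Finset.range_subset_range.2 hn)
    · rw [seqMonomial_truncate]
      split_ifs
      · exact le_rfl
      · rw [mul_zero, norm_zero]
        exact norm_nonneg _
  simp only [← h2] at h3
  rw [tendsto_nhds_unique h1 h3]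
  exact hsum.of_norm.hasSum

/-! ### From the polytorus to the polydisc -/

section Ultralimit

variable {E : Type*} [NormedAddCommGroup E] [NormedSpace ℂ E]

/-- Quadratic Taylor estimate for a bounded holomorphic function on the disc. -/
lemma norm_sub_sub_deriv_le {φ : ℂ → ℂ} {C M : ℝ} (hM : 1 < M)
    (hφ : DifferentiableOn ℂ φ (Metric.ball 0 M)) (hC : ∀ t ∈ Metric.ball 0 M, ‖φ t‖ ≤ C) :
    ‖φ 1 - φ 0 - deriv φ 0‖ ≤ 4 * C / M ^ 2 := by
  have h0 : (0 : ℂ) ∈ Metric.ball (0 : ℂ) M := Metric.mem_ball_self (by linarith)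
  have h1 : (1 : ℂ) ∈ Metric.ball (0 : ℂ) M := by simpa using hM
  -- Schwarz's lemma is used twice: it bounds the difference quotient by 2C/M, and then the
  -- variation of this quotient between 0 and 1, which is exactly the Taylor remainder.
  have hh : DifferentiableOn ℂ (dslope φ 0) (Metric.ball 0 M) :=
    (Complex.differentiableOn_dslope (Metric.ball_mem_nhds _ (by linarith))).2 hφ
  have hb : ∀ t ∈ Metric.ball (0 : ℂ) M, ‖dslope φ 0 t‖ ≤ 2 * C / M := fun t ht =>
    Complex.norm_dslope_le_div_of_mapsTo_ball hφ (fun s hs => by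
      rw [Metric.mem_closedBall, dist_eq_norm]
      exact (norm_sub_le _ _).trans (by linarith [hC s hs, hC 0 h0])) ht
  have h2 := Complex.dist_le_div_mul_dist_of_mapsTo_ball (R₂ := 4 * C / M) hh (fun s hs => by
    rw [Metric.mem_closedBall, dist_eq_norm]
    refine (norm_sub_le _ _).trans ((add_le_add (hb s hs) (hb 0 h0)).trans_eq ?_)
    ring) h1
  rw [dslope_same, dslope_of_ne _ one_ne_zero, slope_def_field, dist_eq_norm] at h2
  simpa [sq, div_div] using h2

/-- The first order Taylor remainder of a bounded holomorphic function on a ball is quadratic, with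
constants depending only on the bound. -/
lemma exists_linear_approx {g : E → ℂ} {C : ℝ} (hg : DifferentiableOn ℂ g (Metric.ball 0 1))
    (hC : ∀ z ∈ Metric.ball 0 1, ‖g z‖ ≤ C) {x : E} (hx : ‖x‖ < 1) :
    ‖fderiv ℂ g x‖ ≤ 2 * C / (1 - ‖x‖) ∧
      ∀ v : E, ‖v‖ < 1 - ‖x‖ →
        ‖g (x + v) - g x - fderiv ℂ g x v‖ ≤ 4 * C / (1 - ‖x‖) ^ 2 * ‖v‖ ^ 2 := by
  have hR : 0 < 1 - ‖x‖ := by linarith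
  have hC0 : 0 ≤ C := (norm_nonneg _).trans (hC 0 (Metric.mem_ball_self one_pos))
  -- The complex line through x in direction v stays in the ball on a disc of radius M =
  -- (1-‖x‖)/‖v‖, and 4C/M² is the quadratic remainder.
  have hmaps : ∀ v : E, 0 < ‖v‖ → ∀ t ∈ Metric.ball (0 : ℂ) ((1 - ‖x‖) / ‖v‖),
      x + t • v ∈ Metric.ball (0 : E) 1 := by
    intro v hv t ht
    rw [mem_ball_zero_iff] at ht ⊢
    refine (norm_add_le _ _).trans_lt ?_
    rw [norm_smul]
    have := (lt_div_iff₀ hv).1 ht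
    linarith
  have hdiff : ∀ v : E, 0 < ‖v‖ → DifferentiableOn ℂ (fun t : ℂ => g (x + t • v))
      (Metric.ball 0 ((1 - ‖x‖) / ‖v‖)) := fun v hv =>
    hg.comp (Differentiable.differentiableOn (by fun_prop)) (hmaps v hv)
  have hderiv : ∀ v : E, deriv (fun t : ℂ => g (x + t • v)) 0 = fderiv ℂ g x v := by
    intro v
    have h1 : HasFDerivAt g (fderiv ℂ g x) (x + (0 : ℂ) • v) := by
      rw [zero_smul, add_zero]
      exact (hg.differentiableAt (Metric.isOpen_ball.mem_nhds
        (mem_ball_zero_iff.2 hx))).hasFDerivAt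
    have h2 : HasDerivAt (fun t : ℂ => x + t • v) v 0 := by
      simpa using ((hasDerivAt_id (0 : ℂ)).smul_const v).const_add x
    exact (h1.comp_hasDerivAt (0 : ℂ) h2).deriv
  constructor
  · have hsub : Metric.ball x (1 - ‖x‖) ⊆ Metric.ball 0 1 :=
      Metric.ball_subset_ball' (by rw [dist_zero_right]; linarith)
    refine Complex.norm_fderiv_le_div_of_mapsTo_ball (hg.mono hsub) (fun y hy => ?_) hR
    rw [Metric.mem_closedBall, dist_eq_norm]
    exact (norm_sub_le _ _).trans (by linarith [hC y (hsub hy), hC x (mem_ball_zero_iff.2 hx)])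
  · intro v hvR
    rcases (norm_nonneg v).eq_or_lt with hv | hv
    · rw [norm_eq_zero.1 hv.symm]
      simp
    · have := norm_sub_sub_deriv_le ((one_lt_div hv).2 hvR) (hdiff v hv) fun t ht =>
        hC _ (hmaps v hv t ht)
      rw [hderiv, one_smul, zero_smul, add_zero] at this
      refine this.trans_eq ?_
      field_simp

/-- An ultralimit of uniformly bounded holomorphic functions on a ball is holomorphic. -/
theorem exists_differentiableOn_ultralimit {g : ℕ → E → ℂ} {C : ℝ}
    (hg : ∀ n, DifferentiableOn ℂ (g n) (Metric.ball 0 1))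
    (hC : ∀ n, ∀ z ∈ Metric.ball 0 1, ‖g n z‖ ≤ C) (U : Ultrafilter ℕ) :
    ∃ f : E → ℂ, DifferentiableOn ℂ f (Metric.ball 0 1) ∧ (∀ z ∈ Metric.ball 0 1, ‖f z‖ ≤ C) ∧
      ∀ z ∈ Metric.ball 0 1, Tendsto (fun n => g n z) U (𝓝 (f z)) := by
  -- Along an ultrafilter bounded values converge at every point at once; this needs no separability
  -- of E, and ℓ_∞ is not separable.
  have hlim : ∀ z : E, ∃ y : ℂ, z ∈ Metric.ball 0 1 → ‖y‖ ≤ C ∧ Tendsto (fun n => g n z) U (𝓝 y) := by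
    intro z
    by_cases hz : z ∈ Metric.ball 0 1
    · obtain ⟨y, hy, hy'⟩ := (isCompact_closedBall (0 : ℂ) C).ultrafilter_le_nhds
        (U.map fun n => g n z) (by
          rw [le_principal_iff]
          exact Filter.mem_map.2 (Filter.univ_mem' fun n => by simpa using hC n z hz))
      exact ⟨y, fun _ => ⟨by simpa using hy, hy'⟩⟩
    · exact ⟨0, fun h => absurd h hz⟩
  choose f hf using hlim
  refine ⟨f, fun x hx => DifferentiableAt.differentiableWithinAt ?_, fun z hz => (hf z hz).1,
    fun z hz => (hf z hz).2⟩
  have hx1 : ‖x‖ < 1 := mem_ball_zero_iff.1 hx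
  have happ := fun n => exists_linear_approx (hg n) (hC n) hx1
  -- Banach–Alaoglu provides a weak* ultralimit L of the derivatives at x. The quadratic remainder
  -- estimate is uniform in n, so it survives the limit and makes L the derivative of f.
  obtain ⟨L, -, hL⟩ := (WeakDual.isCompact_closedBall (𝕜 := ℂ) (E := E) 0
    (2 * C / (1 - ‖x‖))).ultrafilter_le_nhds
      (U.map fun n => WeakDual.toStrongDual.symm (fderiv ℂ (g n) x)) (by
        rw [le_principal_iff]
        exact Filter.mem_map.2 (Filter.univ_mem' fun n => by simpa using (happ n).1))
  have hLv : ∀ v : E, Tendsto (fun n => fderiv ℂ (g n) x v) U (𝓝 (L v)) := fun v =>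
    ((WeakDual.eval_continuous v).tendsto L).comp hL
  have hquad : ∀ v : E, ‖v‖ < 1 - ‖x‖ → ‖f (x + v) - f x - WeakDual.toStrongDual L v‖ ≤
      4 * C / (1 - ‖x‖) ^ 2 * ‖v‖ ^ 2 := by
    intro v hv
    have hxv : x + v ∈ Metric.ball (0 : E) 1 :=
      mem_ball_zero_iff.2 ((norm_add_le _ _).trans_lt (by linarith))
    exact le_of_tendsto' ((((hf _ hxv).2.sub (hf x hx).2).sub (hLv v)).norm) fun n =>
      (happ n).2 v hv
  have hder : HasFDerivAt f (WeakDual.toStrongDual L) x := by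
    rw [hasFDerivAt_iff_isLittleO_nhds_zero]
    refine Asymptotics.IsBigO.trans_isLittleO (g := fun v : E => ‖v‖ ^ 2) ?_
      (Asymptotics.isLittleO_norm_pow_id one_lt_two)
    refine Asymptotics.IsBigO.of_bound (4 * C / (1 - ‖x‖) ^ 2) ?_
    filter_upwards [Metric.ball_mem_nhds (0 : E) (sub_pos.2 hx1)] with v hv
    rw [norm_pow, norm_norm]
    exact hquad v (mem_ball_zero_iff.1 hv)
  exact hder.differentiableAt

end Ultralimit

/-! ### Bounded holomorphic functions as ultralimits of Fejér means. -/

lemma differentiable_eval_ellInfty (Q : MvPolynomial ℕ ℂ) :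
    Differentiable ℂ fun z : EllInfty => MvPolynomial.eval (fun i => z i) Q := by
  have h : ∀ i, Differentiable ℂ fun z : EllInfty => z i := fun i =>
    (lp.evalCLM ℂ (fun _ : ℕ => ℂ) ∞ i).differentiable
  induction Q using MvPolynomial.induction_on with
  | C c => simp
  | add P R hP hR =>
    simp only [map_add]
    exact hP.add hR
  | mul_X P i hP =>
    simp only [map_mul, MvPolynomial.eval_X]
    exact hP.mul (h i)

lemma eval_fejerMean_eq_tsum (a : (ℕ →₀ ℕ) → ℂ) (n : ℕ) (z : EllInfty) :
    MvPolynomial.eval (fun i => z i) (fejerMean n a) =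
      ∑' α, fejerWeight n α * (a α * seqMonomial z α) := by
  rw [MvPolynomial.eval_eq, tsum_eq_sum (s := (fejerMean n a).support)]
  · refine Finset.sum_congr rfl fun α _ => ?_
    rw [coeff_fejerMean, mul_assoc]
    rfl
  · intro α hα
    rw [← mul_assoc, ← coeff_fejerMean, MvPolynomial.notMem_support_iff.1 hα, zero_mul]

lemma tendsto_eval_fejerMean {a : (ℕ →₀ ℕ) → ℂ} {z : EllInfty}
    (h : Summable fun α => ‖a α * seqMonomial z α‖) :
    Tendsto (fun n => MvPolynomial.eval (fun i => z i) (fejerMean n a)) atTop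
      (𝓝 (∑' α, a α * seqMonomial z α)) := by
  simp only [eval_fejerMean_eq_tsum]
  refine tendsto_tsum_of_dominated_convergence h (fun α => ?_) (Eventually.of_forall fun n α => ?_)
  · simpa using (tendsto_ofReal_fejerWeight α).mul_const (a α * seqMonomial z α)
  · rw [norm_mul]
    exact mul_le_of_le_one_left (norm_nonneg _) (norm_fejerWeight_le_one n α)

/-- Every function of `H_∞` of the polytorus has the coefficients of a bounded holomorphic function
on the polydisc. -/
lemma exists_mem_HInftyPolydisc {F : Lp ℂ ∞ polytorusMeasure} (hF : F ∈ hardySpace ∞) :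
    ∃ f ∈ HInftyPolydisc, ∀ α, monomialCoeff f α = polytorusFourierCoeff F (natExp α) := by
  obtain ⟨C, hC⟩ := exists_ae_bound_of_Lp_top F
  set a : (ℕ →₀ ℕ) → ℂ := fun α => polytorusFourierCoeff F (natExp α)
  have hQ : ∀ n w, ‖MvPolynomial.eval (torusPoint w) (fejerMean n a)‖ ≤ C :=
    norm_eval_fejerMean_le (Lp.aestronglyMeasurable F) hC hF
  obtain ⟨f, hfd, hfC, hf⟩ := exists_differentiableOn_ultralimit
    (g := fun n (z : EllInfty) => MvPolynomial.eval (fun i => z i) (fejerMean n a))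
    (fun n => (differentiable_eval_ellInfty _).differentiableOn)
    (fun n z hz => norm_eval_le_of_polytorus (hQ n) fun i =>
      (norm_coord_le z i).trans (mem_ball_zero_iff.1 hz).le) (hyperfilter ℕ)
  -- Coefficients only see finitely supported points of norm at most 1/2. These are square summable,
  -- so the series of F converges absolutely there, the Fejér means tend to its sum, and the
  -- ultralimit f equals it.
  refine ⟨f, ⟨hfd, C, hfC⟩, fun α => monomialCoeff_eq_of_hasSum (a := a) α fun z hz0 hz => ?_⟩
  have hz1 : z ∈ polydisc := mem_polydisc.2 (hz.trans_lt (by norm_num))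
  have hz2 : Summable fun n => ‖z n‖ ^ 2 := by
    refine summable_of_ne_finset_zero (s := Finset.range (multiIndexLength α)) fun i hi => ?_
    rw [hz0 i (by simpa using hi), norm_zero, sq, zero_mul]
  have hs : Summable fun β => ‖a β * seqMonomial z β‖ :=
    summable_fourierCoeff_mul_seqMonomial hz1 hz2 (integrable_of_Lp le_top F) hF
  refine ⟨hs, ?_⟩
  rw [tendsto_nhds_unique (hf z hz1) ((tendsto_eval_fejerMean hs).mono_left Nat.hyperfilter_le_atTop)]
  exact hs.of_norm.hasSum

theorem monHInftyPolydisc_subset_monHardy_top : monHInftyPolydisc ⊆ monHardy ∞ := by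
  refine fun z hz => ⟨hz.1, fun F hF => ?_⟩
  obtain ⟨f, hf, hfF⟩ := exists_mem_HInftyPolydisc hF
  refine (hz.2 f hf).1.congr fun α => ?_
  rw [hfF]
  rfl

end

theorem theorem4p7 :
    (monHardy ∞ = monHInftyPolydisc ∧
      (1 / Real.sqrt 2 : ℝ) • setB ⊆ monHardy ∞ ∧ monHardy ∞ ⊆ setBbar) ∧
    (∀ p : ℝ≥0∞, 1 ≤ p → p < ∞ →
      monHardy p = {z : EllInfty | Memℓp (fun n => z n) 2} ∩ polydisc) :=
  ⟨⟨monHardy_top_subset_monHInftyPolydisc.antisymm monHInftyPolydisc_subset_monHardy_top,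
    smul_setB_subset_monHardy_top, monHardy_top_subset_setBbar⟩,
    fun _ hp hp' => monHardy_eq_of_lt_top hp hp'⟩
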